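/- Fix $\ell_0>0$, $\alpha\in(0,1/2)$, $T>0$ and put $J=[-\ell_0/2,\ell_0/2]$. **Spaces.** $C^{h,k}(S\times K)$ is the set of functions on $S\times K$ that are $h$ times (resp. $k$ times) continuously differentiable on $S\times K$ with respect to the first (resp. second) variable. $C_\sharp^{6+\alpha}$ is the set of $f\in C^{6+\alpha}(J)$ with $f^{(j)}(-\ell_0/2)=f^{(j)}(\ell_0/2)$, $j=0,\dots,6$. $\mathscr Y_T$ is the set of $\zeta\in C^{1,4}([0,T]\times J)$ such that $\zeta_\tau\in C^{0,2+\alpha}([0,T]\times J)$ (that is, $\zeta_\tau\in C^{0,2}$ and $\zeta_{\tau\eta\eta}(\tau,\cdot)$ is $\alpha$-Hölder on $J$ uniformly in $\tau$) and $D_\eta^{(j)}\zeta(\cdot,-\ell_0/2)=D_\eta^{(j)}\zeta(\cdot,\ell_0/2)$ for $j=0,1,2,3$. Moreover $$\|f\|_{C^{0,1}([0,T]\times J)}=\sup_{\tau\in[0,T]}\|f(\tau,\cdot)\|_{C^1(J)}+\sup_{\eta\in J}\|f(\cdot,\eta)\|_{C([0,T])},\qquad \|g\|_{C^1(J)}=\sup_J|g|+\sup_J|g'|.$$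 **The K–S solution.** Let $\Phi_0\in C_\sharp^{6+\alpha}$ and let $\Phi\in C^{1,4}([0,T]\times J)$ solve $\Phi_\tau=-3\Phi_{\eta\eta\eta\eta}-\Phi_{\eta\eta}-\frac12(\Phi_\eta)^2$ with $D_\eta^{(k)}\Phi(\cdot,-\ell_0/2)=D_\eta^{(k)}\Phi(\cdot,\ell_0/2)$, $k=0,\dots,3$, and $\Phi(0,\cdot)=\Phi_0$. **The operators.** Let $I_-=(-\infty,0]\times J$, $I_+=[0,\infty)\times J$, and let $\mathscr X$ be the Banach space of pairs ${\bf f}=(f_1,f_2)\in C(I_-)\times C(I_+)$ with $\|{\bf f}\|_{\mathscr X}=\sup_{I_-}e^{-x/2}|f_1|+\sup_{I_+}e^{-x/2}|f_2|<\infty$. Let $\mathscr L{\bf u}=(D_{xx}u_1-D_xu_1+e^xu_1(0,\cdot),\,D_{xx}u_2-D_xu_2)$. For $\varepsilon>0$ let $L+\varepsilon A$ be the operator ${\bf u}\mapsto\mathscr L{\bf u}+\varepsilon{\bf u}_{\eta\eta}$ in $\mathscr X$ whose domain consists of all ${\bf u}$ with $u_1\in C^{2,0}(I_-)\cap C^{0,2}(I_-)$,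 $u_2\in C^{2,0}(I_+)\cap C^{0,2}(I_+)$, ${\bf u},{\bf u}_{\eta\eta},\mathscr L{\bf u}\in\mathscr X$, $D_x^{(j)}u_1(0,\cdot)=D_x^{(j)}u_2(0,\cdot)$ and $D_\eta^{(j)}u_i(\cdot,-\ell_0/2)=D_\eta^{(j)}u_i(\cdot,\ell_0/2)$ ($i=1,2$, $j=0,1$), and let $L_\varepsilon$ be its closure. With $Q({\bf f})=\int_{-\infty}^0f_1(x,\cdot)\,dx+\int_0^\infty e^{-x}f_2(x,\cdot)\,dx$, let $R(0,L_\varepsilon){\bf f}$, for ${\bf f}\in\mathscr X$ with $Q({\bf f})=0$, be the unique ${\bf u}\in D(L_\varepsilon)$ with $Q({\bf u})=0$ and $-L_\varepsilon{\bf u}={\bf f}$. Define pairs of functions of $x\le0$ and of $x\ge0$ by $${\bf T}=(e^x,1),\quad {\bf T}'=(e^x,0),\quad {\bf U}=\Big(\tfrac{1-x}{3}e^x,\tfrac13\Big),\quad {\bf V}=\Big(\big(1-\tfrac23x+\tfrac{x^2}{6}\big)e^x,\,1+\tfrac x3\Big),\quad {\bf W}={\bf V}-{\bf T}-\tfrac43{\bf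 U},$$ and write $\mathscr D_\varepsilon[{\bf f}]=(D_{\eta\eta}R(0,L_\varepsilon){\bf f})(0,\cdot)$ (the value at $x=0$). Put $$\mathscr B_\varepsilon\psi=\psi-\tfrac{13\varepsilon}{3}\psi_{\eta\eta}+3\varepsilon^2\mathscr D_\varepsilon[\psi_{\eta\eta}{\bf W}],\qquad \mathscr S_\varepsilon\psi=-3(1-\varepsilon)\psi_{\eta\eta\eta\eta}-\psi_{\eta\eta}+3\varepsilon\mathscr D_\varepsilon[\psi_{\eta\eta}({\bf T}'-{\bf U})],$$ $$\mathscr G_\varepsilon(\xi)=\tfrac{17}{6}\xi_{\eta\eta}-3\mathscr D_\varepsilon\big[\tfrac12\xi({\bf T}'-{\bf U})+\varepsilon\xi_{\eta\eta}{\bf W}\big],$$ $$\mathscr H_\varepsilon(\Phi)=3\Phi_{\eta\eta\eta\eta}+3\mathscr D_\varepsilon[\Phi_{\eta\eta}({\bf T}'-{\bf U})]+\tfrac{13}{3}\Phi_{\tau\eta\eta}-3\varepsilon\mathscr D_\varepsilon[\Phi_{\tau\eta\eta}{\bf W}].$$ **Statement.** There exist $\varepsilon_0\in(0,1/2)$ and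 $M>0$ (independent of $\varepsilon$ and $\rho$) such that, for every $\varepsilon\in(0,\varepsilon_0]$ and every $\rho\in\mathscr Y_T$ with $\rho(0,\cdot)=0$ that solves on $[0,T]\times J$ the equation $$\frac{\partial}{\partial\tau}\mathscr B_\varepsilon(\rho)=\mathscr S_\varepsilon(\rho)-\Phi_\eta\rho_\eta-\frac\varepsilon2(\rho_\eta)^2+\mathscr G_\varepsilon\big((\Phi_\eta+\varepsilon\rho_\eta)^2\big)+\mathscr H_\varepsilon(\Phi),$$ one has $$\|\rho\|_{C^{0,1}([0,T]\times[-\ell_0/2,\ell_0/2])}\le M.$$ Consequently, the front $\varphi(t,y)=\varepsilon\psi(\varepsilon^2t,\sqrt\varepsilon\,y)$, where $\psi=\Phi+\varepsilon\rho$, satisfies $|\varphi(t,y)-\varepsilon\Phi(\varepsilon^2t,\sqrt\varepsilon\,y)|\le M\varepsilon^2$ for all $0\le t\le T/\varepsilon^2$ and $|y|\le\ell_0/(2\sqrt\varepsilon)$. -/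

import Mathlib

namespace KSFront

open Set
open scoped ENNReal

noncomputable section

/-! ### Function spaces of one and two real variables -/

/-- The interval `[-ℓ/2, ℓ/2]`. -/
def cell (ℓ : ℝ) : Set ℝ := Icc (-(ℓ / 2)) (ℓ / 2)

/-- `D_η^{(j)} f` on `[-ℓ/2, ℓ/2]` (one-sided at the end points). -/
def dEta (ℓ : ℝ) (j : ℕ) (f : ℝ → ℝ) : ℝ → ℝ := iteratedDerivWithin j f (cell ℓ)

/-- `ζ_τ` on the time interval `[0, T]` (one-sided at the end points). -/
def dTau (T : ℝ) (ζ : ℝ → ℝ → ℝ) : ℝ → ℝ → ℝ :=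
  fun τ η => derivWithin (fun s => ζ s η) (Icc 0 T) τ

/-- `C^{h,k}(S × K)`: `h` times continuously differentiable in `S × K` with respect to the first
variable and `k` times with respect to the second one (all derivatives are jointly continuous). -/
structure MemC (h k : ℕ) (S K : Set ℝ) (f : ℝ → ℝ → ℝ) : Prop where
  fst_diff : ∀ z ∈ K, ContDiffOn ℝ h (fun s => f s z) S
  snd_diff : ∀ s ∈ S, ContDiffOn ℝ k (f s) K
  fst_cont : ∀ i ≤ h,
    ContinuousOn (fun p : ℝ × ℝ => iteratedDerivWithin i (fun s => f s p.2) S p.1) (S ×ˢ K)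
  snd_cont : ∀ j ≤ k,
    ContinuousOn (fun p : ℝ × ℝ => iteratedDerivWithin j (f p.1) K p.2) (S ×ˢ K)

/-- `D_η^{(j)} f(-ℓ/2) = D_η^{(j)} f(ℓ/2)` for `j = 0, …, m`. -/
def PeriodicUpTo (ℓ : ℝ) (m : ℕ) (f : ℝ → ℝ) : Prop :=
  ∀ j ≤ m, dEta ℓ j f (-(ℓ / 2)) = dEta ℓ j f (ℓ / 2)

/-- `C_♯^{m+α}` for an integer `m` and `α ∈ (0,1)`. -/
structure MemCSharp (ℓ : ℝ) (m : ℕ) (α : ℝ) (f : ℝ → ℝ) : Prop where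
  diff : ContDiffOn ℝ m f (cell ℓ)
  holder : ∃ C : ℝ, ∀ x ∈ cell ℓ, ∀ y ∈ cell ℓ,
    |dEta ℓ m f x - dEta ℓ m f y| ≤ C * |x - y| ^ α
  periodic : PeriodicUpTo ℓ m f

/-- The space `𝒴_T` (for the Hölder exponent `α`): `ζ ∈ C^{1,4}([0,T] × [-ℓ/2, ℓ/2])`,
`ζ_τ ∈ C^{0,2+α}([0,T] × [-ℓ/2, ℓ/2])`, and `D_η^{(j)} ζ` takes the same values at
`η = -ℓ/2` and `η = ℓ/2` for `j = 0, 1, 2, 3`. -/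
structure MemY (ℓ α T : ℝ) (ζ : ℝ → ℝ → ℝ) : Prop where
  mem : MemC 1 4 (Icc 0 T) (cell ℓ) ζ
  dtau_mem : MemC 0 2 (Icc 0 T) (cell ℓ) (dTau T ζ)
  dtau_holder : ∃ C : ℝ, ∀ τ ∈ Icc 0 T, ∀ x ∈ cell ℓ, ∀ y ∈ cell ℓ,
    |dEta ℓ 2 (dTau T ζ τ) x - dEta ℓ 2 (dTau T ζ τ) y| ≤ C * |x - y| ^ α
  periodic : ∀ τ ∈ Icc 0 T, PeriodicUpTo ℓ 3 (ζ τ)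

/-- The norm of `C^{0,1}([0,T] × [-ℓ/2, ℓ/2])`:
`sup_τ ‖f(τ,·)‖_{C¹} + sup_η ‖f(·,η)‖_{C⁰}`, with values in `[0, ∞]`. -/
def normC01 (ℓ T : ℝ) (f : ℝ → ℝ → ℝ) : ℝ≥0∞ :=
  (⨆ τ ∈ Icc 0 T, ((⨆ η ∈ cell ℓ, ‖f τ η‖ₑ) + ⨆ η ∈ cell ℓ, ‖dEta ℓ 1 (f τ) η‖ₑ)) +
    ⨆ η ∈ cell ℓ, ⨆ τ ∈ Icc 0 T, ‖f τ η‖ₑ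

/-! ### The Kuramoto–Sivashinsky equation -/

/-- `Φ ∈ C^{1,4}([0,T] × [-ℓ/2, ℓ/2])` solves
`Φ_τ = -3 Φ_ηηηη - Φ_ηη - (Φ_η)² / 2` with periodic boundary conditions and `Φ(0,·) = Φ₀`. -/
structure IsKSSolution (ℓ T : ℝ) (Φ₀ : ℝ → ℝ) (Φ : ℝ → ℝ → ℝ) : Prop where
  mem : MemC 1 4 (Icc 0 T) (cell ℓ) Φ
  eqn : ∀ τ ∈ Icc 0 T, ∀ η ∈ cell ℓ,
    dTau T Φ τ η = -3 * dEta ℓ 4 (Φ τ) η - dEta ℓ 2 (Φ τ) η - 1 / 2 * (dEta ℓ 1 (Φ τ) η) ^ 2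
  periodic : ∀ τ ∈ Icc 0 T, PeriodicUpTo ℓ 3 (Φ τ)
  initial : ∀ η ∈ cell ℓ, Φ 0 η = Φ₀ η

/-! ### The space `𝒳` and the operator `L_ε`

A generalized function is a pair `(u₁, u₂)`, with `u₁` a function of `(x, η)` on
`I₋ = (-∞,0] × [-ℓ/2, ℓ/2]` and `u₂` one on `I₊ = [0,∞) × [-ℓ/2, ℓ/2]`; values elsewhere are
ignored. -/

/-- Pairs `(u₁, u₂)` of functions of `(x, η)`. -/
abbrev GenFun : Type := (ℝ → ℝ → ℝ) × (ℝ → ℝ → ℝ)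

/-- The norm of `𝒳`: `sup_{I₋} e^{-x/2}|f₁| + sup_{I₊} e^{-x/2}|f₂|`, with values in `[0, ∞]`. -/
def normX (ℓ : ℝ) (f : GenFun) : ℝ≥0∞ :=
  (⨆ x ∈ Iic (0 : ℝ), ⨆ η ∈ cell ℓ, ‖Real.exp (-x / 2) * f.1 x η‖ₑ) +
    ⨆ x ∈ Ici (0 : ℝ), ⨆ η ∈ cell ℓ, ‖Real.exp (-x / 2) * f.2 x η‖ₑ

/-- Membership in the space `𝒳`. -/
structure MemX (ℓ : ℝ) (f : GenFun) : Prop where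
  cont_fst : ContinuousOn (fun p : ℝ × ℝ => f.1 p.1 p.2) (Iic 0 ×ˢ cell ℓ)
  cont_snd : ContinuousOn (fun p : ℝ × ℝ => f.2 p.1 p.2) (Ici 0 ×ˢ cell ℓ)
  bdd : normX ℓ f < ⊤

/-- `D_x^{(j)} 𝐮`. -/
def dX (j : ℕ) (u : GenFun) : GenFun :=
  (fun x η => iteratedDerivWithin j (fun s => u.1 s η) (Iic 0) x,
   fun x η => iteratedDerivWithin j (fun s => u.2 s η) (Ici 0) x)

/-- `D_η^{(j)} 𝐮`. -/
def dEtaGen (ℓ : ℝ) (j : ℕ) (u : GenFun) : GenFun :=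
  (fun x => dEta ℓ j (u.1 x), fun x => dEta ℓ j (u.2 x))

/-- The differential operator `ℒ`:
`ℒ𝐮 = (D_xx u₁ - D_x u₁ + e^x u₁(0,·), D_xx u₂ - D_x u₂)`. -/
def opL (u : GenFun) : GenFun :=
  (fun x η => (dX 2 u).1 x η - (dX 1 u).1 x η + Real.exp x * u.1 0 η,
   fun x η => (dX 2 u).2 x η - (dX 1 u).2 x η)

/-- The operator `L + εA`, with `A = D_ηη`. -/
def opLA (ℓ ε : ℝ) (u : GenFun) : GenFun := opL u + ε • dEtaGen ℓ 2 u

/-- The domain `D(L + εA)` (the same for all `ε > 0`). -/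
structure MemDomLA (ℓ : ℝ) (u : GenFun) : Prop where
  fst_C20 : MemC 2 0 (Iic 0) (cell ℓ) u.1
  fst_C02 : MemC 0 2 (Iic 0) (cell ℓ) u.1
  snd_C20 : MemC 2 0 (Ici 0) (cell ℓ) u.2
  snd_C02 : MemC 0 2 (Ici 0) (cell ℓ) u.2
  memX : MemX ℓ u
  memX_etaeta : MemX ℓ (dEtaGen ℓ 2 u)
  memX_opL : MemX ℓ (opL u)
  matching : ∀ j ≤ 1, ∀ η ∈ cell ℓ, (dX j u).1 0 η = (dX j u).2 0 η
  periodic_fst : ∀ x ∈ Iic (0 : ℝ), PeriodicUpTo ℓ 1 (u.1 x)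
  periodic_snd : ∀ x ∈ Ici (0 : ℝ), PeriodicUpTo ℓ 1 (u.2 x)

/-- `u ∈ D(L_ε)` and `L_ε u = g`, where `L_ε` is the closure in `𝒳` of `L + εA`: the pair `(u, g)`
lies in the closure in `𝒳 × 𝒳` of the graph of `L + εA`. -/
structure IsLEps (ℓ ε : ℝ) (u g : GenFun) : Prop where
  memX : MemX ℓ u
  memX_image : MemX ℓ g
  approx : ∀ δ : ℝ≥0∞, 0 < δ → ∃ w : GenFun, MemDomLA ℓ w ∧
    normX ℓ (w - u) < δ ∧ normX ℓ (opLA ℓ ε w - g) < δ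

/-- `Q(𝐟) = ∫_{-∞}^0 f₁(x,·) dx + ∫_0^∞ e^{-x} f₂(x,·) dx`; the spectral projection on the kernel
of `L` is `𝒫(𝐟) = Q(𝐟) 𝐔`. -/
def opQ (f : GenFun) (η : ℝ) : ℝ :=
  (∫ x in Iic (0 : ℝ), f.1 x η) + ∫ x in Ioi (0 : ℝ), Real.exp (-x) * f.2 x η

/-- `u = R(0, L_ε) f` with `L_ε` restricted to `(I - 𝒫)(𝒳) = {f ∈ 𝒳 : Q(f) = 0}`:
`u ∈ D(L_ε)`, `Q(u) = 0` and `-L_ε u = f`. -/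
structure IsResolventZero (ℓ ε : ℝ) (f u : GenFun) : Prop where
  eqn : IsLEps ℓ ε u (-f)
  proj : ∀ η ∈ cell ℓ, opQ u η = 0

/-- `R(0, L_ε) f`. -/
def resolventZero (ℓ ε : ℝ) (f : GenFun) : GenFun :=
  Classical.epsilon fun u => IsResolventZero ℓ ε f u

/-- `(D_ηη R(0, L_ε) f)(0, ·)`, the value at `x = 0`. -/
def dEtaEtaRes (ℓ ε : ℝ) (f : GenFun) : ℝ → ℝ :=
  dEta ℓ 2 ((resolventZero ℓ ε f).1 0)

/-! ### The front operators -/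

/-- Pairs `(h₁, h₂)` of functions of `x` alone, on `(-∞,0]` and on `[0,∞)`. -/
abbrev GenFun1 : Type := (ℝ → ℝ) × (ℝ → ℝ)

/-- `𝐓 = (e^x, 1)`. -/
def bT : GenFun1 := (fun x => Real.exp x, fun _ => 1)

/-- `𝐓' = (e^x, 0)`. -/
def bT' : GenFun1 := (fun x => Real.exp x, fun _ => 0)

/-- `𝐔 = ((1-x) e^x / 3, 1/3)`. -/
def bU : GenFun1 := (fun x => (1 - x) / 3 * Real.exp x, fun _ => 1 / 3)

/-- `𝐕 = ((1 - 2x/3 + x²/6) e^x, 1 + x/3)`. -/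
def bV : GenFun1 :=
  (fun x => (1 - 2 / 3 * x + x ^ 2 / 6) * Real.exp x, fun x => 1 + x / 3)

/-- `𝐖 = 𝐕 - 𝐓 - (4/3) 𝐔`. -/
def bW : GenFun1 := bV - bT - (4 / 3 : ℝ) • bU

/-- The generalized function `φ(η) 𝐡(x)`. -/
def tensor (φ : ℝ → ℝ) (h : GenFun1) : GenFun :=
  (fun x η => φ η * h.1 x, fun x η => φ η * h.2 x)

/-- `ℬ_ε ψ = ψ - (13ε/3) ψ_ηη + 3ε² (D_ηη R(0,L_ε)[ψ_ηη 𝐖])(0,·)`. -/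
def opB (ℓ ε : ℝ) (ψ : ℝ → ℝ) (η : ℝ) : ℝ :=
  ψ η - 13 * ε / 3 * dEta ℓ 2 ψ η + 3 * ε ^ 2 * dEtaEtaRes ℓ ε (tensor (dEta ℓ 2 ψ) bW) η

/-- `𝒮_ε ψ = -3(1-ε) ψ_ηηηη - ψ_ηη + 3ε (D_ηη R(0,L_ε)[ψ_ηη (𝐓' - 𝐔)])(0,·)`. -/
def opS (ℓ ε : ℝ) (ψ : ℝ → ℝ) (η : ℝ) : ℝ :=
  -3 * (1 - ε) * dEta ℓ 4 ψ η - dEta ℓ 2 ψ η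
    + 3 * ε * dEtaEtaRes ℓ ε (tensor (dEta ℓ 2 ψ) (bT' - bU)) η

/-- `𝒢_ε(ξ) = (17/6) ξ_ηη - 3 (D_ηη R(0,L_ε)[ξ (𝐓' - 𝐔)/2 + ε ξ_ηη 𝐖])(0,·)`. -/
def opG (ℓ ε : ℝ) (ξ : ℝ → ℝ) (η : ℝ) : ℝ :=
  17 / 6 * dEta ℓ 2 ξ η
    - 3 * dEtaEtaRes ℓ ε
        ((1 / 2 : ℝ) • tensor ξ (bT' - bU) + ε • tensor (dEta ℓ 2 ξ) bW) η

/-- `ℋ_ε(Φ) = 3 Φ_ηηηη + 3 (D_ηη R(0,L_ε)[Φ_ηη (𝐓' - 𝐔)])(0,·) + (13/3) Φ_τηη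
- 3ε (D_ηη R(0,L_ε)[Φ_τηη 𝐖])(0,·)` at time `τ ∈ [0,T]`. -/
def opH (ℓ ε T : ℝ) (Φ : ℝ → ℝ → ℝ) (τ η : ℝ) : ℝ :=
  3 * dEta ℓ 4 (Φ τ) η
    + 3 * dEtaEtaRes ℓ ε (tensor (dEta ℓ 2 (Φ τ)) (bT' - bU)) η
    + 13 / 3 * dEta ℓ 2 (dTau T Φ τ) η
    - 3 * ε * dEtaEtaRes ℓ ε (tensor (dEta ℓ 2 (dTau T Φ τ)) bW) η

/-- `ρ` solves the equation for the remainder on `[0,T] × [-ℓ/2, ℓ/2]`: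
`∂_τ ℬ_ε(ρ) = 𝒮_ε(ρ) - Φ_η ρ_η - (ε/2)(ρ_η)² + 𝒢_ε((Φ_η + ε ρ_η)²) + ℋ_ε(Φ)`. -/
def SolvesRemainderEq (ℓ ε T : ℝ) (Φ ρ : ℝ → ℝ → ℝ) : Prop :=
  ∀ τ ∈ Icc 0 T, ∀ η ∈ cell ℓ,
    HasDerivWithinAt (fun s => opB ℓ ε (ρ s) η)
      (opS ℓ ε (ρ τ) η - dEta ℓ 1 (Φ τ) η * dEta ℓ 1 (ρ τ) η
        - ε / 2 * (dEta ℓ 1 (ρ τ) η) ^ 2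
        + opG ℓ ε (fun y => (dEta ℓ 1 (Φ τ) y + ε * dEta ℓ 1 (ρ τ) y) ^ 2) η
        + opH ℓ ε T Φ τ η)
      (Icc 0 T) τ

/-- The front in the original variables: `φ(t,y) = ε ψ(ε² t, √ε y)` with `ψ = Φ + ε ρ`. -/
def front (ε : ℝ) (Φ ρ : ℝ → ℝ → ℝ) (t y : ℝ) : ℝ :=
  ε * (Φ (ε ^ 2 * t) (√ε * y) + ε * ρ (ε ^ 2 * t) (√ε * y))

end

end KSFront

/-! On the periodic cell every linear operator in the remainder equation is a Fourier multiplier, so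
the equation is a family of scalar ODEs coupled only through products of first derivatives. The
bound is an energy estimate for `ρ_ηη` in which the quadratic term carries a factor `ε²`.

Symbols. Let `λ = (2πk/ℓ)²` and let `a ≥ 1` be the larger root of `a² - a = ελ`. Pairing `-L_ε u =
f` in the variable `x` with `(e^{(a-1)x}, e^{-ax})` removes everything but the trace `u(0,·)`: its
`k`-th coefficient, multiplied by `1/a - (2a-1) = -(2a+1)(a-1)/a`, equals the paired coefficient of
`-f` (`MemDomLA.pair_opL`, `IsLEps.fc_pair`). For `k ≠ 0` this determines the coefficient; for the
profiles `𝐓' - 𝐔` and `𝐖` the condition `Q = 0` makes the factor `a - 1` cancel and leaves the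
rational multipliers `mTU`, `mW`. The mode `k = 0` is killed by `D_ηη`. Since the resolvent is
defined by choice, existence is proved as well: explicit mode solutions (`exists_modeSol`) are
superposed in `exists_isResolventZero`.

Uniform bounds. The identity `symB · (2a+1) = 6a³ - 3a` gives `symB ≥ 1` and `symB ≥ ελ`. Moreover
`symS ≤ -2λ² + 1` for `ε ≤ 1/5`, `|symG| ≤ 3λ`, `|symH| ≤ 4λ²` and `|symHτ| ≤ 5λ`, all uniformly in
`ε`.

Energy. The mode equation is divided by `symB` and tested with weight `λ²`. The dissipation leaves
`|F|²/(4 symB)` of the forcing `F`, and `symB ≥ ελ` pays for the derivatives that `𝒢_ε` puts on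
`εΦ_ηρ_η` and `ε²ρ_η²` (`sq_forcing_div_le`). The terms in `Φ` alone need `∫ ∑ (λ⁴|Φ_k|² +
λ²|(Φ_τ)_k|²)`, which comes from a parabolic estimate for the K–S equation itself
(`IsKSSolution.exists_integral_bound`). The result is `E(t) ≤ C + ∫ (cE + qε²E²)`, and a
continuation argument closes it for small `ε` (`le_of_le_add_integral_sq`). Rolle's theorem then
bounds `ρ_η`, and the ODE of the mode `k = 0` bounds the mean of `ρ`.

Regularity. Class `C^{1,4}` alone gives no control of `Φ_τηη`, which occurs in `ℋ_ε(Φ)`. Smoothing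
for times `τ ≥ δ` supplies it (`IsKSSolution.exists_fourierData_dTau`), and the mode equations are
used on the open interval only. -/

namespace KSFront

open Set MeasureTheory Complex
open scoped ENNReal Real

noncomputable section

/-! ### Fourier series on the cell -/

/-- The exponential `exp (2π i k η / ℓ)`. -/
def fexp (ℓ : ℝ) (k : ℤ) (η : ℝ) : ℂ := Complex.exp (2 * π * I * k * η / ℓ)

/-- The frequency `2πk/ℓ`. -/
def freq (ℓ : ℝ) (k : ℤ) : ℝ := 2 * π * k / ℓ

/-- The eigenvalue `(2πk/ℓ)²` of `-D_ηη`. -/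
def lam (ℓ : ℝ) (k : ℤ) : ℝ := freq ℓ k ^ 2

/-- The Fourier coefficients on the cell of a complex function. -/
def coef (ℓ : ℝ) (f : ℝ → ℂ) (k : ℤ) : ℂ :=
  (ℓ : ℂ)⁻¹ * ∫ x in (-(ℓ / 2))..(ℓ / 2), fexp ℓ (-k) x * f x

/-- The Fourier coefficients on the cell of a real function. -/
def fc (ℓ : ℝ) (f : ℝ → ℝ) (k : ℤ) : ℂ := coef ℓ (fun x => (f x : ℂ)) k

theorem norm_fexp (ℓ : ℝ) (k : ℤ) (η : ℝ) : ‖fexp ℓ k η‖ = 1 := by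
  have : (2 * π * I * k * η / ℓ : ℂ) = ((2 * π * k * η / ℓ : ℝ) : ℂ) * I := by
    push_cast; ring
  rw [fexp, this, Complex.norm_exp_ofReal_mul_I]

theorem hasDerivAt_fexp (ℓ : ℝ) (k : ℤ) (η : ℝ) :
    HasDerivAt (fexp ℓ k) (I * freq ℓ k * fexp ℓ k η) η := by
  have h := hasDerivAt_fourier ℓ k η
  have e : (fun y : ℝ => fourier k (y : AddCircle ℓ)) = fexp ℓ k := by
    ext y; rw [fourier_coe_apply, fexp]
  rw [e, fourier_coe_apply] at h
  convert h using 1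
  simp only [fexp, freq]
  push_cast
  ring

theorem continuous_fexp (ℓ : ℝ) (k : ℤ) : Continuous (fexp ℓ k) :=
  continuous_iff_continuousAt.2 fun η => (hasDerivAt_fexp ℓ k η).continuousAt

theorem fexp_mul (ℓ : ℝ) (j k : ℤ) (η : ℝ) : fexp ℓ j η * fexp ℓ k η = fexp ℓ (j + k) η := by
  rw [fexp, fexp, fexp, ← Complex.exp_add]
  congr 1; push_cast; ring

theorem fexp_ends {ℓ : ℝ} (hℓ : 0 < ℓ) (k : ℤ) : fexp ℓ k (-(ℓ / 2)) = fexp ℓ k (ℓ / 2) := by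
  have hℓ' : (ℓ : ℂ) ≠ 0 := by exact_mod_cast hℓ.ne'
  rw [fexp, fexp, Complex.exp_eq_exp_iff_exists_int]
  refine ⟨-k, ?_⟩
  push_cast
  field_simp
  ring

theorem fexp_zero (ℓ η : ℝ) : fexp ℓ 0 η = 1 := by simp [fexp]

theorem lam_nonneg (ℓ : ℝ) (k : ℤ) : 0 ≤ lam ℓ k := sq_nonneg _

theorem freq_ne_zero {ℓ : ℝ} (hℓ : 0 < ℓ) {k : ℤ} (hk : k ≠ 0) : freq ℓ k ≠ 0 := by
  have : (k : ℝ) ≠ 0 := by exact_mod_cast hk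
  have := Real.pi_pos
  unfold freq; positivity

theorem lam_pos {ℓ : ℝ} (hℓ : 0 < ℓ) {k : ℤ} (hk : k ≠ 0) : 0 < lam ℓ k :=
  pow_pos (abs_pos.2 (freq_ne_zero hℓ hk)) 2 |>.trans_eq (sq_abs _)

theorem lam_zero (ℓ : ℝ) : lam ℓ 0 = 0 := by simp [lam, freq]

theorem lam_eq (ℓ : ℝ) (k : ℤ) : lam ℓ k = lam ℓ 1 * (k : ℝ) ^ 2 := by
  simp only [lam, freq]; push_cast; ring

theorem lam_one_le {ℓ : ℝ} {k : ℤ} (hk : k ≠ 0) : lam ℓ 1 ≤ lam ℓ k := by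
  rw [lam_eq ℓ k]
  have : (1 : ℝ) ≤ (k : ℝ) ^ 2 := by
    have : (1 : ℤ) ≤ k ^ 2 := by
      have := sq_nonneg k
      have : k ^ 2 ≠ 0 := pow_ne_zero 2 hk
      omega
    exact_mod_cast this
  nlinarith [lam_nonneg ℓ 1]

/-- The term `k = 0` is `0⁻¹ = 0`, so the sum is in effect over `k ≠ 0`, where it is a multiple of
`∑ 1/k²`. -/
theorem summable_inv_lam (ℓ : ℝ) : Summable fun k : ℤ => (lam ℓ k)⁻¹ := by
  have h : Summable fun k : ℤ => (lam ℓ 1)⁻¹ * (1 / (k : ℝ) ^ 2) :=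
    ((Real.summable_one_div_int_pow (p := 2)).2 (by norm_num)).mul_left _
  exact h.congr fun k => by rw [lam_eq ℓ k, mul_inv, one_div]

/-! ### Fourier coefficients on the cell: linearity, Parseval, uniqueness, derivatives. -/

theorem cell_eq_uIcc {ℓ : ℝ} (hℓ : 0 < ℓ) : cell ℓ = uIcc (-(ℓ / 2)) (ℓ / 2) := by
  rw [uIcc_of_le (by linarith), cell]

theorem uniqueDiffOn_cell {ℓ : ℝ} (hℓ : 0 < ℓ) : UniqueDiffOn ℝ (cell ℓ) :=
  uniqueDiffOn_Icc (by linarith)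

theorem left_mem_cell {ℓ : ℝ} (hℓ : 0 < ℓ) : -(ℓ / 2) ∈ cell ℓ := ⟨le_rfl, by linarith⟩

theorem right_mem_cell {ℓ : ℝ} (hℓ : 0 < ℓ) : ℓ / 2 ∈ cell ℓ := ⟨by linarith, le_rfl⟩

theorem isCompact_cell (ℓ : ℝ) : IsCompact (cell ℓ) := isCompact_Icc

theorem _root_.ContinuousOn.ofReal_comp {X : Type*} [TopologicalSpace X] {f : X → ℝ} {s : Set X}
    (hf : ContinuousOn f s) : ContinuousOn (fun x => (f x : ℂ)) s :=
  Complex.continuous_ofReal.comp_continuousOn hf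

theorem continuousOn_const_mul {X : Type*} [TopologicalSpace X] {f : X → ℝ} {s : Set X} (c : ℝ)
    (hf : ContinuousOn f s) : ContinuousOn (fun x => c * f x) s := continuousOn_const.mul hf

theorem continuousOn_fun_add {X : Type*} [TopologicalSpace X] {f g : X → ℝ} {s : Set X}
    (hf : ContinuousOn f s) (hg : ContinuousOn g s) : ContinuousOn (fun x => f x + g x) s :=
  hf.add hg

theorem intervalIntegrable_cell {E : Type*} [NormedAddCommGroup E] {ℓ : ℝ} (hℓ : 0 < ℓ)
    {f : ℝ → E} (hf : ContinuousOn f (cell ℓ)) :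
    IntervalIntegrable f volume (-(ℓ / 2)) (ℓ / 2) :=
  ContinuousOn.intervalIntegrable (by rwa [← cell_eq_uIcc hℓ])

theorem intervalIntegrable_fexp_mul {ℓ : ℝ} (hℓ : 0 < ℓ) {f : ℝ → ℂ}
    (hf : ContinuousOn f (cell ℓ)) (k : ℤ) :
    IntervalIntegrable (fun x => fexp ℓ k x * f x) volume (-(ℓ / 2)) (ℓ / 2) :=
  intervalIntegrable_cell hℓ ((continuous_fexp ℓ k).continuousOn.mul hf)

theorem coef_congr {ℓ : ℝ} (hℓ : 0 < ℓ) {f g : ℝ → ℂ} (h : ∀ x ∈ cell ℓ, f x = g x) (k : ℤ) :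
    coef ℓ f k = coef ℓ g k := by
  unfold coef
  congr 1
  refine intervalIntegral.integral_congr fun x hx => ?_
  rw [← cell_eq_uIcc hℓ] at hx
  simp only [h x hx]

theorem fc_congr {ℓ : ℝ} (hℓ : 0 < ℓ) {f g : ℝ → ℝ} (h : ∀ x ∈ cell ℓ, f x = g x) (k : ℤ) :
    fc ℓ f k = fc ℓ g k := coef_congr hℓ (fun x hx => by rw [h x hx]) k

theorem coef_add {ℓ : ℝ} (hℓ : 0 < ℓ) {f g : ℝ → ℂ} (hf : ContinuousOn f (cell ℓ))
    (hg : ContinuousOn g (cell ℓ)) (k : ℤ) :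
    coef ℓ (fun x => f x + g x) k = coef ℓ f k + coef ℓ g k := by
  unfold coef
  rw [← mul_add, ← intervalIntegral.integral_add (intervalIntegrable_fexp_mul hℓ hf _)
    (intervalIntegrable_fexp_mul hℓ hg _)]
  simp only [mul_add]

theorem coef_const_mul (ℓ : ℝ) (c : ℂ) (f : ℝ → ℂ) (k : ℤ) :
    coef ℓ (fun x => c * f x) k = c * coef ℓ f k := by
  unfold coef
  rw [mul_left_comm, ← intervalIntegral.integral_const_mul c]
  simp only [mul_left_comm c]

theorem fc_add {ℓ : ℝ} (hℓ : 0 < ℓ) {f g : ℝ → ℝ} (hf : ContinuousOn f (cell ℓ))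
    (hg : ContinuousOn g (cell ℓ)) (k : ℤ) :
    fc ℓ (fun x => f x + g x) k = fc ℓ f k + fc ℓ g k := by
  unfold fc
  rw [← coef_add hℓ hf.ofReal_comp hg.ofReal_comp]
  simp

theorem fc_const_mul (ℓ : ℝ) (c : ℝ) (f : ℝ → ℝ) (k : ℤ) :
    fc ℓ (fun x => c * f x) k = c * fc ℓ f k := by
  unfold fc
  rw [← coef_const_mul]
  simp

theorem fc_sub {ℓ : ℝ} (hℓ : 0 < ℓ) {f g : ℝ → ℝ} (hf : ContinuousOn f (cell ℓ))
    (hg : ContinuousOn g (cell ℓ)) (k : ℤ) :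
    fc ℓ (fun x => f x - g x) k = fc ℓ f k - fc ℓ g k := by
  have h := fc_add hℓ hf (g := fun x => -1 * g x) (continuousOn_const.mul hg) k
  have h2 := fc_const_mul ℓ (-1) g k
  simp only [sub_eq_add_neg]
  rw [show (fun x => f x + -g x) = fun x => f x + -1 * g x from by ext; ring, h, h2]
  push_cast; ring

theorem norm_coef_le {ℓ : ℝ} (hℓ : 0 < ℓ) {f : ℝ → ℂ} {C : ℝ} (h : ∀ x ∈ cell ℓ, ‖f x‖ ≤ C)
    (k : ℤ) : ‖coef ℓ f k‖ ≤ C := by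
  have h1 : ‖∫ x in (-(ℓ / 2))..(ℓ / 2), fexp ℓ (-k) x * f x‖ ≤ C * |ℓ / 2 - -(ℓ / 2)| := by
    refine intervalIntegral.norm_integral_le_of_norm_le_const fun x hx => ?_
    rw [norm_mul, norm_fexp, one_mul]
    exact h x (by rw [cell_eq_uIcc hℓ]; exact uIoc_subset_uIcc hx)
  rw [coef, norm_mul, norm_inv, Complex.norm_real, Real.norm_of_nonneg hℓ.le,
    inv_mul_le_iff₀ hℓ]
  rwa [show ℓ / 2 - -(ℓ / 2) = ℓ by ring, abs_of_pos hℓ, mul_comm] at h1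

theorem norm_fc_le {ℓ : ℝ} (hℓ : 0 < ℓ) {f : ℝ → ℝ} {C : ℝ} (h : ∀ x ∈ cell ℓ, |f x| ≤ C)
    (k : ℤ) : ‖fc ℓ f k‖ ≤ C :=
  norm_coef_le hℓ (fun x hx => by simpa using h x hx) k

/-- The link through which Parseval's identity becomes available. -/
theorem coef_eq_fourierCoeffOn {ℓ : ℝ} (hℓ : 0 < ℓ) (f : ℝ → ℂ) (k : ℤ) :
    coef ℓ f k = fourierCoeffOn (show -(ℓ / 2) < ℓ / 2 by linarith) f k := by
  rw [fourierCoeffOn_eq_integral, coef]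
  have : ℓ / 2 - -(ℓ / 2) = ℓ := by ring
  rw [this]
  simp only [fourier_coe_apply, fexp, smul_eq_mul, one_div, Complex.real_smul,
    Complex.ofReal_inv]

theorem hasSum_sq_coef {ℓ : ℝ} (hℓ : 0 < ℓ) {f : ℝ → ℂ} (hf : ContinuousOn f (cell ℓ)) :
    HasSum (fun k => ‖coef ℓ f k‖ ^ 2) (ℓ⁻¹ * ∫ x in (-(ℓ / 2))..(ℓ / 2), ‖f x‖ ^ 2) := by
  have hlt : -(ℓ / 2) < ℓ / 2 := by linarith
  have hmem : MemLp f 2 (volume.restrict (Ioc (-(ℓ / 2)) (ℓ / 2))) := by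
    obtain ⟨C, hC⟩ := (isCompact_cell ℓ).exists_bound_of_continuousOn hf
    refine MemLp.of_bound ?_ C ?_
    · exact (hf.mono Ioc_subset_Icc_self).aestronglyMeasurable measurableSet_Ioc
    · exact (ae_restrict_iff' measurableSet_Ioc).2
        (Filter.Eventually.of_forall fun x hx => hC x (Ioc_subset_Icc_self hx))
  have h := hasSum_sq_fourierCoeffOn hlt hmem
  simp only [← coef_eq_fourierCoeffOn hℓ, smul_eq_mul] at h
  rwa [show ℓ / 2 - -(ℓ / 2) = ℓ by ring] at h

/-- The mean of a function over the cell. -/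
def avg (ℓ : ℝ) (f : ℝ → ℝ) : ℝ := ℓ⁻¹ * ∫ x in (-(ℓ / 2))..(ℓ / 2), f x

theorem hasSum_sq_fc {ℓ : ℝ} (hℓ : 0 < ℓ) {f : ℝ → ℝ} (hf : ContinuousOn f (cell ℓ)) :
    HasSum (fun k => ‖fc ℓ f k‖ ^ 2) (avg ℓ fun x => f x ^ 2) := by
  have h := hasSum_sq_coef hℓ hf.ofReal_comp
  simpa [avg, fc] using h

theorem avg_mono {ℓ : ℝ} (hℓ : 0 < ℓ) {f g : ℝ → ℝ} (hf : ContinuousOn f (cell ℓ))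
    (hg : ContinuousOn g (cell ℓ)) (h : ∀ x ∈ cell ℓ, f x ≤ g x) : avg ℓ f ≤ avg ℓ g :=
  mul_le_mul_of_nonneg_left (intervalIntegral.integral_mono_on (by linarith)
    (intervalIntegrable_cell hℓ hf) (intervalIntegrable_cell hℓ hg) h) (by positivity)

theorem avg_const {ℓ : ℝ} (hℓ : 0 < ℓ) (c : ℝ) : avg ℓ (fun _ => c) = c := by
  simp only [avg, intervalIntegral.integral_const, smul_eq_mul]
  field_simp
  ring

theorem avg_const_mul (ℓ c : ℝ) (f : ℝ → ℝ) : avg ℓ (fun x => c * f x) = c * avg ℓ f := by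
  simp only [avg, intervalIntegral.integral_const_mul]; ring

theorem avg_add {ℓ : ℝ} (hℓ : 0 < ℓ) {f g : ℝ → ℝ} (hf : ContinuousOn f (cell ℓ))
    (hg : ContinuousOn g (cell ℓ)) :
    avg ℓ (fun x => f x + g x) = avg ℓ f + avg ℓ g := by
  simp only [avg]
  rw [intervalIntegral.integral_add (intervalIntegrable_cell hℓ hf)
    (intervalIntegrable_cell hℓ hg), mul_add]

theorem sum_sq_fc_le {ℓ : ℝ} (hℓ : 0 < ℓ) {f : ℝ → ℝ} (hf : ContinuousOn f (cell ℓ)) {C : ℝ}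
    (hC : ∀ x ∈ cell ℓ, |f x| ≤ C) (s : Finset ℤ) : ∑ k ∈ s, ‖fc ℓ f k‖ ^ 2 ≤ C ^ 2 := by
  refine (sum_le_hasSum s (fun _ _ => sq_nonneg _) (hasSum_sq_fc hℓ hf)).trans ?_
  refine (avg_mono hℓ (hf.pow 2) continuousOn_const fun x hx => ?_).trans_eq
    (avg_const hℓ (C ^ 2))
  simpa using pow_le_pow_left₀ (abs_nonneg _) (hC x hx) 2

/-- By Parseval the difference has zero mean square. A continuous nonnegative function that is
positive at one point of the closed cell has positive integral, so the end points are covered too.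
-/
theorem eqOn_cell_of_coef_eq {ℓ : ℝ} (hℓ : 0 < ℓ) {f g : ℝ → ℂ} (hf : ContinuousOn f (cell ℓ))
    (hg : ContinuousOn g (cell ℓ)) (h : ∀ k, coef ℓ f k = coef ℓ g k) :
    ∀ x ∈ cell ℓ, f x = g x := by
  have hlt : -(ℓ / 2) < ℓ / 2 := by linarith
  have hd : ContinuousOn (fun x => f x + (-1) * g x) (cell ℓ) := hf.add (continuousOn_const.mul hg)
  have hz : ∀ k, coef ℓ (fun x => f x + (-1) * g x) k = 0 := fun k => by
    rw [coef_add hℓ hf (g := fun x => (-1) * g x) (continuousOn_const.mul hg), coef_const_mul, h]; ring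
  have hs := hasSum_sq_coef hℓ hd
  simp only [hz, norm_zero, ne_eq, OfNat.ofNat_ne_zero, not_false_eq_true, zero_pow] at hs
  have h0 := hs.unique hasSum_zero
  have h1 : ∫ x in (-(ℓ / 2))..(ℓ / 2), ‖f x + (-1) * g x‖ ^ 2 = 0 := by
    rcases mul_eq_zero.1 h0 with h | h
    · exact absurd h (by positivity)
    · exact h
  by_contra! hne
  obtain ⟨x, hx, hxne⟩ := hne
  have hpos := intervalIntegral.integral_pos (f := fun x => ‖f x + (-1) * g x‖ ^ 2) hlt
    (hd.norm.pow 2) (fun _ _ => by positivity)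
    ⟨x, hx, by
      have : f x + (-1) * g x ≠ 0 := by
        rw [neg_one_mul, ← sub_eq_add_neg]; exact sub_ne_zero.2 hxne
      positivity⟩
  exact hpos.ne' h1

/-- Integration by parts; the boundary terms cancel because `f` and the exponential both agree at
the two end points. -/
theorem coef_deriv {ℓ : ℝ} (hℓ : 0 < ℓ) {f f' : ℝ → ℂ}
    (hf : ∀ x ∈ cell ℓ, HasDerivWithinAt f (f' x) (cell ℓ) x) (hf' : ContinuousOn f' (cell ℓ))
    (hend : f (-(ℓ / 2)) = f (ℓ / 2)) (k : ℤ) :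
    coef ℓ f' k = I * freq ℓ k * coef ℓ f k := by
  have hlt : -(ℓ / 2) < ℓ / 2 := by linarith
  have hfc : ContinuousOn f (cell ℓ) := fun x hx => (hf x hx).continuousWithinAt
  have hIntg : IntervalIntegrable
      (fun x => I * freq ℓ (-k) * fexp ℓ (-k) x * f x + fexp ℓ (-k) x * f' x)
      volume (-(ℓ / 2)) (ℓ / 2) :=
    intervalIntegrable_cell hℓ (((continuousOn_const.mul
      (continuous_fexp ℓ _).continuousOn).mul hfc).add ((continuous_fexp ℓ _).continuousOn.mul hf'))
  have h := intervalIntegral.integral_eq_sub_of_hasDerivAt_of_le hlt.le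
    (f := fun x => fexp ℓ (-k) x * f x)
    ((continuous_fexp ℓ _).continuousOn.mul hfc)
    (fun x hx => (hasDerivAt_fexp ℓ (-k) x).mul
      ((hf x (Ioo_subset_Icc_self hx)).hasDerivAt (Icc_mem_nhds hx.1 hx.2))) hIntg
  have e : (fun x => I * freq ℓ (-k) * fexp ℓ (-k) x * f x + fexp ℓ (-k) x * f' x) =
      fun x => (I * freq ℓ (-k)) * (fexp ℓ (-k) x * f x) + fexp ℓ (-k) x * f' x := by
    ext x; ring
  rw [e, intervalIntegral.integral_add ((intervalIntegrable_fexp_mul hℓ hfc _).const_mul _)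
    (intervalIntegrable_fexp_mul hℓ hf' _), intervalIntegral.integral_const_mul, hend,
    fexp_ends hℓ, sub_self] at h
  have hfr : (freq ℓ (-k) : ℂ) = -freq ℓ k := by simp only [freq]; push_cast; ring
  rw [hfr] at h
  unfold coef
  linear_combination (ℓ : ℂ)⁻¹ * h

theorem fc_deriv {ℓ : ℝ} (hℓ : 0 < ℓ) {f f' : ℝ → ℝ}
    (hf : ∀ x ∈ cell ℓ, HasDerivWithinAt f (f' x) (cell ℓ) x) (hf' : ContinuousOn f' (cell ℓ))
    (hend : f (-(ℓ / 2)) = f (ℓ / 2)) (k : ℤ) :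
    fc ℓ f' k = I * freq ℓ k * fc ℓ f k :=
  coef_deriv hℓ (fun x hx => (hf x hx).ofReal_comp) hf'.ofReal_comp (by rw [hend]) k

theorem norm_fc_deriv {ℓ : ℝ} (hℓ : 0 < ℓ) {f f' : ℝ → ℝ}
    (hf : ∀ x ∈ cell ℓ, HasDerivWithinAt f (f' x) (cell ℓ) x) (hf' : ContinuousOn f' (cell ℓ))
    (hend : f (-(ℓ / 2)) = f (ℓ / 2)) (k : ℤ) :
    ‖fc ℓ f' k‖ ^ 2 = lam ℓ k * ‖fc ℓ f k‖ ^ 2 := by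
  rw [fc_deriv hℓ hf hf' hend, norm_mul, norm_mul, norm_I, Complex.norm_real, one_mul, mul_pow,
    Real.norm_eq_abs, sq_abs, lam]

theorem fc_deriv_deriv {ℓ : ℝ} (hℓ : 0 < ℓ) {f f' f'' : ℝ → ℝ}
    (hf : ∀ x ∈ cell ℓ, HasDerivWithinAt f (f' x) (cell ℓ) x)
    (hf' : ∀ x ∈ cell ℓ, HasDerivWithinAt f' (f'' x) (cell ℓ) x) (hf'' : ContinuousOn f'' (cell ℓ))
    (hend : f (-(ℓ / 2)) = f (ℓ / 2)) (hend' : f' (-(ℓ / 2)) = f' (ℓ / 2)) (k : ℤ) :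
    fc ℓ f'' k = -lam ℓ k * fc ℓ f k := by
  rw [fc_deriv hℓ hf' hf'' hend', fc_deriv hℓ hf
    (fun x hx => (hf' x hx).continuousWithinAt) hend, lam]
  push_cast
  linear_combination (freq ℓ k ^ 2 * fc ℓ f k : ℂ) * I_sq

/-- For `j ≠ k`, `coef_deriv` applied to an exponential says that the coefficient times `freq j -
freq k` is zero, so no integral is computed. -/
theorem coef_fexp {ℓ : ℝ} (hℓ : 0 < ℓ) (j k : ℤ) :
    coef ℓ (fexp ℓ j) k = if j = k then 1 else 0 := by
  have hℓ' : (ℓ : ℂ) ≠ 0 := by exact_mod_cast hℓ.ne'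
  split_ifs with h
  · subst h
    simp only [coef, fexp_mul, neg_add_cancel, fexp_zero, intervalIntegral.integral_const]
    rw [show ℓ / 2 - -(ℓ / 2) = ℓ by ring]
    simp [hℓ']
  · have hd : ∀ x ∈ cell ℓ,
        HasDerivWithinAt (fexp ℓ j) (I * freq ℓ j * fexp ℓ j x) (cell ℓ) x :=
      fun x _ => (hasDerivAt_fexp ℓ j x).hasDerivWithinAt
    have h1 := coef_deriv hℓ hd (continuousOn_const.mul (continuous_fexp ℓ j).continuousOn)
      (fexp_ends hℓ j) k
    rw [coef_const_mul] at h1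
    have h2 : (freq ℓ j - freq ℓ k : ℂ) ≠ 0 := by
      have h3 := freq_ne_zero hℓ (sub_ne_zero.2 h)
      have : freq ℓ (j - k) = freq ℓ j - freq ℓ k := by simp only [freq]; push_cast; ring
      rw [this] at h3
      exact_mod_cast h3
    have h4 : I * (freq ℓ j - freq ℓ k : ℂ) * coef ℓ (fexp ℓ j) k = 0 := by
      linear_combination h1
    rcases mul_eq_zero.1 h4 with h5 | h5
    · exact absurd h5 (mul_ne_zero I_ne_zero h2)
    · exact h5

theorem continuous_tsum_fexp {ℓ : ℝ} {d : ℤ → ℂ} (hd : Summable fun k => ‖d k‖) :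
    Continuous fun η => ∑' k, d k * fexp ℓ k η :=
  continuous_tsum (fun k => continuous_const.mul (continuous_fexp ℓ k)) hd
    fun k η => by rw [norm_mul, norm_fexp, mul_one]

theorem summable_mul_fexp {ℓ : ℝ} {d : ℤ → ℂ} (hd : Summable fun k => ‖d k‖) (η : ℝ) :
    Summable fun k => d k * fexp ℓ k η :=
  Summable.of_norm (hd.congr fun k => by rw [norm_mul, norm_fexp, mul_one])

theorem coef_tsum_fexp {ℓ : ℝ} (hℓ : 0 < ℓ) {d : ℤ → ℂ} (hd : Summable fun k => ‖d k‖) (k : ℤ) :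
    coef ℓ (fun η => ∑' j, d j * fexp ℓ j η) k = d k := by
  have h : HasSum (fun j => ∫ x in (-(ℓ / 2))..(ℓ / 2), fexp ℓ (-k) x * (d j * fexp ℓ j x))
      (∫ x in (-(ℓ / 2))..(ℓ / 2), fexp ℓ (-k) x * ∑' j, d j * fexp ℓ j x) := by
    refine intervalIntegral.hasSum_integral_of_dominated_convergence (fun j _ => ‖d j‖)
      (fun j => ?_) (fun j => ?_) ?_ ?_ ?_
    · exact ((continuous_fexp ℓ _).mul
        (continuous_const.mul (continuous_fexp ℓ j))).aestronglyMeasurable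
    · exact Filter.Eventually.of_forall fun x _ => by simp [norm_fexp]
    · exact Filter.Eventually.of_forall fun x _ => hd
    · exact intervalIntegrable_const
    · exact Filter.Eventually.of_forall fun x _ => (summable_mul_fexp hd x).hasSum.mul_left _
  have h2 := h.mul_left (ℓ : ℂ)⁻¹
  have e : (fun j => (ℓ : ℂ)⁻¹ *
      ∫ x in (-(ℓ / 2))..(ℓ / 2), fexp ℓ (-k) x * (d j * fexp ℓ j x)) =
      fun j => if j = k then d k else 0 := by
    ext j
    have := coef_const_mul ℓ (d j) (fexp ℓ j) k
    rw [coef_fexp hℓ] at this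
    rw [coef] at this
    rw [this]
    split_ifs with hjk
    · rw [hjk, mul_one]
    · rw [mul_zero]
  rw [e] at h2
  exact h2.unique (hasSum_ite_eq k (d k))

/-- A continuous function on the cell with summable Fourier coefficients is the sum of its
Fourier series. -/
theorem hasSum_fc {ℓ : ℝ} (hℓ : 0 < ℓ) {f : ℝ → ℝ} (hf : ContinuousOn f (cell ℓ))
    (hs : Summable fun k => ‖fc ℓ f k‖) {η : ℝ} (hη : η ∈ cell ℓ) :
    HasSum (fun k => fc ℓ f k * fexp ℓ k η) (f η : ℂ) := by
  have h := eqOn_cell_of_coef_eq hℓ (continuous_tsum_fexp (ℓ := ℓ) hs).continuousOn hf.ofReal_comp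
    (fun k => coef_tsum_fexp hℓ hs k) η hη
  rw [← h]
  exact (summable_mul_fexp hs η).hasSum

/-- The Fourier coefficients of the sum of an absolutely convergent series of exponentials. -/
theorem fc_of_hasSum {ℓ : ℝ} (hℓ : 0 < ℓ) {f : ℝ → ℝ} {d : ℤ → ℂ} (hd : Summable fun k => ‖d k‖)
    (hf : ∀ η ∈ cell ℓ, HasSum (fun k => d k * fexp ℓ k η) (f η : ℂ)) (k : ℤ) :
    fc ℓ f k = d k := by
  rw [← coef_tsum_fexp hℓ hd k]
  exact coef_congr hℓ (fun x hx => (hf x hx).tsum_eq.symm) k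

theorem continuousOn_of_hasSum {ℓ : ℝ} {f : ℝ → ℝ} {d : ℤ → ℂ} (hd : Summable fun k => ‖d k‖)
    (hf : ∀ η ∈ cell ℓ, HasSum (fun k => d k * fexp ℓ k η) (f η : ℂ)) :
    ContinuousOn f (cell ℓ) := by
  refine (Complex.continuous_re.comp (continuous_tsum_fexp (ℓ := ℓ) hd)).continuousOn.congr ?_
  intro x hx
  simp [(hf x hx).tsum_eq]

theorem abs_le_of_hasSum {ℓ : ℝ} {f : ℝ → ℝ} {d : ℤ → ℂ} (hd : Summable fun k => ‖d k‖)
    {η : ℝ} (hf : HasSum (fun k => d k * fexp ℓ k η) (f η : ℂ)) :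
    |f η| ≤ ∑' k, ‖d k‖ := by
  rw [← Real.norm_eq_abs, ← Complex.norm_real, ← hf.tsum_eq]
  refine (norm_tsum_le_tsum_norm ?_).trans_eq ?_
  · exact hd.congr fun k => by rw [norm_mul, norm_fexp, mul_one]
  · simp only [norm_mul, norm_fexp, mul_one]

/-! ### Derivatives on the cell and absolutely convergent Fourier series. -/

theorem dEta_zero (ℓ : ℝ) (f : ℝ → ℝ) : dEta ℓ 0 f = f := iteratedDerivWithin_zero

theorem dEta_succ (ℓ : ℝ) (j : ℕ) (f : ℝ → ℝ) (η : ℝ) :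
    dEta ℓ (j + 1) f η = derivWithin (dEta ℓ j f) (cell ℓ) η := by
  rw [dEta, iteratedDerivWithin_succ]; rfl

theorem dEta_one_eq {ℓ : ℝ} (hℓ : 0 < ℓ) {f f' : ℝ → ℝ}
    (hf : ∀ x ∈ cell ℓ, HasDerivWithinAt f (f' x) (cell ℓ) x) {η : ℝ} (hη : η ∈ cell ℓ) :
    dEta ℓ 1 f η = f' η := by
  rw [show (1 : ℕ) = 0 + 1 from rfl, dEta_succ, dEta_zero]
  exact (hf η hη).derivWithin (uniqueDiffOn_cell hℓ η hη)

theorem dEta_two_eq {ℓ : ℝ} (hℓ : 0 < ℓ) {f f' f'' : ℝ → ℝ}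
    (hf : ∀ x ∈ cell ℓ, HasDerivWithinAt f (f' x) (cell ℓ) x)
    (hf' : ∀ x ∈ cell ℓ, HasDerivWithinAt f' (f'' x) (cell ℓ) x) {η : ℝ} (hη : η ∈ cell ℓ) :
    dEta ℓ 2 f η = f'' η := by
  rw [show (2 : ℕ) = 1 + 1 from rfl, dEta_succ]
  refine HasDerivWithinAt.derivWithin ?_ (uniqueDiffOn_cell hℓ η hη)
  exact (hf' η hη).congr (fun x hx => dEta_one_eq hℓ hf hx) (dEta_one_eq hℓ hf hη)

theorem hasDerivWithinAt_dEta {ℓ : ℝ} (hℓ : 0 < ℓ) {n : ℕ} {f : ℝ → ℝ}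
    (hf : ContDiffOn ℝ n f (cell ℓ)) {j : ℕ} (hj : j < n) :
    ∀ η ∈ cell ℓ, HasDerivWithinAt (dEta ℓ j f) (dEta ℓ (j + 1) f η) (cell ℓ) η := by
  intro η hη
  rw [dEta_succ]
  exact (hf.differentiableOn_iteratedDerivWithin (by exact_mod_cast hj)
    (uniqueDiffOn_cell hℓ) η hη).hasDerivWithinAt

theorem continuousOn_dEta {ℓ : ℝ} (hℓ : 0 < ℓ) {n : ℕ} {f : ℝ → ℝ}
    (hf : ContDiffOn ℝ n f (cell ℓ)) {j : ℕ} (hj : j ≤ n) :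
    ContinuousOn (dEta ℓ j f) (cell ℓ) :=
  hf.continuousOn_iteratedDerivWithin (by exact_mod_cast hj) (uniqueDiffOn_cell hℓ)

theorem hasDerivAt_tsum_fexp {ℓ : ℝ} {d : ℤ → ℂ} (hd : Summable fun k => ‖d k‖)
    (hd' : Summable fun k => ‖I * freq ℓ k * d k‖) (η : ℝ) :
    HasDerivAt (fun η => ∑' k, d k * fexp ℓ k η)
      (∑' k, (I * freq ℓ k * d k) * fexp ℓ k η) η := by
  refine hasDerivAt_tsum (g := fun k η => d k * fexp ℓ k η)
    (g' := fun k η => (I * freq ℓ k * d k) * fexp ℓ k η) hd' (fun k y => ?_) (fun k y => ?_)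
    (summable_mul_fexp hd (0 : ℝ)) η
  · have h := (hasDerivAt_fexp ℓ k y).const_mul (d k)
    rwa [show d k * (I * freq ℓ k * fexp ℓ k y) = I * freq ℓ k * d k * fexp ℓ k y by ring] at h
  · rw [norm_mul, norm_fexp, mul_one]

theorem freq_abs_le (ℓ : ℝ) (k : ℤ) : |freq ℓ k| ≤ 1 + lam ℓ k := by
  rw [lam, ← sq_abs]; nlinarith [sq_nonneg (|freq ℓ k| - 1), abs_nonneg (freq ℓ k)]

/-- Termwise differentiation of a Fourier series on the cell. -/
theorem hasSum_dEta_two {ℓ : ℝ} (hℓ : 0 < ℓ) {f : ℝ → ℝ} {d : ℤ → ℂ}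
    (hd : Summable fun k => ‖d k‖) (hd2 : Summable fun k => lam ℓ k * ‖d k‖)
    (hf : ∀ η ∈ cell ℓ, HasSum (fun k => d k * fexp ℓ k η) (f η : ℂ)) :
    ∀ η ∈ cell ℓ, HasSum (fun k => (-lam ℓ k * d k) * fexp ℓ k η) (dEta ℓ 2 f η : ℂ) := by
  have h1 : Summable fun k => ‖I * freq ℓ k * d k‖ := by
    refine Summable.of_nonneg_of_le (fun _ => norm_nonneg _) (fun k => ?_) (hd.add hd2)
    rw [norm_mul, norm_mul, norm_I, one_mul, Complex.norm_real, Real.norm_eq_abs]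
    nlinarith [freq_abs_le ℓ k, norm_nonneg (d k)]
  have e2 : ∀ k, I * freq ℓ k * (I * freq ℓ k * d k) = -lam ℓ k * d k := fun k => by
    rw [lam]; push_cast
    linear_combination (freq ℓ k ^ 2 * d k : ℂ) * I_sq
  have h2 : Summable fun k => ‖I * freq ℓ k * (I * freq ℓ k * d k)‖ := by
    refine hd2.congr fun k => ?_
    rw [e2, norm_mul, norm_neg, Complex.norm_real, Real.norm_of_nonneg (lam_nonneg _ _)]
  have D1 := hasDerivAt_tsum_fexp (ℓ := ℓ) hd h1
  have D2 := hasDerivAt_tsum_fexp (ℓ := ℓ) h1 h2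
  have hre : ∀ {F : ℝ → ℂ} {F' : ℂ} {x : ℝ}, HasDerivAt F F' x →
      HasDerivAt (fun y => (F y).re) F'.re x := fun h =>
    (Complex.reCLM.hasFDerivAt.comp_hasDerivAt _ h)
  have him : ∀ {F : ℝ → ℂ} {F' : ℂ} {x : ℝ}, HasDerivAt F F' x →
      HasDerivAt (fun y => (F y).im) F'.im x := fun h =>
    (Complex.imCLM.hasFDerivAt.comp_hasDerivAt _ h)
  have im0 : ∀ x ∈ cell ℓ, (∑' k, d k * fexp ℓ k x).im = 0 := fun x hx => by
    rw [(hf x hx).tsum_eq, Complex.ofReal_im]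
  -- The series is complex and known to be real only on the cell. Its imaginary part vanishes there,
  -- hence so do the derivatives of that part, since derivatives within the cell are unique.
  have zero_of : ∀ {g g' : ℝ → ℝ}, (∀ x, HasDerivAt g (g' x) x) → (∀ x ∈ cell ℓ, g x = 0) →
      ∀ x ∈ cell ℓ, g' x = 0 := fun {g g'} h h0 x hx =>
    (uniqueDiffOn_cell hℓ x hx).eq_deriv _ (h x).hasDerivWithinAt
      ((hasDerivWithinAt_const x (cell ℓ) (0 : ℝ)).congr h0 (h0 x hx))
  have im1 := zero_of (fun x => him (D1 x)) im0
  have im2 := zero_of (fun x => him (D2 x)) im1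
  intro η hη
  have h3 : dEta ℓ 2 f η = (∑' k, I * freq ℓ k * (I * freq ℓ k * d k) * fexp ℓ k η).re := by
    refine dEta_two_eq hℓ (f' := fun x => (∑' k, I * freq ℓ k * d k * fexp ℓ k x).re)
      (fun x hx => ?_) (fun x _ => (hre (D2 x)).hasDerivWithinAt) hη
    refine (hre (D1 x)).hasDerivWithinAt.congr (fun y hy => ?_) ?_
    · rw [(hf y hy).tsum_eq, Complex.ofReal_re]
    · rw [(hf x hx).tsum_eq, Complex.ofReal_re]
  have h4 : (dEta ℓ 2 f η : ℂ) = ∑' k, I * freq ℓ k * (I * freq ℓ k * d k) * fexp ℓ k η := by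
    apply Complex.ext
    · rw [h3, Complex.ofReal_re]
    · rw [Complex.ofReal_im, im2 η hη]
  rw [h4]
  have := (summable_mul_fexp (ℓ := ℓ) h2 η).hasSum
  simpa only [e2] using this

/-- The arithmetic–geometric mean inequality for the factors `√λ ‖f_k‖` and `1/√λ`. It converts a
square-summable derivative into an absolutely summable series. -/
theorem norm_fc_le_sq_deriv_add {ℓ : ℝ} (hℓ : 0 < ℓ) {f f' : ℝ → ℝ}
    (hf : ∀ x ∈ cell ℓ, HasDerivWithinAt f (f' x) (cell ℓ) x) (hf' : ContinuousOn f' (cell ℓ))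
    (hend : f (-(ℓ / 2)) = f (ℓ / 2)) {k : ℤ} (hk : k ≠ 0) :
    ‖fc ℓ f k‖ ≤ ‖fc ℓ f' k‖ ^ 2 + (lam ℓ k)⁻¹ := by
  have hp := lam_pos hℓ hk
  rw [norm_fc_deriv hℓ hf hf' hend]
  have h2 : lam ℓ k * (lam ℓ k)⁻¹ = 1 := mul_inv_cancel₀ hp.ne'
  have h3 : 0 < (lam ℓ k)⁻¹ := inv_pos.2 hp
  have h4 := two_mul_le_add_sq (√(lam ℓ k) * ‖fc ℓ f k‖) (√(lam ℓ k)⁻¹)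
  rw [mul_pow, Real.sq_sqrt hp.le, Real.sq_sqrt h3.le,
    mul_assoc 2, mul_right_comm, ← Real.sqrt_mul hp.le, h2, Real.sqrt_one, one_mul] at h4
  linarith [norm_nonneg (fc ℓ f k)]

/-- The Fourier series of a periodic `C¹` function converges absolutely. -/
theorem summable_fc_of_deriv {ℓ : ℝ} (hℓ : 0 < ℓ) {f f' : ℝ → ℝ}
    (hf : ∀ x ∈ cell ℓ, HasDerivWithinAt f (f' x) (cell ℓ) x) (hf' : ContinuousOn f' (cell ℓ))
    (hend : f (-(ℓ / 2)) = f (ℓ / 2)) :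
    Summable fun k => ‖fc ℓ f k‖ := by
  have h1 := (hasSum_sq_fc hℓ hf').summable.add (summable_inv_lam ℓ)
  rw [← Finset.summable_compl_iff ({0} : Finset ℤ)]
  refine Summable.of_nonneg_of_le (fun _ => norm_nonneg _) (fun k => ?_)
    ((Finset.summable_compl_iff ({0} : Finset ℤ)).2 h1)
  exact norm_fc_le_sq_deriv_add hℓ hf hf' hend (by simpa using k.2)

theorem tsum_fc_le_of_deriv {ℓ : ℝ} (hℓ : 0 < ℓ) {f f' : ℝ → ℝ}
    (hf : ∀ x ∈ cell ℓ, HasDerivWithinAt f (f' x) (cell ℓ) x) (hf' : ContinuousOn f' (cell ℓ))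
    (hend : f (-(ℓ / 2)) = f (ℓ / 2)) {A A' : ℝ} (hA : ∀ x ∈ cell ℓ, |f x| ≤ A)
    (hA' : ∀ x ∈ cell ℓ, |f' x| ≤ A') :
    ∑' k, ‖fc ℓ f k‖ ≤ A + (A' ^ 2 + ∑' k, (lam ℓ k)⁻¹) := by
  -- The derivative carries no information on the mode `k = 0`, which is bounded by `A` separately.
  have hb : HasSum (fun k => (‖fc ℓ f' k‖ ^ 2 + (lam ℓ k)⁻¹) + if k = 0 then A else 0)
      ((avg ℓ (fun x => f' x ^ 2) + ∑' k, (lam ℓ k)⁻¹) + A) :=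
    ((hasSum_sq_fc hℓ hf').add (summable_inv_lam ℓ).hasSum).add (hasSum_ite_eq 0 A)
  have h1 := (summable_fc_of_deriv hℓ hf hf' hend).hasSum
  refine (hasSum_le (fun k => ?_) h1 hb).trans ?_
  · split_ifs with hk
    · have := norm_fc_le hℓ hA k
      have : 0 ≤ (lam ℓ k)⁻¹ := inv_nonneg.2 (lam_nonneg _ _)
      nlinarith [sq_nonneg ‖fc ℓ f' k‖]
    · linarith [norm_fc_le_sq_deriv_add hℓ hf hf' hend hk]
  · have : avg ℓ (fun x => f' x ^ 2) ≤ A' ^ 2 := by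
      refine (avg_mono hℓ (hf'.pow 2) continuousOn_const fun x hx => ?_).trans_eq
        (avg_const hℓ (A' ^ 2))
      simpa using pow_le_pow_left₀ (abs_nonneg _) (hA' x hx) 2
    linarith

/-! ### The weighted space and the pairing with the adjoint exponentials -/

/-- The pointwise bound `|f| ≤ C e^{x/2}` for both components. -/
def XBound (ℓ C : ℝ) (f : GenFun) : Prop :=
  (∀ x ≤ 0, ∀ η ∈ cell ℓ, |f.1 x η| ≤ C * Real.exp (x / 2)) ∧
    ∀ x ≥ 0, ∀ η ∈ cell ℓ, |f.2 x η| ≤ C * Real.exp (x / 2)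

theorem exp_neg_half_mul_abs_le_iff (x y C : ℝ) :
    |Real.exp (-x / 2) * y| ≤ C ↔ |y| ≤ C * Real.exp (x / 2) := by
  rw [abs_mul, abs_of_pos (Real.exp_pos _), show -x / 2 = -(x / 2) by ring, Real.exp_neg,
    inv_mul_le_iff₀ (Real.exp_pos _), mul_comm C]

theorem enorm_le_ofReal_iff {y C : ℝ} (hC : 0 ≤ C) : ‖y‖ₑ ≤ ENNReal.ofReal C ↔ |y| ≤ C := by
  rw [← ofReal_norm, ENNReal.ofReal_le_ofReal_iff hC, Real.norm_eq_abs]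

theorem XBound.of_normX_le {ℓ C : ℝ} (hC : 0 ≤ C) {f : GenFun}
    (h : normX ℓ f ≤ ENNReal.ofReal C) : XBound ℓ C f := by
  constructor
  · intro x hx η hη
    rw [← exp_neg_half_mul_abs_le_iff, ← enorm_le_ofReal_iff hC]
    refine le_trans ?_ (le_self_add.trans h)
    exact le_iSup₂_of_le x hx (le_iSup₂_of_le η hη le_rfl)
  · intro x hx η hη
    rw [← exp_neg_half_mul_abs_le_iff, ← enorm_le_ofReal_iff hC]
    refine le_trans ?_ (le_add_self.trans h)
    exact le_iSup₂_of_le x hx (le_iSup₂_of_le η hη le_rfl)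

/-- The factor 2 appears because the norm of `𝒳` adds the suprema over the two half-strips. -/
theorem XBound.normX_le {ℓ C : ℝ} (hC : 0 ≤ C) {f : GenFun} (h : XBound ℓ C f) :
    normX ℓ f ≤ ENNReal.ofReal (2 * C) := by
  rw [two_mul, ENNReal.ofReal_add hC hC]
  refine add_le_add ?_ ?_
  · refine iSup₂_le fun x hx => iSup₂_le fun η hη => ?_
    rw [enorm_le_ofReal_iff hC, exp_neg_half_mul_abs_le_iff]
    exact h.1 x hx η hη
  · refine iSup₂_le fun x hx => iSup₂_le fun η hη => ?_
    rw [enorm_le_ofReal_iff hC, exp_neg_half_mul_abs_le_iff]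
    exact h.2 x hx η hη

theorem MemX.exists_bound {ℓ : ℝ} {f : GenFun} (hf : MemX ℓ f) : ∃ C, 0 ≤ C ∧ XBound ℓ C f :=
  ⟨(normX ℓ f).toReal, ENNReal.toReal_nonneg,
    .of_normX_le ENNReal.toReal_nonneg (by rw [ENNReal.ofReal_toReal hf.bdd.ne])⟩

theorem XBound.add {ℓ C D : ℝ} {f g : GenFun} (hf : XBound ℓ C f) (hg : XBound ℓ D g) :
    XBound ℓ (C + D) (f + g) := by
  constructor
  · intro x hx η hη
    have := hf.1 x hx η hη
    have := hg.1 x hx η hη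
    have := abs_add_le (f.1 x η) (g.1 x η)
    simp only [Prod.fst_add, Pi.add_apply]
    linarith
  · intro x hx η hη
    have := hf.2 x hx η hη
    have := hg.2 x hx η hη
    have := abs_add_le (f.2 x η) (g.2 x η)
    simp only [Prod.snd_add, Pi.add_apply]
    linarith

theorem XBound.smul {ℓ C : ℝ} {f : GenFun} (hf : XBound ℓ C f) (c : ℝ) :
    XBound ℓ (|c| * C) (c • f) := by
  constructor
  · intro x hx η hη
    simp only [Prod.smul_fst, Pi.smul_apply, smul_eq_mul, abs_mul, mul_assoc]
    exact mul_le_mul_of_nonneg_left (hf.1 x hx η hη) (abs_nonneg c)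
  · intro x hx η hη
    simp only [Prod.smul_snd, Pi.smul_apply, smul_eq_mul, abs_mul, mul_assoc]
    exact mul_le_mul_of_nonneg_left (hf.2 x hx η hη) (abs_nonneg c)

theorem MemX.of_bound {ℓ C : ℝ} {f : GenFun}
    (h1 : ContinuousOn (fun p : ℝ × ℝ => f.1 p.1 p.2) (Iic 0 ×ˢ cell ℓ))
    (h2 : ContinuousOn (fun p : ℝ × ℝ => f.2 p.1 p.2) (Ici 0 ×ˢ cell ℓ)) (hC : 0 ≤ C)
    (h : XBound ℓ C f) : MemX ℓ f :=
  ⟨h1, h2, (h.normX_le hC).trans_lt ENNReal.ofReal_lt_top⟩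

theorem MemX.add {ℓ : ℝ} {f g : GenFun} (hf : MemX ℓ f) (hg : MemX ℓ g) : MemX ℓ (f + g) := by
  obtain ⟨C, hC, hfC⟩ := hf.exists_bound
  obtain ⟨D, hD, hgD⟩ := hg.exists_bound
  exact .of_bound (hf.cont_fst.add hg.cont_fst) (hf.cont_snd.add hg.cont_snd) (by positivity)
    (hfC.add hgD)

theorem MemX.smul {ℓ : ℝ} {f : GenFun} (hf : MemX ℓ f) (c : ℝ) : MemX ℓ (c • f) := by
  obtain ⟨C, hC, hfC⟩ := hf.exists_bound
  exact .of_bound (hf.cont_fst.const_smul c) (hf.cont_snd.const_smul c) (by positivity)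
    (hfC.smul c)

theorem MemX.neg {ℓ : ℝ} {f : GenFun} (hf : MemX ℓ f) : MemX ℓ (-f) := by
  have := hf.smul (-1)
  rwa [neg_one_smul] at this

theorem MemX.sub {ℓ : ℝ} {f g : GenFun} (hf : MemX ℓ f) (hg : MemX ℓ g) : MemX ℓ (f - g) := by
  rw [sub_eq_add_neg]; exact hf.add hg.neg

/-- The pairing of a generalized function, in the variable `x`, with
`(e^{(a-1)x}, e^{-ax})`. -/
def pair (a : ℝ) (f : GenFun) (η : ℝ) : ℝ :=
  (∫ x in Iic (0 : ℝ), Real.exp ((a - 1) * x) * f.1 x η) +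
    ∫ x in Ioi (0 : ℝ), Real.exp (-a * x) * f.2 x η

theorem opQ_eq_pair (f : GenFun) : opQ f = pair 1 f := by
  ext η; simp [opQ, pair]

theorem exp_mul_bound {x y C : ℝ} (b : ℝ) (h : |y| ≤ C * Real.exp (x / 2)) :
    ‖Real.exp (b * x) * y‖ ≤ C * Real.exp ((b + 1 / 2) * x) := by
  rw [norm_mul, Real.norm_of_nonneg (Real.exp_pos _).le, Real.norm_eq_abs]
  calc Real.exp (b * x) * |y| ≤ Real.exp (b * x) * (C * Real.exp (x / 2)) := by gcongr
    _ = C * Real.exp ((b + 1 / 2) * x) := by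
      rw [show (b + 1 / 2) * x = b * x + x / 2 by ring, Real.exp_add]; ring

/-- The growth `e^{x/2}` is beaten on both half-lines as soon as `a > 1/2`; the range `a ≥ 1`
includes `a = 1`, the pairing that defines `Q`. -/
theorem integrableOn_fst_bound {a C : ℝ} (ha : 1 ≤ a) :
    IntegrableOn (fun x => C * Real.exp ((a - 1 + 1 / 2) * x)) (Iic 0) :=
  (integrableOn_exp_mul_Iic (by linarith) 0).const_mul C

theorem integrableOn_snd_bound {a C : ℝ} (ha : 1 ≤ a) :
    IntegrableOn (fun x => C * Real.exp ((-a + 1 / 2) * x)) (Ioi 0) :=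
  (integrableOn_exp_mul_Ioi (by linarith) 0).const_mul C

theorem ContinuousOn.uncurry_left' {f : ℝ → ℝ → ℝ} {s t : Set ℝ}
    (hf : ContinuousOn (fun p : ℝ × ℝ => f p.1 p.2) (s ×ˢ t)) {x : ℝ} (hx : x ∈ s) :
    ContinuousOn (f x) t :=
  hf.comp (f := fun η => (x, η)) (by fun_prop) fun η hη => ⟨hx, hη⟩

theorem ContinuousOn.uncurry_right' {f : ℝ → ℝ → ℝ} {s t : Set ℝ}
    (hf : ContinuousOn (fun p : ℝ × ℝ => f p.1 p.2) (s ×ˢ t)) {η : ℝ} (hη : η ∈ t) :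
    ContinuousOn (fun x => f x η) s :=
  hf.comp (f := fun x => (x, η)) (by fun_prop) fun x hx => ⟨hx, hη⟩

theorem MemX.integrableOn_fst {ℓ a : ℝ} (ha : 1 ≤ a) {f : GenFun} (hf : MemX ℓ f) {η : ℝ}
    (hη : η ∈ cell ℓ) : IntegrableOn (fun x => Real.exp ((a - 1) * x) * f.1 x η) (Iic 0) := by
  obtain ⟨C, hC, h⟩ := hf.exists_bound
  refine Integrable.mono' (integrableOn_fst_bound (C := C) ha) ?_ ?_
  · exact ContinuousOn.aestronglyMeasurable ((by fun_prop : Continuous fun x : ℝ =>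
      Real.exp ((a - 1) * x)).continuousOn.mul (ContinuousOn.uncurry_right' hf.cont_fst hη)) measurableSet_Iic
  · exact (ae_restrict_iff' measurableSet_Iic).2 (.of_forall fun x hx =>
      exp_mul_bound _ (h.1 x hx η hη))

theorem MemX.integrableOn_snd {ℓ a : ℝ} (ha : 1 ≤ a) {f : GenFun} (hf : MemX ℓ f) {η : ℝ}
    (hη : η ∈ cell ℓ) : IntegrableOn (fun x => Real.exp (-a * x) * f.2 x η) (Ioi 0) := by
  obtain ⟨C, hC, h⟩ := hf.exists_bound
  refine Integrable.mono' (integrableOn_snd_bound (C := C) ha) ?_ ?_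
  · exact ContinuousOn.aestronglyMeasurable ((by fun_prop : Continuous fun x : ℝ =>
      Real.exp (-a * x)).continuousOn.mul
        ((ContinuousOn.uncurry_right' hf.cont_snd hη).mono Ioi_subset_Ici_self)) measurableSet_Ioi
  · exact (ae_restrict_iff' measurableSet_Ioi).2 (.of_forall fun x hx =>
      exp_mul_bound _ (h.2 x (le_of_lt hx) η hη))

theorem pair_add {ℓ a : ℝ} (ha : 1 ≤ a) {f g : GenFun} (hf : MemX ℓ f) (hg : MemX ℓ g) {η : ℝ}
    (hη : η ∈ cell ℓ) : pair a (f + g) η = pair a f η + pair a g η := by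
  simp only [pair, Prod.fst_add, Prod.snd_add, Pi.add_apply, mul_add]
  rw [integral_add (hf.integrableOn_fst ha hη) (hg.integrableOn_fst ha hη),
    integral_add (hf.integrableOn_snd ha hη) (hg.integrableOn_snd ha hη)]
  ring

theorem pair_smul (a c : ℝ) (f : GenFun) (η : ℝ) : pair a (c • f) η = c * pair a f η := by
  simp only [pair, Prod.smul_fst, Prod.smul_snd, Pi.smul_apply, smul_eq_mul, mul_left_comm _ c,
    integral_const_mul]
  ring

theorem pair_sub {ℓ a : ℝ} (ha : 1 ≤ a) {f g : GenFun} (hf : MemX ℓ f) (hg : MemX ℓ g) {η : ℝ}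
    (hη : η ∈ cell ℓ) : pair a (f - g) η = pair a f η - pair a g η := by
  rw [sub_eq_add_neg, ← neg_one_smul ℝ g, pair_add ha hf (hg.smul _) hη, pair_smul]; ring

/-- Each half-line contributes at most `C/(a - 1/2) ≤ 2C`, uniformly in `a`. -/
theorem XBound.abs_pair_le {ℓ a C : ℝ} (ha : 1 ≤ a) (hC : 0 ≤ C) {f : GenFun}
    (hb : XBound ℓ C f) {η : ℝ} (hη : η ∈ cell ℓ) : |pair a f η| ≤ 4 * C := by
  have h1 : ‖∫ x in Iic (0 : ℝ), Real.exp ((a - 1) * x) * f.1 x η‖ ≤ 2 * C := by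
    refine (norm_integral_le_of_norm_le (integrableOn_fst_bound (C := C) ha)
      ((ae_restrict_iff' measurableSet_Iic).2 (.of_forall fun x hx =>
      exp_mul_bound _ (hb.1 x hx η hη)))).trans ?_
    rw [integral_const_mul, integral_exp_mul_Iic (by linarith), mul_zero, Real.exp_zero, mul_comm]
    gcongr
    rw [div_le_iff₀ (by linarith)]; linarith
  have h2 : ‖∫ x in Ioi (0 : ℝ), Real.exp (-a * x) * f.2 x η‖ ≤ 2 * C := by
    refine (norm_integral_le_of_norm_le (integrableOn_snd_bound (C := C) ha)
      ((ae_restrict_iff' measurableSet_Ioi).2 (.of_forall fun x hx =>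
      exp_mul_bound _ (hb.2 x (le_of_lt hx) η hη)))).trans ?_
    rw [integral_const_mul, integral_exp_mul_Ioi (by linarith), mul_zero, Real.exp_zero, mul_comm]
    gcongr
    rw [← neg_div_neg_eq, neg_neg, div_le_iff₀ (by linarith)]; linarith
  rw [← Real.norm_eq_abs]
  exact (norm_add_le _ _).trans (by linarith)

theorem MemX.continuousOn_pair_fst {ℓ a : ℝ} (ha : 1 ≤ a) {f : GenFun} (hf : MemX ℓ f) :
    ContinuousOn (fun η => ∫ x in Iic (0 : ℝ), Real.exp ((a - 1) * x) * f.1 x η) (cell ℓ) := by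
  obtain ⟨C, hC, h⟩ := hf.exists_bound
  refine continuousOn_of_dominated (bound := fun x => C * Real.exp ((a - 1 + 1 / 2) * x))
    (fun η hη => (hf.integrableOn_fst ha hη).aestronglyMeasurable) (fun η hη => ?_)
    (integrableOn_fst_bound ha) ?_
  · exact (ae_restrict_iff' measurableSet_Iic).2 (.of_forall fun x hx =>
      exp_mul_bound _ (h.1 x hx η hη))
  · exact (ae_restrict_iff' measurableSet_Iic).2 (.of_forall fun x hx =>
      continuousOn_const.mul (ContinuousOn.uncurry_left' hf.cont_fst hx))

theorem MemX.continuousOn_pair_snd {ℓ a : ℝ} (ha : 1 ≤ a) {f : GenFun} (hf : MemX ℓ f) :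
    ContinuousOn (fun η => ∫ x in Ioi (0 : ℝ), Real.exp (-a * x) * f.2 x η) (cell ℓ) := by
  obtain ⟨C, hC, h⟩ := hf.exists_bound
  refine continuousOn_of_dominated (bound := fun x => C * Real.exp ((-a + 1 / 2) * x))
    (fun η hη => (hf.integrableOn_snd ha hη).aestronglyMeasurable) (fun η hη => ?_)
    (integrableOn_snd_bound ha) ?_
  · exact (ae_restrict_iff' measurableSet_Ioi).2 (.of_forall fun x hx =>
      exp_mul_bound _ (h.2 x (le_of_lt hx) η hη))
  · exact (ae_restrict_iff' measurableSet_Ioi).2 (.of_forall fun x hx =>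
      continuousOn_const.mul (ContinuousOn.uncurry_left' hf.cont_snd (Ioi_subset_Ici_self hx)))

theorem MemX.continuousOn_pair {ℓ a : ℝ} (ha : 1 ≤ a) {f : GenFun} (hf : MemX ℓ f) :
    ContinuousOn (pair a f) (cell ℓ) :=
  (hf.continuousOn_pair_fst ha).add (hf.continuousOn_pair_snd ha)

/-- Fubini's theorem for a half-line and the cell. -/
theorem fc_integral_swap {ℓ : ℝ} (hℓ : 0 < ℓ) {S : Set ℝ} (hS : MeasurableSet S)
    {F : ℝ → ℝ → ℝ} {B : ℝ → ℝ}
    (hF : ContinuousOn (fun p : ℝ × ℝ => F p.1 p.2) (S ×ˢ cell ℓ))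
    (hB : IntegrableOn B S) (hFB : ∀ x ∈ S, ∀ η ∈ cell ℓ, ‖F x η‖ ≤ B x) (k : ℤ) :
    fc ℓ (fun η => ∫ x in S, F x η) k = ∫ x in S, fc ℓ (F x) k := by
  have hle : -(ℓ / 2) ≤ ℓ / 2 := by linarith
  simp only [fc, coef]
  rw [integral_const_mul]
  congr 1
  simp only [intervalIntegral.integral_of_le hle]
  have e : ∀ η : ℝ, fexp ℓ (-k) η * ((∫ x in S, F x η : ℝ) : ℂ)
      = ∫ x in S, fexp ℓ (-k) η * (F x η : ℂ) := fun η => by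
    rw [integral_const_mul, integral_complex_ofReal]
  simp only [e]
  rw [integral_integral_swap]
  rw [Function.uncurry_def, Measure.prod_restrict]
  have hsub : Ioc (-(ℓ / 2)) (ℓ / 2) ⊆ cell ℓ := Ioc_subset_Icc_self
  have hdom : Integrable (fun p : ℝ × ℝ => B p.2)
      ((volume.restrict (Ioc (-(ℓ / 2)) (ℓ / 2))).prod (volume.restrict S)) := by
    have := (integrable_const (1 : ℝ) (μ := volume.restrict (Ioc (-(ℓ / 2)) (ℓ / 2)))).mul_prod hB
    simpa using this
  rw [Measure.prod_restrict] at hdom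
  refine Integrable.mono' hdom ?_ ?_
  · refine ContinuousOn.aestronglyMeasurable ?_ (measurableSet_Ioc.prod hS)
    refine ((continuous_fexp ℓ _).comp continuous_fst).continuousOn.mul ?_
    refine Complex.continuous_ofReal.comp_continuousOn ?_
    exact hF.comp (f := fun p : ℝ × ℝ => (p.2, p.1)) (by fun_prop)
      fun p hp => ⟨hp.2, hsub hp.1⟩
  · refine (ae_restrict_iff' (measurableSet_Ioc.prod hS)).2 (.of_forall fun p hp => ?_)
    rw [norm_mul, norm_fexp, one_mul, Complex.norm_real]
    exact hFB _ hp.2 _ (hsub hp.1)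

/-- Fubini: the pairing in `x` commutes with taking coefficients in `η`, so it can be analysed mode
by mode. -/
theorem MemX.fc_pair {ℓ a : ℝ} (hℓ : 0 < ℓ) (ha : 1 ≤ a) {f : GenFun} (hf : MemX ℓ f) (k : ℤ) :
    fc ℓ (pair a f) k = (∫ x in Iic (0 : ℝ), Real.exp ((a - 1) * x) * fc ℓ (f.1 x) k) +
      ∫ x in Ioi (0 : ℝ), Real.exp (-a * x) * fc ℓ (f.2 x) k := by
  obtain ⟨C, hC, h⟩ := hf.exists_bound
  have e := fc_add hℓ (hf.continuousOn_pair_fst ha) (hf.continuousOn_pair_snd ha) k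
  rw [fc_integral_swap hℓ measurableSet_Iic
      (F := fun x η => Real.exp ((a - 1) * x) * f.1 x η) ?_
      (integrableOn_fst_bound (C := C) ha) (fun x hx η hη => exp_mul_bound _ (h.1 x hx η hη)),
    fc_integral_swap hℓ measurableSet_Ioi
      (F := fun x η => Real.exp (-a * x) * f.2 x η) ?_
      (integrableOn_snd_bound (C := C) ha)
      (fun x hx η hη => exp_mul_bound _ (h.2 x (le_of_lt hx) η hη))] at e
  · simp only [fc_const_mul] at e
    exact e
  · exact (by fun_prop : Continuous fun p : ℝ × ℝ => Real.exp (-a * p.1)).continuousOn.mul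
      (hf.cont_snd.mono (prod_mono Ioi_subset_Ici_self subset_rfl))
  · exact (by fun_prop : Continuous fun p : ℝ × ℝ => Real.exp ((a - 1) * p.1)).continuousOn.mul
      hf.cont_fst

/-! ### The pairing identity on the domain -/

-- The integrand is the derivative of `e^{(a-1)x}(v' - av)`, so only the boundary term at `0`
-- survives.
open Filter Topology in
theorem integral_Iic_exp_mul_eq {a C : ℝ} (ha : 1 < a) {v v₁ v₂ : ℝ → ℝ}
    (h₁ : ∀ x ∈ Iic (0 : ℝ), HasDerivWithinAt v (v₁ x) (Iic 0) x)
    (h₂ : ∀ x ∈ Iic (0 : ℝ), HasDerivWithinAt v₁ (v₂ x) (Iic 0) x)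
    (hv : ∀ x ∈ Iic (0 : ℝ), |v x| ≤ C) (hd : ∀ x ∈ Iic (0 : ℝ), |v₂ x - v₁ x| ≤ C)
    (hIntg : IntegrableOn (fun x => Real.exp ((a - 1) * x) * (v₂ x - v₁ x - (a ^ 2 - a) * v x))
      (Iic 0)) :
    ∫ x in Iic (0 : ℝ), Real.exp ((a - 1) * x) * (v₂ x - v₁ x - (a ^ 2 - a) * v x) =
      v₁ 0 - a * v 0 := by
  have hF : ∀ x ∈ Iic (0 : ℝ), HasDerivWithinAt
      (fun x => Real.exp ((a - 1) * x) * (v₁ x - a * v x))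
      (Real.exp ((a - 1) * x) * (v₂ x - v₁ x - (a ^ 2 - a) * v x)) (Iic 0) x := by
    intro x hx
    have he : HasDerivWithinAt (fun x => Real.exp ((a - 1) * x))
        (Real.exp ((a - 1) * x) * (a - 1)) (Iic 0) x := by
      have := ((hasDerivAt_id x).const_mul (a - 1)).exp
      simpa using this.hasDerivWithinAt
    refine (he.mul ((h₂ x hx).sub ((h₁ x hx).const_mul a))).congr_deriv ?_
    simp only [Pi.sub_apply]
    ring
  -- No bound on `v'` is available. But `v' - v` has the bounded derivative `v'' - v'`, so it grows
  -- at most linearly, and `a > 1` makes the exponential win.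
  have hlin : ∀ x ∈ Iic (0 : ℝ), |v₁ x - a * v x| ≤ (|v₁ 0 - v 0| + a * C) + C * |x| := by
    intro x hx
    have hm := (convex_Iic (0 : ℝ)).norm_image_sub_le_of_norm_hasDerivWithin_le
      (f := fun x => v₁ x - v x) (C := C) (fun y hy => (h₂ y hy).sub (h₁ y hy)) hd
      (mem_Iic.2 le_rfl) hx
    simp only [Real.norm_eq_abs, sub_zero] at hm
    have e : v₁ x - a * v x = (v₁ x - v x - (v₁ 0 - v 0)) + (v₁ 0 - v 0) + (-(a - 1) * v x) := by
      ring
    rw [e]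
    refine (abs_add_three _ _ _).trans ?_
    rw [abs_mul, abs_neg, abs_of_pos (by linarith : 0 < a - 1)]
    have := hv x hx
    have := abs_nonneg (v x)
    nlinarith
  have hlim : Tendsto (fun x => Real.exp ((a - 1) * x) * (v₁ x - a * v x)) atBot (𝓝 0) := by
    have hg : Tendsto (fun x : ℝ => Real.exp (-((a - 1) * x)) *
        ((|v₁ 0 - v 0| + a * C) + C * x)) atTop (𝓝 0) := by
      have t1 : Tendsto (fun x : ℝ => (a - 1) * x) atTop atTop :=
        tendsto_id.const_mul_atTop (by linarith)
      have t2 := (Real.tendsto_pow_mul_exp_neg_atTop_nhds_zero 1).comp t1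
      have t3 := (Real.tendsto_pow_mul_exp_neg_atTop_nhds_zero 0).comp t1
      have t4 := (t3.const_mul (|v₁ 0 - v 0| + a * C)).add (t2.const_mul (C / (a - 1)))
      simp only [mul_zero, add_zero] at t4
      refine t4.congr fun x => ?_
      have : a - 1 ≠ 0 := by linarith
      simp only [Function.comp]
      field_simp
    have hg' := hg.comp tendsto_neg_atBot_atTop
    refine squeeze_zero_norm' ?_ hg'
    filter_upwards [eventually_le_atBot (0 : ℝ)] with x hx
    rw [norm_mul, Real.norm_of_nonneg (Real.exp_pos _).le, Real.norm_eq_abs]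
    simp only [Function.comp]
    rw [show -((a - 1) * -x) = (a - 1) * x by ring]
    refine mul_le_mul_of_nonneg_left ?_ (Real.exp_pos _).le
    have := hlin x hx
    rwa [abs_of_nonpos hx] at this
  have := integral_Iic_of_hasDerivAt_of_tendsto (hF 0 (mem_Iic.2 le_rfl)).continuousWithinAt
    (fun x hx => (hF x (Iio_subset_Iic_self hx)).hasDerivAt (Iic_mem_nhds hx)) hIntg hlim
  rw [this]
  simp

-- The counterpart on the other half-line, with primitive `e^{-ax}(v' + (a-1)v)`.
open Filter Topology in
theorem integral_Ioi_exp_mul_eq {a C : ℝ} (ha : 1 < a) {v v₁ v₂ : ℝ → ℝ}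
    (h₁ : ∀ x ∈ Ici (0 : ℝ), HasDerivWithinAt v (v₁ x) (Ici 0) x)
    (h₂ : ∀ x ∈ Ici (0 : ℝ), HasDerivWithinAt v₁ (v₂ x) (Ici 0) x)
    (hv : ∀ x ∈ Ici (0 : ℝ), |v x| ≤ C * Real.exp (x / 2))
    (hd : ∀ x ∈ Ici (0 : ℝ), |v₂ x - v₁ x| ≤ C * Real.exp (x / 2))
    (hIntg : IntegrableOn (fun x => Real.exp (-a * x) * (v₂ x - v₁ x - (a ^ 2 - a) * v x))
      (Ioi 0)) :
    ∫ x in Ioi (0 : ℝ), Real.exp (-a * x) * (v₂ x - v₁ x - (a ^ 2 - a) * v x) =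
      -(v₁ 0 + (a - 1) * v 0) := by
  have hC : 0 ≤ C := by
    have := (abs_nonneg _).trans (hv 0 (mem_Ici.2 le_rfl))
    simpa using this
  have hF : ∀ x ∈ Ici (0 : ℝ), HasDerivWithinAt
      (fun x => Real.exp (-a * x) * (v₁ x + (a - 1) * v x))
      (Real.exp (-a * x) * (v₂ x - v₁ x - (a ^ 2 - a) * v x)) (Ici 0) x := by
    intro x hx
    have he : HasDerivWithinAt (fun x => Real.exp (-a * x))
        (Real.exp (-a * x) * (-a)) (Ici 0) x := by
      have := ((hasDerivAt_id x).const_mul (-a)).exp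
      simpa using this.hasDerivWithinAt
    refine (he.mul ((h₂ x hx).add ((h₁ x hx).const_mul (a - 1)))).congr_deriv ?_
    simp only [Pi.add_apply]
    ring
  -- On `[0, x]` the derivative of `v' - v` is bounded by `C e^{x/2}`, its majorant at the right
  -- end. The linear growth thus acquires a factor `e^{x/2}`, which `e^{-ax}` still dominates.
  have hlin : ∀ x ∈ Ici (0 : ℝ),
      |v₁ x + (a - 1) * v x| ≤ ((|v₁ 0 - v 0| + a * C) + C * x) * Real.exp (x / 2) := by
    intro x hx
    have hx0 : (0 : ℝ) ≤ x := hx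
    have hm := (convex_Icc (0 : ℝ) x).norm_image_sub_le_of_norm_hasDerivWithin_le
      (f := fun x => v₁ x - v x) (C := C * Real.exp (x / 2))
      (fun y hy => ((h₂ y hy.1).sub (h₁ y hy.1)).mono Icc_subset_Ici_self)
      (fun y hy => (hd y hy.1).trans (by have := hy.2; gcongr))
      (left_mem_Icc.2 hx) (right_mem_Icc.2 hx)
    simp only [Real.norm_eq_abs, sub_zero] at hm
    rw [abs_of_nonneg hx0] at hm
    have e : v₁ x + (a - 1) * v x
        = (v₁ x - v x - (v₁ 0 - v 0)) + (v₁ 0 - v 0) + (a * v x) := by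
      ring
    rw [e]
    refine (abs_add_three _ _ _).trans ?_
    rw [abs_mul, abs_of_pos (by linarith : 0 < a)]
    have h3 := mul_le_mul_of_nonneg_left (hv x hx) (by linarith : 0 ≤ a)
    have h4 : (1 : ℝ) ≤ Real.exp (x / 2) := Real.one_le_exp (by positivity)
    have h5 := mul_le_mul_of_nonneg_left h4 (abs_nonneg (v₁ 0 - v 0))
    linarith
  have hlim : Tendsto (fun x => Real.exp (-a * x) * (v₁ x + (a - 1) * v x)) atTop (𝓝 0) := by
    have hg : Tendsto (fun x : ℝ => Real.exp (-((a - 1 / 2) * x)) *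
        ((|v₁ 0 - v 0| + a * C) + C * x)) atTop (𝓝 0) := by
      have t1 : Tendsto (fun x : ℝ => (a - 1 / 2) * x) atTop atTop :=
        tendsto_id.const_mul_atTop (by linarith)
      have t2 := (Real.tendsto_pow_mul_exp_neg_atTop_nhds_zero 1).comp t1
      have t3 := (Real.tendsto_pow_mul_exp_neg_atTop_nhds_zero 0).comp t1
      have t4 := (t3.const_mul (|v₁ 0 - v 0| + a * C)).add (t2.const_mul (C / (a - 1 / 2)))
      simp only [mul_zero, add_zero] at t4
      refine t4.congr fun x => ?_
      have : a - 1 / 2 ≠ 0 := by linarith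
      simp only [Function.comp]
      have e : C / (a - 1 / 2) * (((a - 1 / 2) * x) ^ 1 * Real.exp (-((a - 1 / 2) * x)))
          = C * x * Real.exp (-((a - 1 / 2) * x)) := by
        rw [pow_one, ← mul_assoc, ← mul_assoc, div_mul_cancel₀ _ this]
      rw [e]; ring
    refine squeeze_zero_norm' ?_ hg
    filter_upwards [eventually_ge_atTop (0 : ℝ)] with x hx
    rw [norm_mul, Real.norm_of_nonneg (Real.exp_pos _).le, Real.norm_eq_abs,
      show -((a - 1 / 2) * x) = -a * x + x / 2 by ring, Real.exp_add, mul_assoc]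
    refine mul_le_mul_of_nonneg_left ?_ (Real.exp_pos _).le
    exact (hlin x hx).trans_eq (mul_comm _ _)
  have := integral_Ioi_of_hasDerivAt_of_tendsto (hF 0 (mem_Ici.2 le_rfl)).continuousWithinAt
    (fun x hx => (hF x (Ioi_subset_Ici_self hx)).hasDerivAt (Ici_mem_nhds hx)) hIntg hlim
  rw [this]
  simp

theorem hasDerivWithinAt_iteratedDerivWithin {n : ℕ} {S : Set ℝ} (hS : UniqueDiffOn ℝ S)
    {f : ℝ → ℝ} (hf : ContDiffOn ℝ n f S) {j : ℕ} (hj : j < n) {x : ℝ} (hx : x ∈ S) :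
    HasDerivWithinAt (iteratedDerivWithin j f S) (iteratedDerivWithin (j + 1) f S x) S x := by
  rw [iteratedDerivWithin_succ]
  exact (hf.differentiableOn_iteratedDerivWithin (by exact_mod_cast hj) hS x hx).hasDerivWithinAt

theorem MemDomLA.memX_opLA {ℓ : ℝ} {w : GenFun} (hw : MemDomLA ℓ w) (ε : ℝ) :
    MemX ℓ (opLA ℓ ε w) := hw.memX_opL.add (hw.memX_etaeta.smul ε)

/-- The pairing of `ℒw - (a² - a)w` depends only on the trace `w(0, ·)`. -/
theorem MemDomLA.pair_opL {ℓ a : ℝ} (ha : 1 < a) {w : GenFun} (hw : MemDomLA ℓ w) {η : ℝ}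
    (hη : η ∈ cell ℓ) :
    pair a (opL w) η - (a ^ 2 - a) * pair a w η = (1 / a - (2 * a - 1)) * w.1 0 η := by
  have ha1 := ha.le
  have ha0 : 0 < a := by linarith
  obtain ⟨C, hC, hwC⟩ := hw.memX.exists_bound
  obtain ⟨D, hD, hwD⟩ := hw.memX_opL.exists_bound
  have hI1 := hw.memX.integrableOn_fst ha1 hη
  have hI2 := hw.memX.integrableOn_snd ha1 hη
  have hL1 := hw.memX_opL.integrableOn_fst ha1 hη
  have hL2 := hw.memX_opL.integrableOn_snd ha1 hη
  have hE : IntegrableOn (fun x : ℝ => Real.exp (a * x) * w.1 0 η) (Iic 0) :=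
    (integrableOn_exp_mul_Iic ha0 0).mul_const _
  have e1 : ∀ x, Real.exp ((a - 1) * x) * ((dX 2 w).1 x η - (dX 1 w).1 x η - (a ^ 2 - a) * w.1 x η)
      = Real.exp ((a - 1) * x) * (opL w).1 x η - (a ^ 2 - a) * (Real.exp ((a - 1) * x) * w.1 x η)
        - Real.exp (a * x) * w.1 0 η := fun x => by
    simp only [opL]
    rw [show a * x = (a - 1) * x + x by ring, Real.exp_add]; ring
  have e2 : ∀ x, Real.exp (-a * x) * ((dX 2 w).2 x η - (dX 1 w).2 x η - (a ^ 2 - a) * w.2 x η)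
      = Real.exp (-a * x) * (opL w).2 x η - (a ^ 2 - a) * (Real.exp (-a * x) * w.2 x η) :=
    fun x => by simp only [opL]; ring
  have i1 := integral_Iic_exp_mul_eq (v := fun x => w.1 x η) (v₁ := fun x => (dX 1 w).1 x η)
    (v₂ := fun x => (dX 2 w).1 x η) (C := C + D) ha ?_ ?_ ?_ ?_ ?_
  · have i2 := integral_Ioi_exp_mul_eq (v := fun x => w.2 x η) (v₁ := fun x => (dX 1 w).2 x η)
      (v₂ := fun x => (dX 2 w).2 x η) (C := C + D) ha ?_ ?_ ?_ ?_ ?_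
    · simp only [e1] at i1
      simp only [e2] at i2
      have hS1 : IntegrableOn (fun x => Real.exp ((a - 1) * x) * (opL w).1 x η -
        (a ^ 2 - a) * (Real.exp ((a - 1) * x) * w.1 x η)) (Iic 0) :=
        hL1.sub (hI1.const_mul (a ^ 2 - a))
      rw [integral_sub hS1 hE, integral_sub hL1 (hI1.const_mul _),
        integral_const_mul, integral_mul_const, integral_exp_mul_Iic ha0, mul_zero,
        Real.exp_zero] at i1
      rw [integral_sub hL2 (hI2.const_mul _), integral_const_mul] at i2
      have m0 : w.1 0 η = w.2 0 η := by
        have := hw.matching 0 (by norm_num) η hη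
        simpa [dX] using this
      have m1 := hw.matching 1 le_rfl η hη
      simp only [pair]
      rw [← m0, ← m1] at i2
      -- The matching conditions cancel the traces of `w_x`; the traces of `w` add up to `-a - (a-1)
      -- = -(2a-1)`, and `1/a` is the integral of `e^{ax}` coming from the nonlocal term.
      linear_combination i1 + i2
    · intro x hx
      have := hasDerivWithinAt_iteratedDerivWithin (uniqueDiffOn_Ici 0)
        (hw.snd_C20.fst_diff η hη) (show 0 < 2 by norm_num) hx
      simpa only [iteratedDerivWithin_zero, dX, zero_add] using this
    · intro x hx
      exact hasDerivWithinAt_iteratedDerivWithin (uniqueDiffOn_Ici 0)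
        (hw.snd_C20.fst_diff η hη) (show 1 < 2 by norm_num) hx
    · intro x hx
      have := hwC.2 x hx η hη
      nlinarith [Real.exp_pos (x / 2)]
    · intro x hx
      have := hwD.2 x hx η hη
      simp only [opL] at this
      nlinarith [Real.exp_pos (x / 2)]
    · exact (hL2.sub (hI2.const_mul _)).congr (.of_forall fun x => (e2 x).symm)
  · intro x hx
    have := hasDerivWithinAt_iteratedDerivWithin (uniqueDiffOn_Iic 0)
      (hw.fst_C20.fst_diff η hη) (show 0 < 2 by norm_num) hx
    simpa only [iteratedDerivWithin_zero, dX, zero_add] using this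
  · intro x hx
    exact hasDerivWithinAt_iteratedDerivWithin (uniqueDiffOn_Iic 0)
      (hw.fst_C20.fst_diff η hη) (show 1 < 2 by norm_num) hx
  · intro x hx
    have h1 := hwC.1 x hx η hη
    have h2 : Real.exp (x / 2) ≤ 1 := Real.exp_le_one_iff.2 (by have : x ≤ 0 := hx; linarith)
    nlinarith
  · intro x hx
    have hx0 : x ≤ 0 := hx
    have h1 := hwD.1 x hx η hη
    have h0 := hwC.1 0 le_rfl η hη
    rw [zero_div, Real.exp_zero, mul_one] at h0
    have h2 : Real.exp (x / 2) ≤ 1 := Real.exp_le_one_iff.2 (by linarith)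
    have h3 : Real.exp x ≤ 1 := Real.exp_le_one_iff.2 hx0
    have e : (dX 2 w).1 x η - (dX 1 w).1 x η = (opL w).1 x η - Real.exp x * w.1 0 η := by
      simp only [opL]; ring
    rw [e]
    refine (abs_sub _ _).trans ?_
    rw [abs_mul, abs_of_pos (Real.exp_pos x)]
    have h4 : Real.exp x * |w.1 0 η| ≤ 1 * C :=
      mul_le_mul h3 h0 (abs_nonneg _) zero_le_one
    nlinarith
  · exact ((hL1.sub (hI1.const_mul _)).sub hE).congr (.of_forall fun x => (e1 x).symm)

theorem MemDomLA.fc_pair_dEtaGen {ℓ a : ℝ} (hℓ : 0 < ℓ) (ha : 1 ≤ a) {w : GenFun}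
    (hw : MemDomLA ℓ w) (k : ℤ) :
    fc ℓ (pair a (dEtaGen ℓ 2 w)) k = -lam ℓ k * fc ℓ (pair a w) k := by
  have key : ∀ {g : ℝ → ℝ}, ContDiffOn ℝ 2 g (cell ℓ) → PeriodicUpTo ℓ 1 g →
      fc ℓ (dEta ℓ 2 g) k = -lam ℓ k * fc ℓ g k := by
    intro g hg hp
    have h0 := hasDerivWithinAt_dEta hℓ (n := 2) hg (j := 0) (by norm_num)
    rw [dEta_zero] at h0
    have p0 := hp 0 (by norm_num)
    rw [dEta_zero] at p0
    exact fc_deriv_deriv hℓ h0 (hasDerivWithinAt_dEta hℓ (n := 2) hg (j := 1) (by norm_num))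
      (continuousOn_dEta hℓ (n := 2) hg le_rfl) p0 (hp 1 le_rfl) k
  rw [hw.memX_etaeta.fc_pair hℓ ha, hw.memX.fc_pair hℓ ha, mul_add, ← integral_const_mul,
    ← integral_const_mul]
  congr 1
  · refine setIntegral_congr_fun measurableSet_Iic fun x hx => ?_
    simp only [dEtaGen]
    rw [key (hw.fst_C02.snd_diff x hx) (hw.periodic_fst x hx)]
    ring
  · refine setIntegral_congr_fun measurableSet_Ioi fun x hx => ?_
    have hx' : x ∈ Ici (0 : ℝ) := Ioi_subset_Ici_self hx
    simp only [dEtaGen]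
    rw [key (hw.snd_C02.snd_diff x hx') (hw.periodic_snd x hx')]
    ring

/-- On the `k`-th mode `εD_ηη` acts as `-ελ`, and `a` is chosen so that this cancels `(a² - a) pair
a w`: only the trace remains. -/
theorem MemDomLA.fc_pair_opLA {ℓ ε a : ℝ} (hℓ : 0 < ℓ) (ha : 1 < a) {w : GenFun}
    (hw : MemDomLA ℓ w) {k : ℤ} (hk : ε * lam ℓ k = a ^ 2 - a) :
    fc ℓ (pair a (opLA ℓ ε w)) k = ((1 / a - (2 * a - 1) : ℝ) : ℂ) * fc ℓ (w.1 0) k := by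
  have hw0 : ContinuousOn (w.1 0) (cell ℓ) :=
    ContinuousOn.uncurry_left' hw.memX.cont_fst (mem_Iic.2 le_rfl)
  have e1 : ∀ η ∈ cell ℓ, pair a (opLA ℓ ε w) η =
      ((1 / a - (2 * a - 1)) * w.1 0 η + (a ^ 2 - a) * pair a w η)
        + ε * pair a (dEtaGen ℓ 2 w) η := by
    intro η hη
    rw [opLA, pair_add ha.le hw.memX_opL (hw.memX_etaeta.smul ε) hη, pair_smul,
      ← hw.pair_opL ha hη]
    ring
  rw [fc_congr hℓ e1,
    fc_add hℓ (continuousOn_fun_add (continuousOn_const_mul _ hw0)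
      (continuousOn_const_mul _ (hw.memX.continuousOn_pair ha.le)))
      (continuousOn_const_mul _ (hw.memX_etaeta.continuousOn_pair ha.le)),
    fc_add hℓ (continuousOn_const_mul _ hw0)
      (continuousOn_const_mul _ (hw.memX.continuousOn_pair ha.le)),
    fc_const_mul, fc_const_mul, fc_const_mul, hw.fc_pair_dEtaGen hℓ ha.le, ← hk]
  push_cast
  ring

/-- The pairing identity passes to the closure `L_ε`. -/
theorem IsLEps.fc_pair {ℓ ε a : ℝ} (hℓ : 0 < ℓ) (ha : 1 < a) {u g : GenFun}
    (hu : IsLEps ℓ ε u g) {k : ℤ} (hk : ε * lam ℓ k = a ^ 2 - a) :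
    fc ℓ (pair a g) k = ((1 / a - (2 * a - 1) : ℝ) : ℂ) * fc ℓ (u.1 0) k := by
  rw [← sub_eq_zero, ← norm_eq_zero]
  refine le_antisymm (le_of_forall_pos_le_add fun δ hδ => ?_) (norm_nonneg _)
  set c : ℝ := 1 / a - (2 * a - 1) with hc
  have hK : 0 < 4 + |c| := by positivity
  -- The 4 is the norm of the pairing from `XBound.abs_pair_le`, and `|c|` multiplies the error of
  -- the trace.
  set δ' : ℝ := δ / (4 + |c|) with hδ'
  have hδ'p : 0 < δ' := by positivity
  obtain ⟨w, hw, h1, h2⟩ := hu.approx (ENNReal.ofReal δ') (ENNReal.ofReal_pos.2 hδ'p)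
  have b1 := XBound.of_normX_le hδ'p.le h1.le
  have b2 := XBound.of_normX_le hδ'p.le h2.le
  have hz : (0 : ℝ) ∈ Iic (0 : ℝ) := mem_Iic.2 le_rfl
  have cw := ContinuousOn.uncurry_left' hw.memX.cont_fst hz
  have cu := ContinuousOn.uncurry_left' hu.memX.cont_fst hz
  have n1 : ‖fc ℓ (w.1 0) k - fc ℓ (u.1 0) k‖ ≤ δ' := by
    rw [← fc_sub hℓ cw cu]
    refine norm_fc_le hℓ (fun η hη => ?_) k
    have := b1.1 0 le_rfl η hη
    simpa using this
  have n2 : ‖fc ℓ (pair a (opLA ℓ ε w)) k - fc ℓ (pair a g) k‖ ≤ 4 * δ' := by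
    rw [← fc_sub hℓ ((hw.memX_opLA ε).continuousOn_pair ha.le)
      (hu.memX_image.continuousOn_pair ha.le)]
    refine norm_fc_le hℓ (fun η hη => ?_) k
    rw [← pair_sub ha.le (hw.memX_opLA ε) hu.memX_image hη]
    exact b2.abs_pair_le ha.le hδ'p.le hη
  have e := hw.fc_pair_opLA hℓ ha hk
  have e2 : fc ℓ (pair a g) k - (c : ℂ) * fc ℓ (u.1 0) k =
      -(fc ℓ (pair a (opLA ℓ ε w)) k - fc ℓ (pair a g) k)
        + c * (fc ℓ (w.1 0) k - fc ℓ (u.1 0) k) := by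
    rw [e]; ring
  rw [e2, zero_add]
  refine (norm_add_le _ _).trans ?_
  rw [norm_neg, norm_mul, Complex.norm_real, Real.norm_eq_abs]
  have : |c| * ‖fc ℓ (w.1 0) k - fc ℓ (u.1 0) k‖ ≤ |c| * δ' := by gcongr
  have : (4 + |c|) * δ' = δ := by rw [hδ']; field_simp
  linarith

/-! ### Quadratic polynomials times exponentials -/

/-- The constants 2 and 16 = 4² come from `t ≤ e^t` with `t = |x|/2` and `t = |x|/4`. -/
theorem abs_quadratic_le (p₀ p₁ p₂ x : ℝ) :
    |p₀ + p₁ * x + p₂ * x ^ 2| ≤ (|p₀| + 2 * |p₁| + 16 * |p₂|) * Real.exp (|x| / 2) := by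
  have h1 : 1 ≤ Real.exp (|x| / 2) := Real.one_le_exp (by positivity)
  have h2 : |x| ≤ 2 * Real.exp (|x| / 2) := by
    linarith [Real.add_one_le_exp (|x| / 2)]
  have h3 : |x| ^ 2 ≤ 16 * Real.exp (|x| / 2) := by
    have h4 : |x| ≤ 4 * Real.exp (|x| / 4) := by
      linarith [Real.add_one_le_exp (|x| / 4)]
    calc |x| ^ 2 ≤ (4 * Real.exp (|x| / 4)) ^ 2 := by gcongr
      _ = 16 * Real.exp (|x| / 2) := by
        rw [mul_pow, ← Real.exp_nat_mul]; norm_num; ring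
  refine (abs_add_three _ _ _).trans ?_
  rw [abs_mul, abs_mul, abs_pow]
  nlinarith [mul_le_mul_of_nonneg_left h1 (abs_nonneg p₀),
    mul_le_mul_of_nonneg_left h2 (abs_nonneg p₁), mul_le_mul_of_nonneg_left h3 (abs_nonneg p₂)]

theorem abs_quadratic_mul_exp_le {a : ℝ} (p₀ p₁ p₂ : ℝ) {x : ℝ} (hx : x ≤ 0) :
    ‖(p₀ + p₁ * x + p₂ * x ^ 2) * Real.exp (a * x)‖ ≤
      (|p₀| + 2 * |p₁| + 16 * |p₂|) * Real.exp ((a - 1 / 2) * x) := by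
  rw [norm_mul, Real.norm_eq_abs, Real.norm_of_nonneg (Real.exp_pos _).le]
  have h := abs_quadratic_le p₀ p₁ p₂ x
  rw [abs_of_nonpos hx] at h
  calc _ ≤ (|p₀| + 2 * |p₁| + 16 * |p₂|) * Real.exp (-x / 2) * Real.exp (a * x) := by gcongr
    _ = _ := by
      rw [mul_assoc, ← Real.exp_add]; ring_nf

theorem integrableOn_quadratic_mul_exp {a : ℝ} (ha : 1 ≤ a) (p₀ p₁ p₂ : ℝ) :
    IntegrableOn (fun x => (p₀ + p₁ * x + p₂ * x ^ 2) * Real.exp (a * x)) (Iic 0) := by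
  refine Integrable.mono' ((integrableOn_exp_mul_Iic (a := a - 1 / 2) (by linarith) 0).const_mul
    (|p₀| + 2 * |p₁| + 16 * |p₂|)) (Continuous.aestronglyMeasurable (by fun_prop)) ?_
  exact (ae_restrict_iff' measurableSet_Iic).2
    (.of_forall fun x hx => abs_quadratic_mul_exp_le p₀ p₁ p₂ hx)

theorem hasDerivAt_quadratic_mul_exp (a p₀ p₁ p₂ x : ℝ) :
    HasDerivAt (fun x => (p₀ + p₁ * x + p₂ * x ^ 2) * Real.exp (a * x))
      (((a * p₀ + p₁) + (a * p₁ + 2 * p₂) * x + (a * p₂) * x ^ 2) * Real.exp (a * x)) x := by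
  have h1 : HasDerivAt (fun x : ℝ => p₀ + p₁ * x + p₂ * x ^ 2) (p₁ + p₂ * (2 * x)) x := by
    have h := (((hasDerivAt_id' x).const_mul p₁).const_add p₀).add
      ((hasDerivAt_pow 2 x).const_mul p₂)
    exact h.congr_deriv (by simp)
  have h2 : HasDerivAt (fun x : ℝ => Real.exp (a * x)) (Real.exp (a * x) * a) x := by
    have := ((hasDerivAt_id x).const_mul a).exp
    simpa using this
  exact (h1.mul h2).congr_deriv (by ring)

-- An antiderivative is again a quadratic times `e^{ax}`; its coefficients `c₂`, `c₁`, `c₀` solve a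
-- triangular system by back substitution.
open Filter Topology in
theorem integral_quadratic_mul_exp {a : ℝ} (ha : 1 ≤ a) (p₀ p₁ p₂ : ℝ) :
    ∫ x in Iic (0 : ℝ), (p₀ + p₁ * x + p₂ * x ^ 2) * Real.exp (a * x) =
      p₀ / a - p₁ / a ^ 2 + 2 * p₂ / a ^ 3 := by
  have ha0 : a ≠ 0 := by linarith
  set c₂ := p₂ / a with h₂
  set c₁ := (p₁ - 2 * c₂) / a with h₁
  set c₀ := (p₀ - c₁) / a with h₀
  have hlim : Tendsto (fun x => (c₀ + c₁ * x + c₂ * x ^ 2) * Real.exp (a * x)) atBot (𝓝 0) := by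
    have hg : Tendsto (fun x : ℝ => (|c₀| + 2 * |c₁| + 16 * |c₂|) * Real.exp ((a - 1 / 2) * x))
        atBot (𝓝 0) := by
      have : Tendsto (fun x : ℝ => (a - 1 / 2) * x) atBot atBot :=
        tendsto_id.const_mul_atBot (by linarith)
      simpa using (Real.tendsto_exp_atBot.comp this).const_mul (|c₀| + 2 * |c₁| + 16 * |c₂|)
    refine squeeze_zero_norm' ?_ hg
    filter_upwards [eventually_le_atBot (0 : ℝ)] with x hx
    exact abs_quadratic_mul_exp_le c₀ c₁ c₂ hx
  have e0 : a * c₀ + c₁ = p₀ := by rw [h₀]; field_simp; ring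
  have e1 : a * c₁ + 2 * c₂ = p₁ := by rw [h₁]; field_simp; ring
  have e2 : a * c₂ = p₂ := by rw [h₂]; field_simp
  have := integral_Iic_of_hasDerivAt_of_tendsto' (a := (0 : ℝ))
    (fun x _ => hasDerivAt_quadratic_mul_exp a c₀ c₁ c₂ x)
    (integrableOn_quadratic_mul_exp ha _ _ _) hlim
  rw [e0, e1, e2] at this
  rw [this]
  simp only [h₀, h₁, h₂]
  simp
  field_simp
  ring

theorem integrableOn_linear_mul_exp_neg {a : ℝ} (ha : 1 ≤ a) (q₀ q₁ : ℝ) :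
    IntegrableOn (fun x => Real.exp (-a * x) * (q₀ + q₁ * x)) (Ioi 0) := by
  have h := integrableOn_quadratic_mul_exp ha q₀ (-q₁) 0
  rw [integrableOn_Iic_iff_integrableOn_Iio] at h
  have h2 := h.comp_neg
  rw [Set.neg_Iio, neg_zero] at h2
  refine h2.congr_fun (fun x _ => ?_) measurableSet_Ioi
  simp only
  ring_nf

theorem integral_linear_mul_exp_neg {a : ℝ} (ha : 1 ≤ a) (q₀ q₁ : ℝ) :
    ∫ x in Ioi (0 : ℝ), Real.exp (-a * x) * (q₀ + q₁ * x) = q₀ / a + q₁ / a ^ 2 := by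
  have h := integral_quadratic_mul_exp ha q₀ (-q₁) 0
  have h2 := integral_comp_neg_Ioi (0 : ℝ)
    (fun x => (q₀ + -q₁ * x + 0 * x ^ 2) * Real.exp (a * x))
  rw [neg_zero, h] at h2
  rw [show q₀ / a + q₁ / a ^ 2 = q₀ / a - -q₁ / a ^ 2 + 2 * 0 / a ^ 3 by ring, ← h2]
  congr 1
  ext x
  ring_nf

/-! ### Solutions of the mode equations -/

/-- `v`, with derivatives `v₁` and `v₂`, is a decaying solution of
`ℒv - μv = -h` in the variable `x` alone, with `Q(v) = 0`. -/
structure ModeSol (μ C : ℝ) (h v v₁ v₂ : GenFun1) : Prop where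
  deriv_fst : ∀ x, HasDerivAt v.1 (v₁.1 x) x
  deriv_fst' : ∀ x, HasDerivAt v₁.1 (v₂.1 x) x
  cont_fst : Continuous v₂.1
  deriv_snd : ∀ x, HasDerivAt v.2 (v₁.2 x) x
  deriv_snd' : ∀ x, HasDerivAt v₁.2 (v₂.2 x) x
  cont_snd : Continuous v₂.2
  eq_fst : ∀ x, v₂.1 x - v₁.1 x + Real.exp x * v.1 0 - μ * v.1 x = -h.1 x
  eq_snd : ∀ x, v₂.2 x - v₁.2 x - μ * v.2 x = -h.2 x
  match_zero : v.1 0 = v.2 0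
  match_one : v₁.1 0 = v₁.2 0
  bound_fst : ∀ x ≤ 0, |v.1 x| ≤ C * Real.exp (x / 2)
  bound_snd : ∀ x ≥ 0, |v.2 x| ≤ C * Real.exp (x / 2)
  int_fst : IntegrableOn v.1 (Iic 0)
  int_snd : IntegrableOn (fun x => Real.exp (-x) * v.2 x) (Ioi 0)
  proj : (∫ x in Iic (0 : ℝ), v.1 x) + ∫ x in Ioi (0 : ℝ), Real.exp (-x) * v.2 x = 0

/-- The explicit solutions are `(A e^{ax} + p(x) e^x, B e^{(1-a)x} + q(x))`. -/
theorem modeSol_of_coeffs {a α₀ α₁ α₂ β₀ β₁ A B p₀ p₁ p₂ q₀ q₁ C : ℝ} {h : GenFun1}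
    (hh₁ : ∀ x, h.1 x = (α₀ + α₁ * x + α₂ * x ^ 2) * Real.exp x) (hh₂ : ∀ x, h.2 x = β₀ + β₁ * x)
    (ha : 1 ≤ a)
    (e₂ : (a ^ 2 - a) * p₂ = α₂) (e₁ : (a ^ 2 - a) * p₁ = 2 * p₂ + α₁)
    (e₀ : (a ^ 2 - a) * p₀ = 2 * p₂ + p₁ + α₀ + (A + p₀))
    (f₁ : (a ^ 2 - a) * q₁ = β₁) (f₀ : (a ^ 2 - a) * q₀ = β₀ - q₁)
    (m₀ : A + p₀ = B + q₀) (m₁ : a * A + p₀ + p₁ = (1 - a) * B + q₁)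
    (hQ : A / a + (p₀ - p₁ + 2 * p₂) + B / a + (q₀ + q₁) = 0)
    (hC₁ : |A| + (|p₀| + 2 * |p₁| + 16 * |p₂|) ≤ C) (hC₂ : |B| + (|q₀| + 2 * |q₁|) ≤ C) :
    ∃ v v₁ v₂ : GenFun1, ModeSol (a ^ 2 - a) C h v v₁ v₂ := by
  have dq := hasDerivAt_quadratic_mul_exp 1
  simp only [one_mul] at dq
  have de : ∀ b c x : ℝ, HasDerivAt (fun x => c * Real.exp (b * x))
      (b * c * Real.exp (b * x)) x := fun b c x => by
    have := (((hasDerivAt_id x).const_mul b).exp).const_mul c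
    refine (this.congr_deriv ?_)
    simp; ring
  have dl : ∀ c d x : ℝ, HasDerivAt (fun x => c + d * x) d x := fun c d x => by
    simpa using ((hasDerivAt_id x).const_mul d).const_add c
  have iq := integrableOn_quadratic_mul_exp le_rfl p₀ p₁ p₂
  have vq := integral_quadratic_mul_exp le_rfl p₀ p₁ p₂
  simp only [one_mul] at iq vq
  have ie := integrableOn_quadratic_mul_exp ha A 0 0
  have ve := integral_quadratic_mul_exp ha A 0 0
  simp only [zero_mul, add_zero] at ie ve
  have iB := integrableOn_linear_mul_exp_neg ha B 0
  have vB := integral_linear_mul_exp_neg ha B 0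
  simp only [zero_mul, add_zero] at iB vB
  have il := integrableOn_linear_mul_exp_neg le_rfl q₀ q₁
  have vl := integral_linear_mul_exp_neg le_rfl q₀ q₁
  have eB : ∀ x : ℝ, Real.exp (-x) * (B * Real.exp ((1 - a) * x) + (q₀ + q₁ * x)) =
      Real.exp (-a * x) * B + Real.exp (-1 * x) * (q₀ + q₁ * x) := fun x => by
    rw [show -a * x = -x + (1 - a) * x by ring, Real.exp_add]; ring_nf
  refine ⟨(fun x => A * Real.exp (a * x) + (p₀ + p₁ * x + p₂ * x ^ 2) * Real.exp x,
      fun x => B * Real.exp ((1 - a) * x) + (q₀ + q₁ * x)),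
    (fun x => a * A * Real.exp (a * x) +
        ((p₀ + p₁) + (p₁ + 2 * p₂) * x + p₂ * x ^ 2) * Real.exp x,
      fun x => (1 - a) * B * Real.exp ((1 - a) * x) + q₁),
    (fun x => a * (a * A) * Real.exp (a * x) +
        ((p₀ + p₁ + (p₁ + 2 * p₂)) + (p₁ + 2 * p₂ + 2 * p₂) * x + p₂ * x ^ 2) * Real.exp x,
      fun x => (1 - a) * ((1 - a) * B) * Real.exp ((1 - a) * x)),
    ⟨fun x => (de a A x).add (dq p₀ p₁ p₂ x), fun x => (de a (a * A) x).add (dq _ _ _ x),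
      by fun_prop, fun x => (de (1 - a) B x).add (dl q₀ q₁ x),
      fun x => (de (1 - a) ((1 - a) * B) x).add_const _, by fun_prop, ?_, ?_, ?_, ?_, ?_, ?_,
      ie.add iq, ?_, ?_⟩⟩
  · intro x
    simp only [hh₁]
    simp only [mul_zero, Real.exp_zero, zero_pow two_ne_zero, add_zero, mul_one]
    -- The exponential `A e^{ax}` solves the local homogeneous equation. The remaining terms are
    -- sorted by powers of `x`, and `A + p₀ = v(0)` in `e₀` is the nonlocal contribution.
    linear_combination (-Real.exp x) * (e₀ + x * e₁ + x ^ 2 * e₂)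
  · intro x
    simp only [hh₂]
    linear_combination -f₀ - x * f₁
  · simpa using m₀
  · simp; linear_combination m₁
  · intro x hx
    have h1 := abs_quadratic_mul_exp_le (a := 1) p₀ p₁ p₂ hx
    rw [one_mul, Real.norm_eq_abs, show (1 - 1 / 2) * x = x / 2 by ring] at h1
    have h2 : Real.exp (a * x) ≤ Real.exp (x / 2) := Real.exp_le_exp.2 (by nlinarith)
    refine (abs_add_le _ _).trans ?_
    rw [abs_mul, abs_of_pos (Real.exp_pos (a * x))]
    nlinarith [mul_le_mul_of_nonneg_left h2 (abs_nonneg A), Real.exp_pos (x / 2)]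
  · intro x hx
    have h1 := abs_quadratic_le q₀ q₁ 0 x
    simp only [zero_mul, add_zero, abs_zero, mul_zero] at h1
    rw [abs_of_nonneg hx] at h1
    have h2 : Real.exp ((1 - a) * x) ≤ Real.exp (x / 2) := Real.exp_le_exp.2 (by nlinarith)
    refine (abs_add_le _ _).trans ?_
    rw [abs_mul, abs_of_pos (Real.exp_pos ((1 - a) * x))]
    nlinarith [mul_le_mul_of_nonneg_left h2 (abs_nonneg B), Real.exp_pos (x / 2)]
  · simp only [eB]
    exact iB.add il
  · simp only [eB]
    rw [integral_add ie iq, integral_add iB il, ve, vq, vB, vl]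
    linear_combination hQ

/-- The quantity inverted is the factor dividing the trace `v(0)` in the mode problem. It vanishes
at `a = 1`; the lower bound `μ₁` keeps `a` away from there, since `μ₁ ≤ a(a-1) ≤ 2(a-1)` when `a ≤
2`. -/
theorem inv_mode_det_le {a μ₁ : ℝ} (hμ₁ : 0 < μ₁) (ha : 1 < a) (hμ : μ₁ ≤ a ^ 2 - a) :
    ((2 * a + 1) * (a - 1) / a)⁻¹ ≤ 1 + μ₁⁻¹ := by
  have ha0 : 0 < a := by linarith
  have ha1 : 0 < a - 1 := by linarith
  have hm0 : 0 < μ₁⁻¹ := inv_pos.2 hμ₁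
  have h2a : 2 * (a - 1) ≤ (2 * a + 1) * (a - 1) / a := by
    rw [le_div_iff₀ ha0]; nlinarith
  rw [inv_le_comm₀ (by positivity) (by positivity)]
  refine le_trans ?_ h2a
  rw [inv_le_iff_one_le_mul₀ (by positivity)]
  rcases le_or_gt 2 a with h | h
  · nlinarith
  · have h3 : μ₁ * μ₁⁻¹ = 1 := mul_inv_cancel₀ hμ₁.ne'
    have h4 : μ₁ ≤ 2 * (a - 1) := by nlinarith
    nlinarith

/-- The unknown is the trace `s = v(0)`. Given `s`, the polynomial coefficients follow by back
substitution and `A = s - p₀`, `B = s - q₀`; continuity of the derivative at `0` fixes `s`. Since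
`Q` annihilates the range of `ℒ`, `hQ` (that is, `Q(h) = 0`) forces `Q(v) = 0`. The constant does
not depend on `a`, so one constant serves all modes. -/
theorem exists_modeSol {α₀ α₁ α₂ β₀ β₁ μ₁ : ℝ} (hμ₁ : 0 < μ₁) {h : GenFun1}
    (hh₁ : ∀ x, h.1 x = (α₀ + α₁ * x + α₂ * x ^ 2) * Real.exp x) (hh₂ : ∀ x, h.2 x = β₀ + β₁ * x)
    (hQ : α₀ - α₁ + 2 * α₂ + β₀ + β₁ = 0) :
    ∃ C, 0 ≤ C ∧ ∀ a : ℝ, 1 < a → μ₁ ≤ a ^ 2 - a →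
      ∃ v v₁ v₂ : GenFun1, ModeSol (a ^ 2 - a) C h v v₁ v₂ := by
  -- Each capital letter majorizes its lower-case counterpart below, with `m = 1/μ₁` in place of
  -- `1/(a² - a)` and `1 + m` in place of the inverse determinant.
  obtain ⟨m, hm⟩ : ∃ y, y = μ₁⁻¹ := ⟨_, rfl⟩
  have hm0 : 0 < m := hm ▸ inv_pos.2 hμ₁
  obtain ⟨P₂, hP₂⟩ : ∃ y, y = |α₂| * m := ⟨_, rfl⟩
  obtain ⟨P₁, hP₁⟩ : ∃ y, y = (2 * P₂ + |α₁|) * m := ⟨_, rfl⟩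
  obtain ⟨Q₁, hQ₁⟩ : ∃ y, y = |β₁| * m := ⟨_, rfl⟩
  obtain ⟨Q₀, hQ₀⟩ : ∃ y, y = (|β₀| + Q₁) * m := ⟨_, rfl⟩
  obtain ⟨S, hS⟩ : ∃ y, y = (2 * P₂ + P₁ + |α₀| + P₁ + (|β₀| + Q₁) + Q₁) * (1 + m) := ⟨_, rfl⟩
  obtain ⟨P₀, hP₀⟩ : ∃ y, y = (2 * P₂ + P₁ + |α₀| + S) * m := ⟨_, rfl⟩
  have hP₂0 : 0 ≤ P₂ := by rw [hP₂]; positivity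
  have hP₁0 : 0 ≤ P₁ := by rw [hP₁]; positivity
  have hQ₁0 : 0 ≤ Q₁ := by rw [hQ₁]; positivity
  have hQ₀0 : 0 ≤ Q₀ := by rw [hQ₀]; positivity
  have hS0 : 0 ≤ S := by rw [hS]; positivity
  have hP₀0 : 0 ≤ P₀ := by rw [hP₀]; positivity
  refine ⟨S + P₀ + (P₀ + 2 * P₁ + 16 * P₂) + (S + Q₀ + (Q₀ + 2 * Q₁)), by positivity, ?_⟩
  intro a ha hμ
  have ha0 : 0 < a := by linarith
  have ha1 : 0 < a - 1 := by linarith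
  have hμ0 : 0 < a ^ 2 - a := by linarith
  have hdiv : ∀ {x X : ℝ}, |x| ≤ X → |x / (a ^ 2 - a)| ≤ X * m := by
    intro x X hx
    rw [abs_div, abs_of_pos hμ0, div_eq_mul_inv]
    rw [hm]
    exact mul_le_mul hx (inv_anti₀ hμ₁ hμ) (by positivity) ((abs_nonneg _).trans hx)
  have hdiva : ∀ {x X : ℝ}, |x| ≤ X → |x / a| ≤ X := by
    intro x X hx
    rw [abs_div, abs_of_pos ha0]
    exact (div_le_self (abs_nonneg _) ha.le).trans hx
  have h2' : ∀ x : ℝ, |2 * x| = 2 * |x| := fun x => by rw [abs_mul, abs_two]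
  obtain ⟨p₂, hp₂⟩ : ∃ y, y = α₂ / (a ^ 2 - a) := ⟨_, rfl⟩
  obtain ⟨p₁, hp₁⟩ : ∃ y, y = (2 * p₂ + α₁) / (a ^ 2 - a) := ⟨_, rfl⟩
  obtain ⟨q₁, hq₁⟩ : ∃ y, y = β₁ / (a ^ 2 - a) := ⟨_, rfl⟩
  obtain ⟨q₀, hq₀⟩ : ∃ y, y = (β₀ - q₁) / (a ^ 2 - a) := ⟨_, rfl⟩
  obtain ⟨den, hden⟩ : ∃ y, y = (2 * a + 1) * (a - 1) / a := ⟨_, rfl⟩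
  obtain ⟨num, hnum⟩ : ∃ y, y = (2 * p₂ + p₁ + α₀) / a - p₁ + (β₀ - q₁) / a + q₁ := ⟨_, rfl⟩
  obtain ⟨s, hs⟩ : ∃ y, y = num / den := ⟨_, rfl⟩
  obtain ⟨p₀, hp₀⟩ : ∃ y, y = (2 * p₂ + p₁ + α₀ + s) / (a ^ 2 - a) := ⟨_, rfl⟩
  have hden0 : 0 < den := by rw [hden]; positivity
  have b2 : |p₂| ≤ P₂ := by rw [hp₂, hP₂]; exact hdiv le_rfl
  have b1 : |p₁| ≤ P₁ := by
    rw [hp₁, hP₁]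
    exact hdiv ((abs_add_le _ _).trans (by rw [h2']; linarith))
  have c1 : |q₁| ≤ Q₁ := by rw [hq₁, hQ₁]; exact hdiv le_rfl
  have c0' : |β₀ - q₁| ≤ |β₀| + Q₁ := (abs_sub _ _).trans (by linarith)
  have c0 : |q₀| ≤ Q₀ := by rw [hq₀, hQ₀]; exact hdiv c0'
  have n1 : |2 * p₂ + p₁ + α₀| ≤ 2 * P₂ + P₁ + |α₀| :=
    (abs_add_three _ _ _).trans (by rw [h2']; linarith)
  have bnum : |num| ≤ 2 * P₂ + P₁ + |α₀| + P₁ + (|β₀| + Q₁) + Q₁ := by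
    rw [hnum]
    have h1 := hdiva n1
    have h2 := hdiva c0'
    have h3 := abs_add_le ((2 * p₂ + p₁ + α₀) / a - p₁ + (β₀ - q₁) / a) q₁
    have h4 := abs_add_le ((2 * p₂ + p₁ + α₀) / a - p₁) ((β₀ - q₁) / a)
    have h5 := abs_sub ((2 * p₂ + p₁ + α₀) / a) p₁
    linarith
  have bden : den⁻¹ ≤ 1 + m := by
    rw [hden, hm]; exact inv_mode_det_le hμ₁ ha hμ
  have bs : |s| ≤ S := by
    rw [hs, hS, abs_div, abs_of_pos hden0, div_eq_mul_inv]
    exact mul_le_mul bnum bden (by positivity) ((abs_nonneg _).trans bnum)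
  have b0 : |p₀| ≤ P₀ := by
    rw [hp₀, hP₀]
    exact hdiv ((abs_add_le _ _).trans (by linarith))
  have E2 : (a ^ 2 - a) * p₂ = α₂ := by rw [hp₂]; exact mul_div_cancel₀ _ hμ0.ne'
  have E1 : (a ^ 2 - a) * p₁ = 2 * p₂ + α₁ := by rw [hp₁]; exact mul_div_cancel₀ _ hμ0.ne'
  have E0 : (a ^ 2 - a) * p₀ = 2 * p₂ + p₁ + α₀ + s := by rw [hp₀]; exact mul_div_cancel₀ _ hμ0.ne'
  have F1 : (a ^ 2 - a) * q₁ = β₁ := by rw [hq₁]; exact mul_div_cancel₀ _ hμ0.ne'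
  have F0 : (a ^ 2 - a) * q₀ = β₀ - q₁ := by rw [hq₀]; exact mul_div_cancel₀ _ hμ0.ne'
  have Es : (2 * a + 1) * (a - 1) * s = a * num := by
    have : den * s = num := by rw [hs]; exact mul_div_cancel₀ _ hden0.ne'
    rw [← this, hden]; field_simp
  have En : a * num = 2 * p₂ + p₁ + α₀ - a * p₁ + (β₀ - q₁) + a * q₁ := by
    rw [hnum]; field_simp
  have hmul : (a : ℝ) * (a - 1) = a ^ 2 - a := by ring
  have M1 : a * (s - p₀) + p₀ + p₁ = (1 - a) * (s - q₀) + q₁ := by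
    have : a * (a * (s - p₀) + p₀ + p₁) = a * ((1 - a) * (s - q₀) + q₁) := by
      linear_combination Es + En - E0 - F0
    exact mul_left_cancel₀ ha0.ne' this
  refine modeSol_of_coeffs hh₁ hh₂ ha.le (A := s - p₀) (B := s - q₀) E2 E1 (by linarith) F1 F0
    (by ring) M1 ?_ ?_ ?_
  · have hz : (a ^ 2 - a) * ((s - p₀) / a + (p₀ - p₁ + 2 * p₂) + (s - q₀) / a + (q₀ + q₁)) = 0 := by
      have e1 : (a ^ 2 - a) * ((s - p₀) / a) = (a - 1) * (s - p₀) := by field_simp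
      have e2 : (a ^ 2 - a) * ((s - q₀) / a) = (a - 1) * (s - q₀) := by field_simp
      rw [mul_add, mul_add, mul_add, e1, e2]
      linear_combination M1 + E0 - E1 + 2 * E2 + F0 + F1 + hQ
    exact (mul_eq_zero.1 hz).resolve_left hμ0.ne'
  · have := abs_sub s p₀
    linarith
  · have := abs_sub s q₀
    linarith

/-! ### Existence of the resolvent -/

theorem contDiff_two_of_hasDerivAt {f f₁ f₂ : ℝ → ℝ} (h₁ : ∀ x, HasDerivAt f (f₁ x) x)
    (h₂ : ∀ x, HasDerivAt f₁ (f₂ x) x) (hc : Continuous f₂) : ContDiff ℝ 2 f := by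
  have e1 : deriv f = f₁ := funext fun x => (h₁ x).deriv
  have e2 : deriv f₁ = f₂ := funext fun x => (h₂ x).deriv
  rw [show (2 : WithTop ℕ∞) = 1 + 1 from rfl, contDiff_succ_iff_deriv, e1, contDiff_one_iff_deriv,
    e2]
  exact ⟨fun x => (h₁ x).differentiableAt, by simp, fun x => (h₂ x).differentiableAt, hc⟩

theorem iteratedDerivWithin_one_eq {S : Set ℝ} (hS : UniqueDiffOn ℝ S) {f f₁ : ℝ → ℝ}
    (h₁ : ∀ x, HasDerivAt f (f₁ x) x) {x : ℝ} (hx : x ∈ S) :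
    iteratedDerivWithin 1 f S x = f₁ x := by
  rw [iteratedDerivWithin_one]
  exact (h₁ x).hasDerivWithinAt.derivWithin (hS x hx)

theorem iteratedDerivWithin_two_eq {S : Set ℝ} (hS : UniqueDiffOn ℝ S) {f f₁ f₂ : ℝ → ℝ}
    (h₁ : ∀ x, HasDerivAt f (f₁ x) x) (h₂ : ∀ x, HasDerivAt f₁ (f₂ x) x) {x : ℝ} (hx : x ∈ S) :
    iteratedDerivWithin 2 f S x = f₂ x := by
  rw [iteratedDerivWithin_succ]
  refine HasDerivWithinAt.derivWithin ?_ (hS x hx)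
  exact (h₂ x).hasDerivWithinAt.congr (fun y hy => iteratedDerivWithin_one_eq hS h₁ hy)
    (iteratedDerivWithin_one_eq hS h₁ hx)

theorem memC_two_zero {S K : Set ℝ} (hS : UniqueDiffOn ℝ S) {f f₁ f₂ : ℝ → ℝ → ℝ}
    (h₁ : ∀ z s, HasDerivAt (fun s => f s z) (f₁ s z) s)
    (h₂ : ∀ z s, HasDerivAt (fun s => f₁ s z) (f₂ s z) s)
    (c₀ : Continuous fun p : ℝ × ℝ => f p.1 p.2) (c₁ : Continuous fun p : ℝ × ℝ => f₁ p.1 p.2)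
    (c₂ : Continuous fun p : ℝ × ℝ => f₂ p.1 p.2) : MemC 2 0 S K f := by
  refine ⟨fun z _ => ?_, fun s _ => ?_, fun i hi => ?_, fun j hj => ?_⟩
  · exact (contDiff_two_of_hasDerivAt (h₁ z) (h₂ z)
      (c₂.comp (Continuous.prodMk_left z))).contDiffOn
  · exact contDiffOn_zero.2 (c₀.comp (Continuous.prodMk_right s)).continuousOn
  · interval_cases i
    · simpa only [iteratedDerivWithin_zero] using c₀.continuousOn
    · exact c₁.continuousOn.congr fun p hp => iteratedDerivWithin_one_eq hS (h₁ p.2) hp.1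
    · exact c₂.continuousOn.congr fun p hp => iteratedDerivWithin_two_eq hS (h₁ p.2) (h₂ p.2) hp.1
  · obtain rfl : j = 0 := by omega
    simpa only [iteratedDerivWithin_zero] using c₀.continuousOn

theorem memC_zero_two {S K : Set ℝ} (hK : UniqueDiffOn ℝ K) {f f₁ f₂ : ℝ → ℝ → ℝ}
    (h₁ : ∀ s z, HasDerivAt (f s) (f₁ s z) z) (h₂ : ∀ s z, HasDerivAt (f₁ s) (f₂ s z) z)
    (c₀ : Continuous fun p : ℝ × ℝ => f p.1 p.2) (c₁ : Continuous fun p : ℝ × ℝ => f₁ p.1 p.2)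
    (c₂ : Continuous fun p : ℝ × ℝ => f₂ p.1 p.2) : MemC 0 2 S K f := by
  refine ⟨fun z _ => ?_, fun s _ => ?_, fun j hj => ?_, fun i hi => ?_⟩
  · exact contDiffOn_zero.2 (c₀.comp (Continuous.prodMk_left z)).continuousOn
  · exact (contDiff_two_of_hasDerivAt (h₁ s) (h₂ s)
      (c₂.comp (Continuous.prodMk_right s))).contDiffOn
  · obtain rfl : j = 0 := by omega
    simpa only [iteratedDerivWithin_zero] using c₀.continuousOn
  · interval_cases i
    · simpa only [iteratedDerivWithin_zero] using c₀.continuousOn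
    · exact c₁.continuousOn.congr fun p hp => iteratedDerivWithin_one_eq hK (h₁ p.1) hp.2
    · exact c₂.continuousOn.congr fun p hp => iteratedDerivWithin_two_eq hK (h₁ p.1) (h₂ p.1) hp.2

theorem MemX.congr {ℓ : ℝ} {f g : GenFun} (hf : MemX ℓ f)
    (h₁ : ∀ x ≤ 0, ∀ η ∈ cell ℓ, g.1 x η = f.1 x η)
    (h₂ : ∀ x ≥ 0, ∀ η ∈ cell ℓ, g.2 x η = f.2 x η) : MemX ℓ g := by
  obtain ⟨C, hC, h⟩ := hf.exists_bound
  refine .of_bound (hf.cont_fst.congr fun p hp => h₁ p.1 hp.1 p.2 hp.2)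
    (hf.cont_snd.congr fun p hp => h₂ p.1 hp.1 p.2 hp.2) hC ⟨fun x hx η hη => ?_, fun x hx η hη => ?_⟩
  · rw [h₁ x hx η hη]; exact h.1 x hx η hη
  · rw [h₂ x hx η hη]; exact h.2 x hx η hη

theorem memX_sum {ℓ : ℝ} (F : Finset ℤ) {g : ℤ → ℝ → ℝ} {y : ℤ → GenFun1} {G Y : ℤ → ℝ}
    (hg : ∀ k, Continuous (g k)) (hy₁ : ∀ k, Continuous (y k).1) (hy₂ : ∀ k, Continuous (y k).2)
    (hG : ∀ k η, |g k η| ≤ G k) (hY₁ : ∀ k, ∀ x ≤ 0, |(y k).1 x| ≤ Y k * Real.exp (x / 2))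
    (hY₂ : ∀ k, ∀ x ≥ 0, |(y k).2 x| ≤ Y k * Real.exp (x / 2)) :
    MemX ℓ (fun x η => ∑ k ∈ F, g k η * (y k).1 x, fun x η => ∑ k ∈ F, g k η * (y k).2 x) := by
  have hG0 : ∀ k, 0 ≤ G k := fun k => (abs_nonneg _).trans (hG k 0)
  have hY0 : ∀ k, 0 ≤ Y k := fun k => by
    have := (abs_nonneg _).trans (hY₁ k 0 le_rfl)
    simpa using this
  refine .of_bound (C := ∑ k ∈ F, G k * Y k) (Continuous.continuousOn ?_) (Continuous.continuousOn ?_)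
    (Finset.sum_nonneg fun k _ => mul_nonneg (hG0 k) (hY0 k))
    ⟨fun x hx η _ => ?_, fun x hx η _ => ?_⟩
  · exact continuous_finsetSum _ fun k _ =>
      ((hg k).comp continuous_snd).mul ((hy₁ k).comp continuous_fst)
  · exact continuous_finsetSum _ fun k _ =>
      ((hg k).comp continuous_snd).mul ((hy₂ k).comp continuous_fst)
  · rw [Finset.sum_mul]
    refine (Finset.abs_sum_le_sum_abs _ _).trans (Finset.sum_le_sum fun k _ => ?_)
    rw [abs_mul, mul_assoc]
    exact mul_le_mul (hG k η) (hY₁ k x hx) (abs_nonneg _) (hG0 k)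
  · rw [Finset.sum_mul]
    refine (Finset.abs_sum_le_sum_abs _ _).trans (Finset.sum_le_sum fun k _ => ?_)
    rw [abs_mul, mul_assoc]
    exact mul_le_mul (hG k η) (hY₂ k x hx) (abs_nonneg _) (hG0 k)

/-- The real part of `c e_k`. -/
def reMode (ℓ : ℝ) (c : ℂ) (k : ℤ) (η : ℝ) : ℝ := (c * fexp ℓ k η).re

theorem hasDerivAt_reMode (ℓ : ℝ) (c : ℂ) (k : ℤ) (η : ℝ) :
    HasDerivAt (reMode ℓ c k) (reMode ℓ (I * freq ℓ k * c) k η) η := by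
  have h := Complex.reCLM.hasFDerivAt.comp_hasDerivAt η ((hasDerivAt_fexp ℓ k η).const_mul c)
  refine h.congr_deriv ?_
  simp only [reMode, reCLM_apply]
  congr 1; ring

theorem hasDerivAt_reMode' (ℓ : ℝ) (c : ℂ) (k : ℤ) (η : ℝ) :
    HasDerivAt (reMode ℓ (I * freq ℓ k * c) k) (-lam ℓ k * reMode ℓ c k η) η := by
  refine (hasDerivAt_reMode ℓ _ k η).congr_deriv ?_
  have : I * freq ℓ k * (I * freq ℓ k * c) * fexp ℓ k η = ((-lam ℓ k : ℝ) : ℂ) * (c * fexp ℓ k η) := by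
    rw [lam]; push_cast
    linear_combination (freq ℓ k ^ 2 * c * fexp ℓ k η : ℂ) * I_sq
  rw [reMode, this, re_ofReal_mul, reMode]

theorem continuous_reMode (ℓ : ℝ) (c : ℂ) (k : ℤ) : Continuous (reMode ℓ c k) :=
  continuous_iff_continuousAt.2 fun η => (hasDerivAt_reMode ℓ c k η).continuousAt

theorem abs_reMode_le (ℓ : ℝ) (c : ℂ) (k : ℤ) (η : ℝ) : |reMode ℓ c k η| ≤ ‖c‖ := by
  refine (Complex.abs_re_le_norm _).trans ?_
  rw [norm_mul, norm_fexp, mul_one]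

theorem reMode_ends {ℓ : ℝ} (hℓ : 0 < ℓ) (c : ℂ) (k : ℤ) :
    reMode ℓ c k (-(ℓ / 2)) = reMode ℓ c k (ℓ / 2) := by rw [reMode, fexp_ends hℓ, reMode]

theorem periodicUpTo_sum {ℓ : ℝ} (hℓ : 0 < ℓ) (F : Finset ℤ) (c : ℤ → ℂ) (y : ℤ → ℝ) :
    PeriodicUpTo ℓ 1 (fun η => ∑ k ∈ F, reMode ℓ (c k) k η * y k) := by
  intro j hj
  interval_cases j
  · simp only [dEta_zero, reMode_ends hℓ]
  · have hd : ∀ η, HasDerivAt (fun η => ∑ k ∈ F, reMode ℓ (c k) k η * y k)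
        (∑ k ∈ F, reMode ℓ (I * freq ℓ k * c k) k η * y k) η := fun η =>
      HasDerivAt.fun_sum fun k _ => (hasDerivAt_reMode ℓ (c k) k η).mul_const _
    rw [dEta, iteratedDerivWithin_one_eq (uniqueDiffOn_cell hℓ) hd (left_mem_cell hℓ),
      iteratedDerivWithin_one_eq (uniqueDiffOn_cell hℓ) hd (right_mem_cell hℓ)]
    simp only [reMode_ends hℓ]

section Modes

variable {ℓ ε : ℝ} {C D : ℤ → ℝ} {c : ℤ → ℂ} {H V V₁ V₂ : ℤ → GenFun1}

/-- A partial sum `∑ Re(c_k e_k(η)) v_k(x)`. -/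
def modeSum (ℓ : ℝ) (c : ℤ → ℂ) (V : ℤ → GenFun1) (F : Finset ℤ) : GenFun :=
  (fun x η => ∑ k ∈ F, reMode ℓ (c k) k η * (V k).1 x,
    fun x η => ∑ k ∈ F, reMode ℓ (c k) k η * (V k).2 x)

theorem ModeSol.continuous_fst {μ M : ℝ} {h v v₁ v₂ : GenFun1} (hv : ModeSol μ M h v v₁ v₂) :
    Continuous v.1 := continuous_iff_continuousAt.2 fun x => (hv.deriv_fst x).continuousAt

theorem ModeSol.continuous_snd {μ M : ℝ} {h v v₁ v₂ : GenFun1} (hv : ModeSol μ M h v v₁ v₂) :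
    Continuous v.2 := continuous_iff_continuousAt.2 fun x => (hv.deriv_snd x).continuousAt

theorem ModeSol.continuous_fst' {μ M : ℝ} {h v v₁ v₂ : GenFun1} (hv : ModeSol μ M h v v₁ v₂) :
    Continuous v₁.1 := continuous_iff_continuousAt.2 fun x => (hv.deriv_fst' x).continuousAt

theorem ModeSol.continuous_snd' {μ M : ℝ} {h v v₁ v₂ : GenFun1} (hv : ModeSol μ M h v v₁ v₂) :
    Continuous v₁.2 := continuous_iff_continuousAt.2 fun x => (hv.deriv_snd' x).continuousAt

theorem dX_modeSum (hV : ∀ k, ModeSol (ε * lam ℓ k) (C k) (H k) (V k) (V₁ k) (V₂ k)) (F : Finset ℤ) :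
    (∀ x ≤ 0, ∀ η, (dX 1 (modeSum ℓ c V F)).1 x η = (modeSum ℓ c V₁ F).1 x η ∧
      (dX 2 (modeSum ℓ c V F)).1 x η = (modeSum ℓ c V₂ F).1 x η) ∧
    (∀ x ≥ 0, ∀ η, (dX 1 (modeSum ℓ c V F)).2 x η = (modeSum ℓ c V₁ F).2 x η ∧
      (dX 2 (modeSum ℓ c V F)).2 x η = (modeSum ℓ c V₂ F).2 x η) := by
  constructor
  · intro x hx η
    have d1 : ∀ x, HasDerivAt (fun x => (modeSum ℓ c V F).1 x η) ((modeSum ℓ c V₁ F).1 x η) x :=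
      fun x => HasDerivAt.fun_sum fun k _ => ((hV k).deriv_fst x).const_mul _
    have d2 : ∀ x, HasDerivAt (fun x => (modeSum ℓ c V₁ F).1 x η) ((modeSum ℓ c V₂ F).1 x η) x :=
      fun x => HasDerivAt.fun_sum fun k _ => ((hV k).deriv_fst' x).const_mul _
    exact ⟨iteratedDerivWithin_one_eq (uniqueDiffOn_Iic 0) d1 hx,
      iteratedDerivWithin_two_eq (uniqueDiffOn_Iic 0) d1 d2 hx⟩
  · intro x hx η
    have d1 : ∀ x, HasDerivAt (fun x => (modeSum ℓ c V F).2 x η) ((modeSum ℓ c V₁ F).2 x η) x :=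
      fun x => HasDerivAt.fun_sum fun k _ => ((hV k).deriv_snd x).const_mul _
    have d2 : ∀ x, HasDerivAt (fun x => (modeSum ℓ c V₁ F).2 x η) ((modeSum ℓ c V₂ F).2 x η) x :=
      fun x => HasDerivAt.fun_sum fun k _ => ((hV k).deriv_snd' x).const_mul _
    exact ⟨iteratedDerivWithin_one_eq (uniqueDiffOn_Ici 0) d1 hx,
      iteratedDerivWithin_two_eq (uniqueDiffOn_Ici 0) d1 d2 hx⟩

theorem dEta_two_sum (hℓ : 0 < ℓ) (F : Finset ℤ) (y : ℤ → ℝ) {η : ℝ} (hη : η ∈ cell ℓ) :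
    dEta ℓ 2 (fun η => ∑ k ∈ F, reMode ℓ (c k) k η * y k) η =
      ∑ k ∈ F, (-lam ℓ k * reMode ℓ (c k) k η) * y k :=
  iteratedDerivWithin_two_eq (uniqueDiffOn_cell hℓ)
    (f₁ := fun η => ∑ k ∈ F, reMode ℓ (I * freq ℓ k * c k) k η * y k)
    (f₂ := fun η => ∑ k ∈ F, (-lam ℓ k * reMode ℓ (c k) k η) * y k)
    (fun η => HasDerivAt.fun_sum fun k _ => (hasDerivAt_reMode ℓ (c k) k η).mul_const _)
    (fun η => HasDerivAt.fun_sum fun k _ => (hasDerivAt_reMode' ℓ (c k) k η).mul_const _) hη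

theorem opLA_modeSum (hℓ : 0 < ℓ)
    (hV : ∀ k, ModeSol (ε * lam ℓ k) (C k) (H k) (V k) (V₁ k) (V₂ k)) (F : Finset ℤ) :
    (∀ x ≤ 0, ∀ η ∈ cell ℓ, (opLA ℓ ε (modeSum ℓ c V F)).1 x η = -(modeSum ℓ c H F).1 x η) ∧
    ∀ x ≥ 0, ∀ η ∈ cell ℓ, (opLA ℓ ε (modeSum ℓ c V F)).2 x η = -(modeSum ℓ c H F).2 x η := by
  constructor
  · intro x hx η hη
    have e1 : (dEtaGen ℓ 2 (modeSum ℓ c V F)).1 x η = _ :=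
      dEta_two_sum hℓ F (fun k => (V k).1 x) hη
    simp only [opLA, opL, Prod.fst_add, Pi.add_apply, Prod.smul_fst, Pi.smul_apply, smul_eq_mul]
    rw [((dX_modeSum hV F).1 x hx η).1, ((dX_modeSum hV F).1 x hx η).2, e1]
    simp only [modeSum]
    rw [Finset.mul_sum, Finset.mul_sum, ← Finset.sum_sub_distrib, ← Finset.sum_add_distrib,
      ← Finset.sum_add_distrib, ← Finset.sum_neg_distrib]
    refine Finset.sum_congr rfl fun k _ => ?_
    linear_combination reMode ℓ (c k) k η * (hV k).eq_fst x
  · intro x hx η hη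
    have e1 : (dEtaGen ℓ 2 (modeSum ℓ c V F)).2 x η = _ :=
      dEta_two_sum hℓ F (fun k => (V k).2 x) hη
    simp only [opLA, opL, Prod.snd_add, Pi.add_apply, Prod.smul_snd, Pi.smul_apply, smul_eq_mul]
    rw [((dX_modeSum hV F).2 x hx η).1, ((dX_modeSum hV F).2 x hx η).2, e1]
    simp only [modeSum]
    rw [Finset.mul_sum, ← Finset.sum_sub_distrib, ← Finset.sum_add_distrib,
      ← Finset.sum_neg_distrib]
    refine Finset.sum_congr rfl fun k _ => ?_
    linear_combination reMode ℓ (c k) k η * (hV k).eq_snd x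

theorem continuous_modeSum_fst {Y : ℤ → GenFun1} (hY : ∀ k, Continuous (Y k).1) (F : Finset ℤ) :
    Continuous fun p : ℝ × ℝ => (modeSum ℓ c Y F).1 p.1 p.2 :=
  continuous_finsetSum _ fun k _ =>
    ((continuous_reMode ℓ (c k) k).comp continuous_snd).mul ((hY k).comp continuous_fst)

theorem continuous_modeSum_snd {Y : ℤ → GenFun1} (hY : ∀ k, Continuous (Y k).2) (F : Finset ℤ) :
    Continuous fun p : ℝ × ℝ => (modeSum ℓ c Y F).2 p.1 p.2 :=
  continuous_finsetSum _ fun k _ =>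
    ((continuous_reMode ℓ (c k) k).comp continuous_snd).mul ((hY k).comp continuous_fst)

/-- Finite partial sums lie in the domain of `L + εA` itself; passing to the closure is needed only
for the limit in `F`. -/
theorem memDomLA_modeSum (hℓ : 0 < ℓ)
    (hV : ∀ k, ModeSol (ε * lam ℓ k) (C k) (H k) (V k) (V₁ k) (V₂ k))
    (hH₁ : ∀ k, Continuous (H k).1) (hH₂ : ∀ k, Continuous (H k).2)
    (hHD₁ : ∀ k, ∀ x ≤ 0, |(H k).1 x| ≤ D k * Real.exp (x / 2))
    (hHD₂ : ∀ k, ∀ x ≥ 0, |(H k).2 x| ≤ D k * Real.exp (x / 2)) (F : Finset ℤ) :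
    MemDomLA ℓ (modeSum ℓ c V F) := by
  have hmem : MemX ℓ (modeSum ℓ c V F) :=
    memX_sum F (fun k => continuous_reMode ℓ (c k) k) (fun k => (hV k).continuous_fst)
      (fun k => (hV k).continuous_snd) (fun k η => abs_reMode_le ℓ (c k) k η)
      (fun k => (hV k).bound_fst) (fun k => (hV k).bound_snd)
  have hmemH : MemX ℓ (modeSum ℓ c H F) :=
    memX_sum F (fun k => continuous_reMode ℓ (c k) k) hH₁ hH₂
      (fun k η => abs_reMode_le ℓ (c k) k η) hHD₁ hHD₂
  have hmemη : MemX ℓ (dEtaGen ℓ 2 (modeSum ℓ c V F)) := by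
    refine (memX_sum F (g := fun k η => -lam ℓ k * reMode ℓ (c k) k η) (y := V)
      (fun k => (continuous_reMode ℓ (c k) k).const_mul _) (fun k => (hV k).continuous_fst)
      (fun k => (hV k).continuous_snd) (G := fun k => lam ℓ k * ‖c k‖) (fun k η => ?_)
      (fun k => (hV k).bound_fst) (fun k => (hV k).bound_snd)).congr
      (fun x hx η hη => dEta_two_sum hℓ F _ hη) (fun x hx η hη => dEta_two_sum hℓ F _ hη)
    rw [abs_mul, abs_neg, abs_of_nonneg (lam_nonneg _ _)]
    exact mul_le_mul_of_nonneg_left (abs_reMode_le ℓ (c k) k η) (lam_nonneg _ _)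
  refine ⟨?_, ?_, ?_, ?_, hmem, hmemη, ?_, ?_, ?_, ?_⟩
  · exact memC_two_zero (uniqueDiffOn_Iic 0) (f₁ := (modeSum ℓ c V₁ F).1)
      (f₂ := (modeSum ℓ c V₂ F).1)
      (fun z s => HasDerivAt.fun_sum fun k _ => ((hV k).deriv_fst s).const_mul _)
      (fun z s => HasDerivAt.fun_sum fun k _ => ((hV k).deriv_fst' s).const_mul _)
      (continuous_modeSum_fst (fun k => (hV k).continuous_fst) F)
      (continuous_modeSum_fst (fun k => (hV k).continuous_fst') F)
      (continuous_modeSum_fst (fun k => (hV k).cont_fst) F)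
  · exact memC_zero_two (uniqueDiffOn_cell hℓ)
      (f₁ := (modeSum ℓ (fun k => I * freq ℓ k * c k) V F).1)
      (f₂ := fun x η => ∑ k ∈ F, (-lam ℓ k * reMode ℓ (c k) k η) * (V k).1 x)
      (fun s z => HasDerivAt.fun_sum fun k _ => (hasDerivAt_reMode ℓ (c k) k z).mul_const _)
      (fun s z => HasDerivAt.fun_sum fun k _ => (hasDerivAt_reMode' ℓ (c k) k z).mul_const _)
      (continuous_modeSum_fst (fun k => (hV k).continuous_fst) F)
      (continuous_modeSum_fst (fun k => (hV k).continuous_fst) F)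
      (continuous_finsetSum _ fun k _ => (((continuous_reMode ℓ (c k) k).comp
        continuous_snd).const_mul _).mul ((hV k).continuous_fst.comp continuous_fst))
  · exact memC_two_zero (uniqueDiffOn_Ici 0) (f₁ := (modeSum ℓ c V₁ F).2)
      (f₂ := (modeSum ℓ c V₂ F).2)
      (fun z s => HasDerivAt.fun_sum fun k _ => ((hV k).deriv_snd s).const_mul _)
      (fun z s => HasDerivAt.fun_sum fun k _ => ((hV k).deriv_snd' s).const_mul _)
      (continuous_modeSum_snd (fun k => (hV k).continuous_snd) F)
      (continuous_modeSum_snd (fun k => (hV k).continuous_snd') F)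
      (continuous_modeSum_snd (fun k => (hV k).cont_snd) F)
  · exact memC_zero_two (uniqueDiffOn_cell hℓ)
      (f₁ := (modeSum ℓ (fun k => I * freq ℓ k * c k) V F).2)
      (f₂ := fun x η => ∑ k ∈ F, (-lam ℓ k * reMode ℓ (c k) k η) * (V k).2 x)
      (fun s z => HasDerivAt.fun_sum fun k _ => (hasDerivAt_reMode ℓ (c k) k z).mul_const _)
      (fun s z => HasDerivAt.fun_sum fun k _ => (hasDerivAt_reMode' ℓ (c k) k z).mul_const _)
      (continuous_modeSum_snd (fun k => (hV k).continuous_snd) F)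
      (continuous_modeSum_snd (fun k => (hV k).continuous_snd) F)
      (continuous_finsetSum _ fun k _ => (((continuous_reMode ℓ (c k) k).comp
        continuous_snd).const_mul _).mul ((hV k).continuous_snd.comp continuous_fst))
  · have hL := opLA_modeSum (c := c) hℓ hV F
    -- Membership of `ℒw` follows by difference from the equation, so no growth bound on the
    -- `x`-derivatives of the modes is required.
    refine (hmemH.neg.sub (hmemη.smul ε)).congr (fun x hx η hη => ?_) (fun x hx η hη => ?_)
    · have := hL.1 x hx η hη
      simp only [opLA, Prod.fst_add, Pi.add_apply] at this
      simp only [Prod.fst_sub, Prod.fst_neg, Pi.sub_apply, Pi.neg_apply]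
      linarith
    · have := hL.2 x hx η hη
      simp only [opLA, Prod.snd_add, Pi.add_apply] at this
      simp only [Prod.snd_sub, Prod.snd_neg, Pi.sub_apply, Pi.neg_apply]
      linarith
  · intro j hj η hη
    interval_cases j
    · simp only [dX, iteratedDerivWithin_zero, modeSum]
      exact Finset.sum_congr rfl fun k _ => by rw [(hV k).match_zero]
    · rw [((dX_modeSum hV F).1 0 le_rfl η).1, ((dX_modeSum hV F).2 0 le_rfl η).1]
      exact Finset.sum_congr rfl fun k _ => by rw [(hV k).match_one]
  · exact fun x _ => periodicUpTo_sum hℓ F c fun k => (V k).1 x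
  · exact fun x _ => periodicUpTo_sum hℓ F c fun k => (V k).2 x

end Modes

section Modes

variable {ℓ ε : ℝ} {C D : ℤ → ℝ} {c : ℤ → ℂ} {H V V₁ V₂ : ℤ → GenFun1}

/-- The tail of the coefficient series controls the error uniformly in `η`; with `m = e^{x/2}` this
is an error in `𝒳`. The choice `F = ∅` bounds the whole series. -/
theorem abs_sum_sub_tsum_le {y Y : ℤ → ℝ} {m : ℝ} (hy : ∀ k, |y k| ≤ Y k * m)
    (hs : Summable fun k => ‖c k‖ * Y k) (η : ℝ) (F : Finset ℤ) :
    |(∑ k ∈ F, reMode ℓ (c k) k η * y k) - ∑' k, reMode ℓ (c k) k η * y k| ≤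
      (∑' k : {k // k ∉ F}, ‖c k‖ * Y k) * m := by
  have hb : ∀ k, ‖reMode ℓ (c k) k η * y k‖ ≤ ‖c k‖ * Y k * m := fun k => by
    rw [norm_mul, Real.norm_eq_abs, Real.norm_eq_abs, mul_assoc]
    exact mul_le_mul (abs_reMode_le ℓ _ k η) (hy k) (abs_nonneg _) (norm_nonneg _)
  have hsum : Summable fun k => reMode ℓ (c k) k η * y k :=
    Summable.of_norm_bounded (hs.mul_right m) hb
  rw [← hsum.sum_add_tsum_subtype_compl F, sub_add_cancel_left, abs_neg, ← tsum_mul_right]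
  have hs' : Summable fun k : {k // k ∉ F} => ‖c k‖ * Y k * m :=
    (hs.mul_right m).comp_injective Subtype.val_injective
  exact tsum_of_norm_bounded hs'.hasSum fun k => hb k

theorem modeSol_bound_nonneg {μ M : ℝ} {h v v₁ v₂ : GenFun1} (hv : ModeSol μ M h v v₁ v₂) :
    0 ≤ M := by
  have := (abs_nonneg _).trans (hv.bound_fst 0 le_rfl)
  simpa using this

/-- The majorants `C k e^{x/2}` may be unbounded on `S`. Dividing out the weight makes them
constants, and then the Weierstrass test applies. -/
theorem continuousOn_tsum_weight {S : Set ℝ} {Y : ℤ → ℝ → ℝ} (hY : ∀ k, Continuous (Y k))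
    (hb : ∀ k, ∀ x ∈ S, |Y k x| ≤ C k * Real.exp (x / 2))
    (hs : Summable fun k => ‖c k‖ * C k) (K : Set ℝ) :
    ContinuousOn (fun p : ℝ × ℝ => ∑' k, reMode ℓ (c k) k p.2 * Y k p.1) (S ×ˢ K) := by
  have h1 : ContinuousOn (fun p : ℝ × ℝ =>
      ∑' k, reMode ℓ (c k) k p.2 * (Real.exp (-p.1 / 2) * Y k p.1)) (S ×ˢ K) := by
    refine continuousOn_tsum (fun k => Continuous.continuousOn ?_) hs fun k p hp => ?_
    · exact ((continuous_reMode ℓ (c k) k).comp continuous_snd).mul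
        ((by fun_prop : Continuous fun p : ℝ × ℝ => Real.exp (-p.1 / 2)).mul
          ((hY k).comp continuous_fst))
    · rw [norm_mul, Real.norm_eq_abs, Real.norm_eq_abs]
      exact mul_le_mul (abs_reMode_le ℓ _ k _)
        ((exp_neg_half_mul_abs_le_iff _ _ _).2 (hb k _ hp.1)) (abs_nonneg _) (norm_nonneg _)
  have h2 := (by fun_prop : Continuous fun p : ℝ × ℝ => Real.exp (p.1 / 2)).continuousOn.mul h1
  refine h2.congr fun p hp => ?_
  simp only [Pi.mul_apply, mul_left_comm _ (Real.exp (-p.1 / 2)), tsum_mul_left]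
  rw [← mul_assoc, ← Real.exp_add]
  simp [neg_div]

/-- Superpositions of mode solutions give values of the resolvent. -/
theorem exists_isResolventZero (hℓ : 0 < ℓ)
    (hV : ∀ k, ModeSol (ε * lam ℓ k) (C k) (H k) (V k) (V₁ k) (V₂ k))
    (hH₁ : ∀ k, Continuous (H k).1) (hH₂ : ∀ k, Continuous (H k).2)
    (hHD₁ : ∀ k, ∀ x ≤ 0, |(H k).1 x| ≤ D k * Real.exp (x / 2))
    (hHD₂ : ∀ k, ∀ x ≥ 0, |(H k).2 x| ≤ D k * Real.exp (x / 2))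
    (hC : Summable fun k => ‖c k‖ * C k) (hD : Summable fun k => ‖c k‖ * D k)
    {f : GenFun} (hf₁ : ∀ x ≤ 0, ∀ η ∈ cell ℓ, f.1 x η = ∑' k, reMode ℓ (c k) k η * (H k).1 x)
    (hf₂ : ∀ x ≥ 0, ∀ η ∈ cell ℓ, f.2 x η = ∑' k, reMode ℓ (c k) k η * (H k).2 x) :
    ∃ u, IsResolventZero ℓ ε f u := by
  have hC0 : ∀ k, 0 ≤ C k := fun k => modeSol_bound_nonneg (hV k)
  have hD0 : ∀ k, 0 ≤ D k := fun k => by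
    have := (abs_nonneg _).trans (hHD₁ k 0 le_rfl)
    simpa using this
  set u : GenFun := (fun x η => ∑' k, reMode ℓ (c k) k η * (V k).1 x,
    fun x η => ∑' k, reMode ℓ (c k) k η * (V k).2 x) with hu
  have memX_tsum : ∀ {g : GenFun} {Y : ℤ → GenFun1} {B : ℤ → ℝ}, (∀ k, Continuous (Y k).1) →
      (∀ k, Continuous (Y k).2) → (∀ k, ∀ x ≤ 0, |(Y k).1 x| ≤ B k * Real.exp (x / 2)) →
      (∀ k, ∀ x ≥ 0, |(Y k).2 x| ≤ B k * Real.exp (x / 2)) → (∀ k, 0 ≤ B k) →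
      (Summable fun k => ‖c k‖ * B k) →
      (∀ x ≤ 0, ∀ η ∈ cell ℓ, g.1 x η = ∑' k, reMode ℓ (c k) k η * (Y k).1 x) →
      (∀ x ≥ 0, ∀ η ∈ cell ℓ, g.2 x η = ∑' k, reMode ℓ (c k) k η * (Y k).2 x) → MemX ℓ g := by
    intro g Y B c1 c2 b1 b2 B0 hB g1 g2
    refine .of_bound (C := ∑' k, ‖c k‖ * B k)
      ((continuousOn_tsum_weight c1 (S := Iic 0) (fun k x hx => b1 k x hx) hB (cell ℓ)).congr
        fun p hp => g1 p.1 hp.1 p.2 hp.2)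
      ((continuousOn_tsum_weight c2 (S := Ici 0) (fun k x hx => b2 k x hx) hB (cell ℓ)).congr
        fun p hp => g2 p.1 hp.1 p.2 hp.2)
      (tsum_nonneg fun k => mul_nonneg (norm_nonneg _) (B0 k))
      ⟨fun x hx η hη => ?_, fun x hx η hη => ?_⟩
    · rw [g1 x hx η hη]
      have := abs_sum_sub_tsum_le (ℓ := ℓ)
        (fun k => b1 k x hx) hB η ∅
      simp only [Finset.sum_empty, zero_sub, abs_neg] at this
      refine this.trans_eq ?_
      congr 1
      exact (Equiv.subtypeUnivEquiv (by simp)).tsum_eq (fun k => ‖c k‖ * B k)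
    · rw [g2 x hx η hη]
      have := abs_sum_sub_tsum_le (ℓ := ℓ)
        (fun k => b2 k x hx) hB η ∅
      simp only [Finset.sum_empty, zero_sub, abs_neg] at this
      refine this.trans_eq ?_
      congr 1
      exact (Equiv.subtypeUnivEquiv (by simp)).tsum_eq (fun k => ‖c k‖ * B k)
  have hmemu : MemX ℓ u := memX_tsum (fun k => (hV k).continuous_fst)
    (fun k => (hV k).continuous_snd) (fun k => (hV k).bound_fst) (fun k => (hV k).bound_snd)
    hC0 hC (fun _ _ _ _ => rfl) (fun _ _ _ _ => rfl)
  have hmemf : MemX ℓ f := memX_tsum hH₁ hH₂ hHD₁ hHD₂ hD0 hD hf₁ hf₂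
  have hw : ∀ F : Finset ℤ, XBound ℓ (∑' k : {k // k ∉ F}, ‖c k‖ * C k) (modeSum ℓ c V F - u) :=
    fun F => ⟨fun x hx η _ => abs_sum_sub_tsum_le
        (fun k => (hV k).bound_fst x hx) hC η F,
      fun x hx η _ => abs_sum_sub_tsum_le
        (fun k => (hV k).bound_snd x hx) hC η F⟩
  have hLw : ∀ F : Finset ℤ, XBound ℓ (∑' k : {k // k ∉ F}, ‖c k‖ * D k)
      (opLA ℓ ε (modeSum ℓ c V F) - -f) := by
    intro F
    have hL := opLA_modeSum (c := c) hℓ hV F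
    constructor
    · intro x hx η hη
      have e : (opLA ℓ ε (modeSum ℓ c V F) - -f).1 x η =
          -((modeSum ℓ c H F).1 x η - ∑' k, reMode ℓ (c k) k η * (H k).1 x) := by
        rw [← hf₁ x hx η hη, neg_sub', ← hL.1 x hx η hη]; rfl
      rw [e, abs_neg]
      exact abs_sum_sub_tsum_le (fun k => hHD₁ k x hx) hD η F
    · intro x hx η hη
      have e : (opLA ℓ ε (modeSum ℓ c V F) - -f).2 x η =
          -((modeSum ℓ c H F).2 x η - ∑' k, reMode ℓ (c k) k η * (H k).2 x) := by
        rw [← hf₂ x hx η hη, neg_sub', ← hL.2 x hx η hη]; rfl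
      rw [e, abs_neg]
      exact abs_sum_sub_tsum_le (fun k => hHD₂ k x hx) hD η F
  have tailC := tendsto_tsum_compl_atTop_zero fun k => ‖c k‖ * C k
  have tailD := tendsto_tsum_compl_atTop_zero fun k => ‖c k‖ * D k
  have tC0 : ∀ F : Finset ℤ, 0 ≤ ∑' k : {k // k ∉ F}, ‖c k‖ * C k := fun F =>
    tsum_nonneg fun k => mul_nonneg (norm_nonneg _) (hC0 k)
  have tD0 : ∀ F : Finset ℤ, 0 ≤ ∑' k : {k // k ∉ F}, ‖c k‖ * D k := fun F =>
    tsum_nonneg fun k => mul_nonneg (norm_nonneg _) (hD0 k)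
  have hdom := fun F => memDomLA_modeSum (c := c) hℓ hV hH₁ hH₂ hHD₁ hHD₂ F
  refine ⟨u, ⟨hmemu, hmemf.neg, fun δ hδ => ?_⟩, fun η hη => ?_⟩
  · obtain ⟨r, hr0, hrδ⟩ : ∃ r : ℝ, 0 < r ∧ ENNReal.ofReal r < δ := by
      obtain ⟨r, hr0, hr⟩ := ENNReal.lt_iff_exists_real_btwn.1 hδ
      refine ⟨r, ?_, hr.2⟩
      simpa using hr.1
    have evC := (tailC.eventually (gt_mem_nhds (show 0 < r / 2 by positivity)))
    have evD := (tailD.eventually (gt_mem_nhds (show 0 < r / 2 by positivity)))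
    obtain ⟨F, hFC, hFD⟩ := (evC.and evD).exists
    refine ⟨modeSum ℓ c V F, hdom F, ?_, ?_⟩
    · refine ((hw F).normX_le (tC0 F)).trans_lt (lt_of_le_of_lt ?_ hrδ)
      exact ENNReal.ofReal_le_ofReal (by linarith)
    · refine ((hLw F).normX_le (tD0 F)).trans_lt (lt_of_le_of_lt ?_ hrδ)
      exact ENNReal.ofReal_le_ofReal (by linarith)
  · rw [opQ_eq_pair]
    -- `Q` vanishes on every mode and is continuous for the norm of `𝒳`, hence vanishes on the
    -- limit.
    have hz : ∀ F : Finset ℤ, pair 1 (modeSum ℓ c V F) η = 0 := by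
      intro F
      rw [← opQ_eq_pair]
      simp only [opQ, modeSum, Finset.mul_sum]
      rw [integral_finsetSum _ fun k _ => ((hV k).int_fst.const_mul _),
        integral_finsetSum _ fun k _ => ?_, ← Finset.sum_add_distrib]
      · refine Finset.sum_eq_zero fun k _ => ?_
        simp only [mul_left_comm (Real.exp _)]
        rw [integral_const_mul, integral_const_mul, ← mul_add, (hV k).proj, mul_zero]
      · simp only [mul_left_comm (Real.exp _)]
        exact (hV k).int_snd.const_mul _
    have hle : ∀ F : Finset ℤ, |pair 1 u η| ≤ 4 * ∑' k : {k // k ∉ F}, ‖c k‖ * C k := by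
      intro F
      have h1 := (hw F).abs_pair_le le_rfl (tC0 F) hη
      rwa [pair_sub le_rfl (hdom F).memX hmemu hη, hz, zero_sub, abs_neg] at h1
    have h0 : |pair 1 u η| ≤ 4 * 0 :=
      ge_of_tendsto' (tailC.const_mul 4) hle
    exact abs_eq_zero.1 (le_antisymm (by linarith) (abs_nonneg _))

end Modes

/-! ### The multipliers -/

/-- The larger root of `a² - a = μ`. -/
def root (μ : ℝ) : ℝ := (1 + √(1 + 4 * μ)) / 2

theorem root_sq_sub {μ : ℝ} (hμ : 0 ≤ μ) : root μ ^ 2 - root μ = μ := by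
  have := Real.sq_sqrt (show 0 ≤ 1 + 4 * μ by linarith)
  unfold root; nlinarith

theorem one_le_root {μ : ℝ} (hμ : 0 ≤ μ) : 1 ≤ root μ := by
  have : 1 ≤ √(1 + 4 * μ) := Real.one_le_sqrt.2 (by linarith)
  unfold root; linarith

theorem one_lt_root {μ : ℝ} (hμ : 0 < μ) : 1 < root μ := by
  have h1 := one_le_root hμ.le
  have h2 := root_sq_sub hμ.le
  rcases h1.lt_or_eq with h | h
  · exact h
  · rw [← h] at h2; linarith

/-- The multiplier of the trace at `x = 0` of the resolvent applied to `𝐓' - 𝐔`. -/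
def mTU (a : ℝ) : ℝ := 1 / (3 * a * (2 * a + 1))

/-- The multiplier of the trace at `x = 0` of the resolvent applied to `𝐖`. -/
def mW (a : ℝ) : ℝ := -(8 * a + 3) / (9 * a ^ 2 * (2 * a + 1))

theorem bTU_fst (x : ℝ) : (bT' - bU).1 x = (2 / 3 + 1 / 3 * x + 0 * x ^ 2) * Real.exp x := by
  simp only [bT', bU, Prod.fst_sub, Pi.sub_apply]; ring

theorem bTU_snd (x : ℝ) : (bT' - bU).2 x = -1 / 3 + 0 * x := by
  simp only [bT', bU, Prod.snd_sub, Pi.sub_apply]; ring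

theorem bW_fst (x : ℝ) : bW.1 x = (-4 / 9 + -2 / 9 * x + 1 / 6 * x ^ 2) * Real.exp x := by
  simp only [bW, bV, bT, bU, Prod.fst_sub, Prod.smul_fst, Pi.sub_apply, Pi.smul_apply, smul_eq_mul]
  ring

theorem bW_snd (x : ℝ) : bW.2 x = -4 / 9 + 1 / 3 * x := by
  simp only [bW, bV, bT, bU, Prod.snd_sub, Prod.smul_snd, Pi.sub_apply, Pi.smul_apply, smul_eq_mul]
  ring

theorem ModeSol.add {μ M N : ℝ} {h g v v₁ v₂ w w₁ w₂ : GenFun1} (hv : ModeSol μ M h v v₁ v₂)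
    (hw : ModeSol μ N g w w₁ w₂) : ModeSol μ (M + N) (h + g) (v + w) (v₁ + w₁) (v₂ + w₂) where
  deriv_fst x := (hv.deriv_fst x).add (hw.deriv_fst x)
  deriv_fst' x := (hv.deriv_fst' x).add (hw.deriv_fst' x)
  cont_fst := hv.cont_fst.add hw.cont_fst
  deriv_snd x := (hv.deriv_snd x).add (hw.deriv_snd x)
  deriv_snd' x := (hv.deriv_snd' x).add (hw.deriv_snd' x)
  cont_snd := hv.cont_snd.add hw.cont_snd
  eq_fst x := by
    simp only [Prod.fst_add, Pi.add_apply]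
    linear_combination hv.eq_fst x + hw.eq_fst x
  eq_snd x := by
    simp only [Prod.snd_add, Pi.add_apply]
    linear_combination hv.eq_snd x + hw.eq_snd x
  match_zero := by
    simp only [Prod.fst_add, Prod.snd_add, Pi.add_apply, hv.match_zero, hw.match_zero]
  match_one := by
    simp only [Prod.fst_add, Prod.snd_add, Pi.add_apply, hv.match_one, hw.match_one]
  bound_fst x hx := (abs_add_le _ _).trans (by
    linarith [hv.bound_fst x hx, hw.bound_fst x hx])
  bound_snd x hx := (abs_add_le _ _).trans (by
    linarith [hv.bound_snd x hx, hw.bound_snd x hx])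
  int_fst := hv.int_fst.add hw.int_fst
  int_snd := (hv.int_snd.add hw.int_snd).congr (.of_forall fun x => by
    simp [mul_add])
  proj := by
    simp only [Prod.fst_add, Prod.snd_add, Pi.add_apply, mul_add]
    rw [integral_add hv.int_fst hw.int_fst, integral_add hv.int_snd hw.int_snd]
    linear_combination hv.proj + hw.proj

theorem ModeSol.smul {μ M : ℝ} {h v v₁ v₂ : GenFun1} (hv : ModeSol μ M h v v₁ v₂) (r : ℝ) :
    ModeSol μ (|r| * M) (r • h) (r • v) (r • v₁) (r • v₂) where
  deriv_fst x := (hv.deriv_fst x).const_mul r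
  deriv_fst' x := (hv.deriv_fst' x).const_mul r
  cont_fst := hv.cont_fst.const_smul r
  deriv_snd x := (hv.deriv_snd x).const_mul r
  deriv_snd' x := (hv.deriv_snd' x).const_mul r
  cont_snd := hv.cont_snd.const_smul r
  eq_fst x := by
    simp only [Prod.smul_fst, Pi.smul_apply, smul_eq_mul]
    linear_combination r * hv.eq_fst x
  eq_snd x := by
    simp only [Prod.smul_snd, Pi.smul_apply, smul_eq_mul]
    linear_combination r * hv.eq_snd x
  match_zero := by
    simp only [Prod.smul_fst, Prod.smul_snd, Pi.smul_apply, hv.match_zero]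
  match_one := by
    simp only [Prod.smul_fst, Prod.smul_snd, Pi.smul_apply, hv.match_one]
  bound_fst x hx := by
    simp only [Prod.smul_fst, Pi.smul_apply, smul_eq_mul, abs_mul, mul_assoc]
    exact mul_le_mul_of_nonneg_left (hv.bound_fst x hx) (abs_nonneg r)
  bound_snd x hx := by
    simp only [Prod.smul_snd, Pi.smul_apply, smul_eq_mul, abs_mul, mul_assoc]
    exact mul_le_mul_of_nonneg_left (hv.bound_snd x hx) (abs_nonneg r)
  int_fst := hv.int_fst.const_mul r
  int_snd := (hv.int_snd.const_mul r).congr (.of_forall fun x => by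
    simp [mul_left_comm])
  proj := by
    simp only [Prod.smul_fst, Prod.smul_snd, Pi.smul_apply, smul_eq_mul, mul_left_comm _ r,
      integral_const_mul]
    linear_combination r * hv.proj

theorem modeSol_zero (μ : ℝ) : ModeSol μ 0 0 0 0 0 where
  deriv_fst x := hasDerivAt_const x 0
  deriv_fst' x := hasDerivAt_const x 0
  cont_fst := continuous_const
  deriv_snd x := hasDerivAt_const x 0
  deriv_snd' x := hasDerivAt_const x 0
  cont_snd := continuous_const
  eq_fst x := by simp
  eq_snd x := by simp
  match_zero := rfl
  match_one := rfl
  bound_fst x hx := by simp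
  bound_snd x hx := by simp
  int_fst := (integrable_zero ℝ ℝ _)
  int_snd := by simp
  proj := by simp

theorem ModeSol.mono {μ M N : ℝ} {h v v₁ v₂ : GenFun1} (hv : ModeSol μ M h v v₁ v₂)
    (hMN : M ≤ N) : ModeSol μ N h v v₁ v₂ :=
  { hv with
    bound_fst := fun x hx => (hv.bound_fst x hx).trans (by gcongr)
    bound_snd := fun x hx => (hv.bound_snd x hx).trans (by gcongr) }

/-- The mode `k = 0` has `μ = 0` and is not covered by `exists_modeSol`; it gets an explicit
solution with `A = B = 0`. It is needed because `𝒢_ε` multiplies `𝐓' - 𝐔` by a square, which may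
have nonzero mean. -/
theorem exists_modeSol_TU {ℓ ε : ℝ} (hℓ : 0 < ℓ) (hε : 0 < ε) :
    ∃ C, ∀ k, ∃ v v₁ v₂, ModeSol (ε * lam ℓ k) C (bT' - bU) v v₁ v₂ := by
  have hμ₁ : 0 < ε * lam ℓ 1 := mul_pos hε (lam_pos hℓ one_ne_zero)
  obtain ⟨C, hC0, hC⟩ := exists_modeSol hμ₁ bTU_fst bTU_snd (by norm_num)
  obtain ⟨v, v₁, v₂, h0⟩ := modeSol_of_coeffs (a := 1) (A := 0) (B := 0) (p₀ := 1 / 9)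
    (p₁ := -4 / 9) (p₂ := -1 / 6) (q₀ := 1 / 9) (q₁ := -1 / 3) bTU_fst bTU_snd le_rfl
    (by norm_num) (by norm_num) (by norm_num) (by norm_num) (by norm_num) (by norm_num)
    (by norm_num) (by norm_num) (C := 10) (by norm_num [abs_div]) (by norm_num [abs_div])
  refine ⟨max C 10, fun k => ?_⟩
  by_cases hk : k = 0
  · refine ⟨v, v₁, v₂, ?_⟩
    rw [hk, lam_zero, mul_zero]
    have := h0.mono (le_max_right C _)
    rwa [show (1 : ℝ) ^ 2 - 1 = 0 by norm_num] at this
  · have hμ : 0 < ε * lam ℓ k := mul_pos hε (lam_pos hℓ hk)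
    obtain ⟨v, v₁, v₂, h1⟩ := hC (root (ε * lam ℓ k)) (one_lt_root hμ) (by
      rw [root_sq_sub hμ.le]
      exact mul_le_mul_of_nonneg_left (lam_one_le hk) hε.le)
    rw [root_sq_sub hμ.le] at h1
    exact ⟨v, v₁, v₂, h1.mono (le_max_left C _)⟩

/-- The mode `k = 0` is left out: with `a = 1` the condition `f₁` of `modeSol_of_coeffs` would read
`0 = 1/3`. It is never used, since `𝐖` is always multiplied by a second `η`-derivative, of zero
mean. -/
theorem exists_modeSol_W {ℓ ε : ℝ} (hℓ : 0 < ℓ) (hε : 0 < ε) :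
    ∃ C, ∀ k ≠ 0, ∃ v v₁ v₂, ModeSol (ε * lam ℓ k) C bW v v₁ v₂ := by
  have hμ₁ : 0 < ε * lam ℓ 1 := mul_pos hε (lam_pos hℓ one_ne_zero)
  obtain ⟨C, hC0, hC⟩ := exists_modeSol hμ₁ bW_fst bW_snd (by norm_num)
  refine ⟨C, fun k hk => ?_⟩
  have hμ : 0 < ε * lam ℓ k := mul_pos hε (lam_pos hℓ hk)
  obtain ⟨v, v₁, v₂, h1⟩ := hC (root (ε * lam ℓ k)) (one_lt_root hμ) (by
    rw [root_sq_sub hμ.le]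
    exact mul_le_mul_of_nonneg_left (lam_one_le hk) hε.le)
  rw [root_sq_sub hμ.le] at h1
  exact ⟨v, v₁, v₂, h1⟩

/-! ### Resolvents of products of a function of `η` and a profile in `x`. -/

theorem polyPair_bounds {α₀ α₁ α₂ β₀ β₁ : ℝ} {h : GenFun1}
    (hh₁ : ∀ x, h.1 x = (α₀ + α₁ * x + α₂ * x ^ 2) * Real.exp x) (hh₂ : ∀ x, h.2 x = β₀ + β₁ * x) :
    Continuous h.1 ∧ Continuous h.2 ∧ ∃ D, (∀ x ≤ 0, |h.1 x| ≤ D * Real.exp (x / 2)) ∧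
      ∀ x ≥ 0, |h.2 x| ≤ D * Real.exp (x / 2) := by
  refine ⟨?_, ?_, (|α₀| + 2 * |α₁| + 16 * |α₂|) + (|β₀| + 2 * |β₁|), fun x hx => ?_, fun x hx => ?_⟩
  · rw [funext hh₁]; fun_prop
  · rw [funext hh₂]; fun_prop
  · have h1 := abs_quadratic_mul_exp_le (a := 1) α₀ α₁ α₂ hx
    rw [one_mul, Real.norm_eq_abs, show (1 - 1 / 2) * x = x / 2 by ring, ← hh₁] at h1
    nlinarith [Real.exp_pos (x / 2), abs_nonneg β₀, abs_nonneg β₁]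
  · have h1 := abs_quadratic_le β₀ β₁ 0 x
    simp only [zero_mul, add_zero, abs_zero, mul_zero] at h1
    rw [abs_of_nonneg hx, ← hh₂] at h1
    nlinarith [Real.exp_pos (x / 2), abs_nonneg α₀, abs_nonneg α₁, abs_nonneg α₂]

theorem hasSum_reMode {ℓ : ℝ} (hℓ : 0 < ℓ) {f : ℝ → ℝ} (hf : ContinuousOn f (cell ℓ))
    (hs : Summable fun k => ‖fc ℓ f k‖) {η : ℝ} (hη : η ∈ cell ℓ) :
    HasSum (fun k => reMode ℓ (fc ℓ f k) k η) (f η) := by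
  have := Complex.reCLM.hasSum (hasSum_fc hℓ hf hs hη)
  simpa [reMode] using this

theorem reMode_real_mul (ℓ r : ℝ) (c : ℂ) (k : ℤ) (η : ℝ) :
    reMode ℓ (r * c) k η = r * reMode ℓ c k η := by
  rw [reMode, mul_assoc, re_ofReal_mul, reMode]

/-- Right-hand sides `ψ(𝐓' - 𝐔) + χ𝐖` whose coefficients have absolutely convergent Fourier
series have a resolvent. -/
theorem exists_isResolventZero_tensor {ℓ ε : ℝ} (hℓ : 0 < ℓ) (hε : 0 < ε) {ψ χ : ℝ → ℝ}
    (hψ : ContinuousOn ψ (cell ℓ)) (hχ : ContinuousOn χ (cell ℓ))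
    (sψ : Summable fun k => ‖fc ℓ ψ k‖) (sχ : Summable fun k => ‖fc ℓ χ k‖)
    {c : ℤ → ℂ} {r t : ℤ → ℝ} (cψ : ∀ k, fc ℓ ψ k = r k * c k) (cχ : ∀ k, fc ℓ χ k = t k * c k)
    (ht : t 0 = 0) :
    ∃ u, IsResolventZero ℓ ε (tensor ψ (bT' - bU) + tensor χ bW) u := by
  obtain ⟨C₁, hC₁⟩ := exists_modeSol_TU hℓ hε
  obtain ⟨C₂, hC₂⟩ := exists_modeSol_W hℓ hε
  choose v v₁ v₂ hv using hC₁
  have hC₂' : ∀ k, ∃ w w₁ w₂, ModeSol (ε * lam ℓ k) (|t k| * C₂) (t k • bW) w w₁ w₂ := by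
    intro k
    by_cases hk : k = 0
    · refine ⟨0, 0, 0, ?_⟩
      rw [hk, ht, abs_zero, zero_mul, zero_smul]
      exact modeSol_zero _
    · obtain ⟨w, w₁, w₂, hw⟩ := hC₂ k hk
      exact ⟨_, _, _, hw.smul (t k)⟩
  choose w w₁ w₂ hw using hC₂'
  obtain ⟨cTU1, cTU2, D₁, bTU1, bTU2⟩ := polyPair_bounds bTU_fst bTU_snd
  obtain ⟨cW1, cW2, D₂, bW1, bW2⟩ := polyPair_bounds bW_fst bW_snd
  -- The coefficients of `ψ` and `χ` are real multiples of one complex number `c k`, so a single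
  -- real mode `Re(c_k e_k)` carries the profile `r_k(𝐓' - 𝐔) + t_k𝐖`.
  have hV := fun k => ((hv k).smul (r k)).add (hw k)
  have nψ : ∀ k, ‖c k‖ * |r k| = ‖fc ℓ ψ k‖ := fun k => by
    rw [cψ, norm_mul, Complex.norm_real, Real.norm_eq_abs, mul_comm]
  have nχ : ∀ k, ‖c k‖ * |t k| = ‖fc ℓ χ k‖ := fun k => by
    rw [cχ, norm_mul, Complex.norm_real, Real.norm_eq_abs, mul_comm]
  have hsum : ∀ A B : ℝ, Summable fun k => ‖c k‖ * (|r k| * A + |t k| * B) := fun A B => by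
    refine ((sψ.mul_right A).add (sχ.mul_right B)).congr fun k => ?_
    rw [← nψ, ← nχ]; ring
  have key : ∀ {η : ℝ}, η ∈ cell ℓ → ∀ y z : ℝ,
      ψ η * y + χ η * z = ∑' k, reMode ℓ (c k) k η * (r k * y + t k * z) := by
    intro η hη y z
    have h1 := ((hasSum_reMode hℓ hψ sψ hη).mul_right y).add
      ((hasSum_reMode hℓ hχ sχ hη).mul_right z)
    rw [← h1.tsum_eq]
    refine tsum_congr fun k => ?_
    rw [cψ, cχ, reMode_real_mul, reMode_real_mul]; ring
  refine exists_isResolventZero (D := fun k => |r k| * D₁ + |t k| * D₂) (c := c) hℓ hV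
    (fun k => (cTU1.const_smul (r k)).add (cW1.const_smul (t k)))
    (fun k => (cTU2.const_smul (r k)).add (cW2.const_smul (t k)))
    (fun k x hx => ?_) (fun k x hx => ?_) (hsum C₁ C₂) (hsum D₁ D₂)
    (fun x hx η hη => key hη _ _) (fun x hx η hη => key hη _ _)
  · refine (abs_add_le _ _).trans ?_
    simp only [Prod.smul_fst, Pi.smul_apply, smul_eq_mul, abs_mul]
    nlinarith [mul_le_mul_of_nonneg_left (bTU1 x hx) (abs_nonneg (r k)),
      mul_le_mul_of_nonneg_left (bW1 x hx) (abs_nonneg (t k))]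
  · refine (abs_add_le _ _).trans ?_
    simp only [Prod.smul_snd, Pi.smul_apply, smul_eq_mul, abs_mul]
    nlinarith [mul_le_mul_of_nonneg_left (bTU2 x hx) (abs_nonneg (r k)),
      mul_le_mul_of_nonneg_left (bW2 x hx) (abs_nonneg (t k))]

theorem pair_tensor {a : ℝ} (ha : 1 ≤ a) {α₀ α₁ α₂ β₀ β₁ : ℝ} {h : GenFun1}
    (hh₁ : ∀ x, h.1 x = (α₀ + α₁ * x + α₂ * x ^ 2) * Real.exp x) (hh₂ : ∀ x, h.2 x = β₀ + β₁ * x)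
    (φ : ℝ → ℝ) (η : ℝ) :
    pair a (tensor φ h) η =
      (α₀ / a - α₁ / a ^ 2 + 2 * α₂ / a ^ 3 + (β₀ / a + β₁ / a ^ 2)) * φ η := by
  have e1 : ∀ x, Real.exp ((a - 1) * x) * (φ η * h.1 x) =
      φ η * ((α₀ + α₁ * x + α₂ * x ^ 2) * Real.exp (a * x)) := fun x => by
    rw [hh₁, show a * x = (a - 1) * x + x by ring, Real.exp_add]; ring
  have e2 : ∀ x, Real.exp (-a * x) * (φ η * h.2 x) =
      φ η * (Real.exp (-a * x) * (β₀ + β₁ * x)) := fun x => by rw [hh₂]; ring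
  simp only [pair, tensor, e1, e2, integral_const_mul]
  rw [integral_quadratic_mul_exp ha, integral_linear_mul_exp_neg ha]
  ring

theorem memX_tensor {ℓ : ℝ} {α₀ α₁ α₂ β₀ β₁ : ℝ} {h : GenFun1}
    (hh₁ : ∀ x, h.1 x = (α₀ + α₁ * x + α₂ * x ^ 2) * Real.exp x) (hh₂ : ∀ x, h.2 x = β₀ + β₁ * x)
    {φ : ℝ → ℝ} (hφ : ContinuousOn φ (cell ℓ)) : MemX ℓ (tensor φ h) := by
  obtain ⟨c1, c2, D, b1, b2⟩ := polyPair_bounds hh₁ hh₂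
  obtain ⟨M, hM⟩ := (isCompact_cell ℓ).exists_bound_of_continuousOn hφ
  have hD : 0 ≤ D := by
    have := (abs_nonneg _).trans (b1 0 le_rfl)
    simpa using this
  have hM' : ∀ η ∈ cell ℓ, |φ η| ≤ |M| := fun η hη => (hM η hη).trans (le_abs_self M)
  refine .of_bound (C := |M| * D) ?_ ?_ (by positivity) ⟨fun x hx η hη => ?_, fun x hx η hη => ?_⟩
  · exact (hφ.comp continuousOn_snd fun p hp => hp.2).mul (c1.comp continuous_fst).continuousOn
  · exact (hφ.comp continuousOn_snd fun p hp => hp.2).mul (c2.comp continuous_fst).continuousOn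
  · simp only [tensor, abs_mul, mul_assoc]
    exact mul_le_mul (hM' η hη) (b1 x hx) (abs_nonneg _) (abs_nonneg _)
  · simp only [tensor, abs_mul, mul_assoc]
    exact mul_le_mul (hM' η hη) (b2 x hx) (abs_nonneg _) (abs_nonneg _)

/-- The multiplier decays like `a⁻²` while `λ = (a² - a)/ε`. This non-uniform bound serves the
convergence of series at fixed `ε`; estimates uniform in `ε` come from the full symbols. -/
theorem lam_mul_mTU_le {ε lm a : ℝ} (hε : 0 < ε) (ha : 1 ≤ a) (hr : ε * lm = a ^ 2 - a) :
    lm * |mTU a| ≤ ε⁻¹ := by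
  have hl : lm = ε⁻¹ * (a ^ 2 - a) := by rw [← hr]; field_simp
  have h1 : (a ^ 2 - a) * |mTU a| ≤ 1 := by
    rw [mTU, abs_of_pos (by positivity), mul_one_div, div_le_one (by positivity)]
    nlinarith
  rw [hl, mul_assoc]
  exact mul_le_of_le_one_right (by positivity) h1

theorem lam_mul_mW_le {ε lm a : ℝ} (hε : 0 < ε) (ha : 1 ≤ a) (hr : ε * lm = a ^ 2 - a) :
    lm * |mW a| ≤ ε⁻¹ := by
  have hl : lm = ε⁻¹ * (a ^ 2 - a) := by rw [← hr]; field_simp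
  have h1 : (a ^ 2 - a) * |mW a| ≤ 1 := by
    rw [mW, abs_div, abs_neg, abs_of_pos (show 0 < 8 * a + 3 by linarith),
      abs_of_pos (show 0 < 9 * a ^ 2 * (2 * a + 1) by positivity), ← mul_div_assoc,
      div_le_one (by positivity)]
    nlinarith [mul_nonneg (by linarith : 0 ≤ a) (by linarith : 0 ≤ a - 1),
      mul_nonneg (mul_nonneg (by linarith : 0 ≤ a) (by linarith : 0 ≤ a)) (by linarith : 0 ≤ a - 1)]
  rw [hl, mul_assoc]
  exact mul_le_of_le_one_right (by positivity) h1

/-- The Fourier coefficients of `(D_ηη R(0,L_ε)[ψ(𝐓' - 𝐔) + χ𝐖])(0,·)`. -/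
def resCoef (ℓ ε : ℝ) (ψ χ : ℝ → ℝ) (k : ℤ) : ℂ :=
  -lam ℓ k * (mTU (root (ε * lam ℓ k)) * fc ℓ ψ k + mW (root (ε * lam ℓ k)) * fc ℓ χ k)

theorem norm_resCoef_le {ℓ ε : ℝ} (hε : 0 < ε) (ψ χ : ℝ → ℝ) (k : ℤ) :
    ‖resCoef ℓ ε ψ χ k‖ ≤ ε⁻¹ * (‖fc ℓ ψ k‖ + ‖fc ℓ χ k‖) := by
  have hμ : 0 ≤ ε * lam ℓ k := mul_nonneg hε.le (lam_nonneg _ _)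
  have h1 := lam_mul_mTU_le hε (one_le_root hμ) (root_sq_sub hμ).symm
  have h2 := lam_mul_mW_le hε (one_le_root hμ) (root_sq_sub hμ).symm
  rw [resCoef, norm_mul, norm_neg, Complex.norm_real, Real.norm_of_nonneg (lam_nonneg _ _)]
  calc _ ≤ lam ℓ k * (|mTU (root (ε * lam ℓ k))| * ‖fc ℓ ψ k‖
        + |mW (root (ε * lam ℓ k))| * ‖fc ℓ χ k‖) := by
        refine mul_le_mul_of_nonneg_left ((norm_add_le _ _).trans_eq ?_) (lam_nonneg _ _)
        simp only [norm_mul, Complex.norm_real, Real.norm_eq_abs]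
    _ ≤ _ := by
        nlinarith [mul_le_mul_of_nonneg_right h1 (norm_nonneg (fc ℓ ψ k)),
          mul_le_mul_of_nonneg_right h2 (norm_nonneg (fc ℓ χ k))]

/-- Whatever resolvent is chosen, the pairing identity fixes all coefficients of its trace with `k ≠
0`, and `D_ηη` annihilates the remaining one; uniqueness of the resolvent need not be established.
-/
theorem hasSum_dEtaEtaRes {ℓ ε : ℝ} (hℓ : 0 < ℓ) (hε : 0 < ε) {ψ χ : ℝ → ℝ}
    (hψ : ContinuousOn ψ (cell ℓ)) (hχ : ContinuousOn χ (cell ℓ))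
    (sψ : Summable fun k => ‖fc ℓ ψ k‖) (sχ : Summable fun k => ‖fc ℓ χ k‖)
    {c : ℤ → ℂ} {r t : ℤ → ℝ} (cψ : ∀ k, fc ℓ ψ k = r k * c k) (cχ : ∀ k, fc ℓ χ k = t k * c k)
    (ht : t 0 = 0) :
    ∀ η ∈ cell ℓ, HasSum (fun k => resCoef ℓ ε ψ χ k * fexp ℓ k η)
      (dEtaEtaRes ℓ ε (tensor ψ (bT' - bU) + tensor χ bW) η : ℂ) := by
  set f := tensor ψ (bT' - bU) + tensor χ bW with hf
  have hu : IsResolventZero ℓ ε f (resolventZero ℓ ε f) :=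
    Classical.epsilon_spec (exists_isResolventZero_tensor hℓ hε hψ hχ sψ sχ cψ cχ ht)
  set u := resolventZero ℓ ε f with hu'
  have mf : MemX ℓ f := (memX_tensor bTU_fst bTU_snd hψ).add (memX_tensor bW_fst bW_snd hχ)
  have cu : ContinuousOn (u.1 0) (cell ℓ) :=
    ContinuousOn.uncurry_left' hu.eqn.memX.cont_fst (mem_Iic.2 le_rfl)
  have coefs : ∀ k ≠ 0, fc ℓ (u.1 0) k =
      mTU (root (ε * lam ℓ k)) * fc ℓ ψ k + mW (root (ε * lam ℓ k)) * fc ℓ χ k := by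
    intro k hk
    have hμ : 0 < ε * lam ℓ k := mul_pos hε (lam_pos hℓ hk)
    have hr := (root_sq_sub hμ.le).symm
    have ha := one_lt_root hμ
    set a := root (ε * lam ℓ k) with haa
    have ha0 : (a : ℂ) ≠ 0 := by
      have : a ≠ 0 := by linarith
      exact_mod_cast this
    have ha1 : (a - 1 : ℂ) ≠ 0 := by
      have : a - 1 ≠ 0 := by linarith
      exact_mod_cast this
    have ha2 : (2 * a + 1 : ℂ) ≠ 0 := by
      have : 2 * a + 1 ≠ 0 := by linarith
      exact_mod_cast this
    have h1 := hu.eqn.fc_pair hℓ ha hr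
    have h2 : ∀ η ∈ cell ℓ, pair a (-f) η =
        (-((2 / 3) / a - (1 / 3) / a ^ 2 + 2 * 0 / a ^ 3 + ((-1 / 3) / a + 0 / a ^ 2))) * ψ η +
        (-((-4 / 9) / a - (-2 / 9) / a ^ 2 + 2 * (1 / 6) / a ^ 3 +
          ((-4 / 9) / a + (1 / 3) / a ^ 2))) * χ η := by
      intro η hη
      rw [← neg_one_smul ℝ f, pair_smul, hf, pair_add ha.le (memX_tensor bTU_fst bTU_snd hψ)
        (memX_tensor bW_fst bW_snd hχ) hη, pair_tensor ha.le bTU_fst bTU_snd,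
        pair_tensor ha.le bW_fst bW_snd]
      ring
    rw [fc_congr hℓ h2, fc_add hℓ (continuousOn_const_mul _ hψ) (continuousOn_const_mul _ hχ),
      fc_const_mul, fc_const_mul] at h1
    have hne : ((1 / a - (2 * a - 1) : ℝ) : ℂ) ≠ 0 := by
      have : 1 / a - (2 * a - 1) < 0 := by
        have : 1 / a < 1 := by rw [div_lt_one (by linarith)]; exact ha
        linarith
      exact_mod_cast this.ne
    -- Both sides contain the factor `a - 1`: on the left from `1/a - (2a-1)`, on the right because
    -- `Q` vanishes on both profiles. It cancels.
    refine mul_left_cancel₀ hne ?_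
    rw [← h1, mTU, mW]
    push_cast
    field_simp
    ring
  have e : ∀ k, -lam ℓ k * fc ℓ (u.1 0) k = resCoef ℓ ε ψ χ k := by
    intro k
    by_cases hk : k = 0
    · simp [resCoef, hk, lam_zero]
    · rw [coefs k hk, resCoef]
  have n : ∀ k, lam ℓ k * ‖fc ℓ (u.1 0) k‖ = ‖resCoef ℓ ε ψ χ k‖ := fun k => by
    rw [← e, norm_mul, norm_neg, Complex.norm_real, Real.norm_of_nonneg (lam_nonneg _ _)]
  have hs2 : Summable fun k => lam ℓ k * ‖fc ℓ (u.1 0) k‖ := by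
    refine Summable.of_nonneg_of_le (fun k => mul_nonneg (lam_nonneg _ _) (norm_nonneg _))
      (fun k => (n k).trans_le (norm_resCoef_le hε ψ χ k)) ((sψ.add sχ).mul_left _)
  have hs1 : Summable fun k => ‖fc ℓ (u.1 0) k‖ := by
    rw [← Finset.summable_compl_iff ({0} : Finset ℤ)]
    refine Summable.of_nonneg_of_le (fun _ => norm_nonneg _) (fun k => ?_)
      ((Finset.summable_compl_iff ({0} : Finset ℤ)).2 (hs2.mul_left (lam ℓ 1)⁻¹))
    have hk : (k : ℤ) ≠ 0 := by simpa using k.2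
    rw [← mul_assoc]
    refine le_mul_of_one_le_left (norm_nonneg _) ?_
    rw [inv_mul_eq_div, one_le_div (lam_pos hℓ one_ne_zero)]
    exact lam_one_le hk
  intro η hη
  have := hasSum_dEta_two hℓ hs1 hs2 (fun η hη => hasSum_fc hℓ cu hs1 hη) η hη
  simp only [e] at this
  exact this

/-! ### Periodic functions of class `C³` -/

/-- `v` is of class `C³` on the cell, with derivatives `v₁`, `v₂`, `v₃`, and `v`, `v₁`, `v₂` take
equal values at the end points. -/
structure C3Per (ℓ : ℝ) (v v₁ v₂ v₃ : ℝ → ℝ) : Prop where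
  deriv_zero : ∀ x ∈ cell ℓ, HasDerivWithinAt v (v₁ x) (cell ℓ) x
  deriv_one : ∀ x ∈ cell ℓ, HasDerivWithinAt v₁ (v₂ x) (cell ℓ) x
  deriv_two : ∀ x ∈ cell ℓ, HasDerivWithinAt v₂ (v₃ x) (cell ℓ) x
  cont_three : ContinuousOn v₃ (cell ℓ)
  end_zero : v (-(ℓ / 2)) = v (ℓ / 2)
  end_one : v₁ (-(ℓ / 2)) = v₁ (ℓ / 2)
  end_two : v₂ (-(ℓ / 2)) = v₂ (ℓ / 2)

section C3Per

variable {ℓ : ℝ} {v v₁ v₂ v₃ w w₁ w₂ w₃ : ℝ → ℝ}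

theorem C3Per.cont_zero (h : C3Per ℓ v v₁ v₂ v₃) : ContinuousOn v (cell ℓ) :=
  fun x hx => (h.deriv_zero x hx).continuousWithinAt

theorem C3Per.cont_one (h : C3Per ℓ v v₁ v₂ v₃) : ContinuousOn v₁ (cell ℓ) :=
  fun x hx => (h.deriv_one x hx).continuousWithinAt

theorem C3Per.cont_two (h : C3Per ℓ v v₁ v₂ v₃) : ContinuousOn v₂ (cell ℓ) :=
  fun x hx => (h.deriv_two x hx).continuousWithinAt

theorem C3Per.add_const_mul (h : C3Per ℓ v v₁ v₂ v₃) (g : C3Per ℓ w w₁ w₂ w₃) (c : ℝ) :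
    C3Per ℓ (fun x => v x + c * w x) (fun x => v₁ x + c * w₁ x) (fun x => v₂ x + c * w₂ x)
      (fun x => v₃ x + c * w₃ x) where
  deriv_zero x hx := (h.deriv_zero x hx).add ((g.deriv_zero x hx).const_mul c)
  deriv_one x hx := (h.deriv_one x hx).add ((g.deriv_one x hx).const_mul c)
  deriv_two x hx := (h.deriv_two x hx).add ((g.deriv_two x hx).const_mul c)
  cont_three := h.cont_three.add (continuousOn_const_mul c g.cont_three)
  end_zero := by simp only [h.end_zero, g.end_zero]
  end_one := by simp only [h.end_one, g.end_one]
  end_two := by simp only [h.end_two, g.end_two]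

/-- Leibniz' rule up to order three, for products of first derivatives of functions of class `C⁴`.
-/
theorem C3Per.mul (h : C3Per ℓ v v₁ v₂ v₃) (g : C3Per ℓ w w₁ w₂ w₃) :
    C3Per ℓ (fun x => v x * w x) (fun x => v₁ x * w x + v x * w₁ x)
      (fun x => v₂ x * w x + 2 * (v₁ x * w₁ x) + v x * w₂ x)
      (fun x => v₃ x * w x + 3 * (v₂ x * w₁ x) + 3 * (v₁ x * w₂ x) + v x * w₃ x) where
  deriv_zero x hx := (h.deriv_zero x hx).mul (g.deriv_zero x hx)
  deriv_one x hx := (((h.deriv_one x hx).mul (g.deriv_zero x hx)).add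
    ((h.deriv_zero x hx).mul (g.deriv_one x hx))).congr_deriv (by ring)
  deriv_two x hx := ((((h.deriv_two x hx).mul (g.deriv_zero x hx)).add
    (((h.deriv_one x hx).mul (g.deriv_one x hx)).const_mul 2)).add
    ((h.deriv_zero x hx).mul (g.deriv_two x hx))).congr_deriv (by ring)
  cont_three := (((h.cont_three.mul g.cont_zero).add
    (continuousOn_const.mul (h.cont_two.mul g.cont_one))).add
    (continuousOn_const.mul (h.cont_one.mul g.cont_two))).add (h.cont_zero.mul g.cont_three)
  end_zero := by simp only [h.end_zero, g.end_zero]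
  end_one := by simp only [h.end_zero, g.end_zero, h.end_one, g.end_one]
  end_two := by
    simp only [h.end_zero, g.end_zero, h.end_one, g.end_one, h.end_two, g.end_two]

theorem C3Per.fc_two (h : C3Per ℓ v v₁ v₂ v₃) (hℓ : 0 < ℓ) (k : ℤ) :
    fc ℓ v₂ k = -lam ℓ k * fc ℓ v k :=
  fc_deriv_deriv hℓ h.deriv_zero h.deriv_one h.cont_two h.end_zero h.end_one k

theorem C3Per.norm_fc_one (h : C3Per ℓ v v₁ v₂ v₃) (hℓ : 0 < ℓ) (k : ℤ) :
    ‖fc ℓ v₁ k‖ ^ 2 = lam ℓ k * ‖fc ℓ v k‖ ^ 2 :=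
  norm_fc_deriv hℓ h.deriv_zero h.cont_one h.end_zero k

theorem C3Per.norm_fc_two (h : C3Per ℓ v v₁ v₂ v₃) (hℓ : 0 < ℓ) (k : ℤ) :
    ‖fc ℓ v₂ k‖ = lam ℓ k * ‖fc ℓ v k‖ := by
  rw [h.fc_two hℓ, norm_mul, norm_neg, Complex.norm_real, Real.norm_of_nonneg (lam_nonneg _ _)]

theorem C3Per.norm_fc_three (h : C3Per ℓ v v₁ v₂ v₃) (hℓ : 0 < ℓ) (k : ℤ) :
    ‖fc ℓ v₃ k‖ ^ 2 = lam ℓ k ^ 3 * ‖fc ℓ v k‖ ^ 2 := by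
  rw [norm_fc_deriv hℓ h.deriv_two h.cont_three h.end_two, h.norm_fc_two hℓ]; ring

theorem C3Per.summable_zero (h : C3Per ℓ v v₁ v₂ v₃) (hℓ : 0 < ℓ) :
    Summable fun k => ‖fc ℓ v k‖ :=
  summable_fc_of_deriv hℓ h.deriv_zero h.cont_one h.end_zero

theorem C3Per.summable_two (h : C3Per ℓ v v₁ v₂ v₃) (hℓ : 0 < ℓ) :
    Summable fun k => ‖fc ℓ v₂ k‖ :=
  summable_fc_of_deriv hℓ h.deriv_two h.cont_three h.end_two

theorem C3Per.dEta_two (h : C3Per ℓ v v₁ v₂ v₃) (hℓ : 0 < ℓ) {η : ℝ} (hη : η ∈ cell ℓ) :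
    dEta ℓ 2 v η = v₂ η := dEta_two_eq hℓ h.deriv_zero h.deriv_one hη

theorem c3Per_dEta (hℓ : 0 < ℓ) {f : ℝ → ℝ} (hf : ContDiffOn ℝ 4 f (cell ℓ))
    (hp : PeriodicUpTo ℓ 3 f) :
    C3Per ℓ (dEta ℓ 1 f) (dEta ℓ 2 f) (dEta ℓ 3 f) (dEta ℓ 4 f) where
  deriv_zero := hasDerivWithinAt_dEta hℓ (n := 4) hf (j := 1) (by norm_num)
  deriv_one := hasDerivWithinAt_dEta hℓ (n := 4) hf (j := 2) (by norm_num)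
  deriv_two := hasDerivWithinAt_dEta hℓ (n := 4) hf (j := 3) (by norm_num)
  cont_three := continuousOn_dEta hℓ (n := 4) hf le_rfl
  end_zero := hp 1 (by norm_num)
  end_one := hp 2 (by norm_num)
  end_two := hp 3 le_rfl

theorem c3Per_self (hℓ : 0 < ℓ) {f : ℝ → ℝ} (hf : ContDiffOn ℝ 4 f (cell ℓ))
    (hp : PeriodicUpTo ℓ 3 f) : C3Per ℓ f (dEta ℓ 1 f) (dEta ℓ 2 f) (dEta ℓ 3 f) where
  deriv_zero := by
    have := hasDerivWithinAt_dEta hℓ (n := 4) hf (j := 0) (by norm_num)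
    rwa [dEta_zero] at this
  deriv_one := hasDerivWithinAt_dEta hℓ (n := 4) hf (j := 1) (by norm_num)
  deriv_two := hasDerivWithinAt_dEta hℓ (n := 4) hf (j := 2) (by norm_num)
  cont_three := continuousOn_dEta hℓ (n := 4) hf (by norm_num)
  end_zero := by simpa only [dEta_zero] using hp 0 (by norm_num)
  end_one := hp 1 (by norm_num)
  end_two := hp 2 (by norm_num)

theorem fc_dEta_four (hℓ : 0 < ℓ) {f : ℝ → ℝ} (hf : ContDiffOn ℝ 4 f (cell ℓ))
    (hp : PeriodicUpTo ℓ 3 f) (k : ℤ) :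
    fc ℓ (dEta ℓ 4 f) k = lam ℓ k ^ 2 * fc ℓ f k := by
  have h := c3Per_dEta hℓ hf hp
  rw [fc_deriv_deriv hℓ h.deriv_one h.deriv_two h.cont_three h.end_one h.end_two,
    (c3Per_self hℓ hf hp).fc_two hℓ]
  ring

end C3Per

/-! ### Fourier coefficients of functions depending on time -/

theorem continuousOn_fc {ℓ T : ℝ} (hℓ : 0 < ℓ) {f : ℝ → ℝ → ℝ}
    (hf : ContinuousOn (fun p : ℝ × ℝ => f p.1 p.2) (Icc 0 T ×ˢ cell ℓ)) (k : ℤ) :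
    ContinuousOn (fun τ => fc ℓ (f τ) k) (Icc 0 T) := by
  obtain ⟨C, hC⟩ := (isCompact_Icc.prod (isCompact_cell ℓ)).exists_bound_of_continuousOn hf
  have hsub : Set.uIoc (-(ℓ / 2)) (ℓ / 2) ⊆ cell ℓ := by
    rw [cell_eq_uIcc hℓ]; exact uIoc_subset_uIcc
  intro τ hτ
  refine continuousWithinAt_const.mul ?_
  refine intervalIntegral.continuousWithinAt_of_dominated_interval (bound := fun _ => C) ?_ ?_
    intervalIntegrable_const ?_
  · filter_upwards [self_mem_nhdsWithin] with s hs
    exact (((continuous_fexp ℓ _).continuousOn.mul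
      (ContinuousOn.uncurry_left' hf hs).ofReal_comp).mono hsub).aestronglyMeasurable
      measurableSet_uIoc
  · filter_upwards [self_mem_nhdsWithin] with s hs
    refine .of_forall fun η hη => ?_
    rw [norm_mul, norm_fexp, one_mul, Complex.norm_real]
    exact hC (s, η) ⟨hs, hsub hη⟩
  · refine .of_forall fun η hη => ?_
    exact continuousWithinAt_const.mul
      ((ContinuousOn.uncurry_right' hf (hsub hη)).ofReal_comp τ hτ)

/-- The mean is the Fourier coefficient of index `0`. -/
theorem continuousOn_avg {ℓ T : ℝ} (hℓ : 0 < ℓ) {f : ℝ → ℝ → ℝ}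
    (hf : ContinuousOn (fun p : ℝ × ℝ => f p.1 p.2) (Icc 0 T ×ˢ cell ℓ)) :
    ContinuousOn (fun τ => avg ℓ (f τ)) (Icc 0 T) := by
  have h := continuousOn_fc hℓ hf 0
  have e : ∀ τ, avg ℓ (f τ) = (fc ℓ (f τ) 0).re := fun τ => by
    simp only [fc, coef, neg_zero, fexp_zero, one_mul, avg]
    rw [intervalIntegral.integral_ofReal, ← Complex.ofReal_inv, ← Complex.ofReal_mul,
      Complex.ofReal_re]
  simp only [e]
  exact Complex.continuous_re.comp_continuousOn h

theorem hasDerivAt_fc {ℓ t B : ℝ} (hℓ : 0 < ℓ) {f g : ℝ → ℝ → ℝ} {S : Set ℝ}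
    (hS : S ∈ nhds t) (hf : ∀ s ∈ S, ContinuousOn (f s) (cell ℓ))
    (hg : ContinuousOn (g t) (cell ℓ))
    (hd : ∀ s ∈ S, ∀ η ∈ cell ℓ, HasDerivAt (fun s => f s η) (g s η) s)
    (hB : ∀ s ∈ S, ∀ η ∈ cell ℓ, |g s η| ≤ B) (k : ℤ) :
    HasDerivAt (fun s => fc ℓ (f s) k) (fc ℓ (g t) k) t := by
  have hsub : Set.uIoc (-(ℓ / 2)) (ℓ / 2) ⊆ cell ℓ := by
    rw [cell_eq_uIcc hℓ]; exact uIoc_subset_uIcc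
  have ht : t ∈ S := mem_of_mem_nhds hS
  have h := intervalIntegral.hasDerivAt_integral_of_dominated_loc_of_deriv_le
    (F := fun s η => fexp ℓ (-k) η * (f s η : ℂ)) (F' := fun s η => fexp ℓ (-k) η * (g s η : ℂ))
    (bound := fun _ => B) (a := -(ℓ / 2)) (b := ℓ / 2) (μ := volume) hS ?_ ?_ ?_ ?_
    intervalIntegrable_const ?_
  · exact h.2.const_mul _
  · filter_upwards [hS] with s hs
    exact (((continuous_fexp ℓ _).continuousOn.mul (hf s hs).ofReal_comp).mono
      hsub).aestronglyMeasurable measurableSet_uIoc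
  · exact intervalIntegrable_fexp_mul hℓ (hf t ht).ofReal_comp _
  · exact (((continuous_fexp ℓ _).continuousOn.mul hg.ofReal_comp).mono
      hsub).aestronglyMeasurable measurableSet_uIoc
  · refine .of_forall fun η hη s hs => ?_
    rw [norm_mul, norm_fexp, one_mul, Complex.norm_real]
    exact hB s hs η (hsub hη)
  · exact .of_forall fun η hη s hs => ((hd s hs η (hsub hη)).ofReal_comp).const_mul _

/-- The integrated form of a differential inequality for a squared norm. -/
theorem norm_sq_le_add_integral {T w : ℝ} {z z' : ℝ → ℂ} {R : ℝ → ℝ}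
    (hz : ContinuousOn z (Icc 0 T)) (hz' : ∀ t ∈ Ioo 0 T, HasDerivAt z (z' t) t)
    (hR : ContinuousOn R (Icc 0 T)) (h : ∀ t ∈ Ioo 0 T, w * (2 * inner ℝ (z t) (z' t)) ≤ R t)
    {t : ℝ} (ht : t ∈ Icc 0 T) :
    w * ‖z t‖ ^ 2 ≤ w * ‖z 0‖ ^ 2 + ∫ s in (0 : ℝ)..t, R s := by
  have hT : (0 : ℝ) ≤ T := ht.1.trans ht.2
  have hIntg : IntervalIntegrable R volume 0 T :=
    ContinuousOn.intervalIntegrable (by rwa [uIcc_of_le hT])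
  have hcI : ContinuousOn (fun t => ∫ s in (0 : ℝ)..t, R s) (Icc 0 T) := by
    have := intervalIntegral.continuousOn_primitive_interval (μ := volume) (f := R) (a := 0) (b := T)
      (by rw [uIcc_of_le hT]; exact hR.integrableOn_Icc)
    rwa [uIcc_of_le hT] at this
  have hderiv : ∀ t ∈ Ioo 0 T, HasDerivAt (fun t => w * ‖z t‖ ^ 2 - ∫ s in (0 : ℝ)..t, R s)
      (w * (2 * inner ℝ (z t) (z' t)) - R t) t := by
    intro t ht
    have hn : Icc 0 T ∈ nhds t := Icc_mem_nhds ht.1 ht.2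
    refine ((hz' t ht).norm_sq.const_mul w).sub ?_
    refine intervalIntegral.integral_hasDerivAt_right ?_ ?_ (hR.continuousAt hn)
    · exact hIntg.mono_set (by rw [uIcc_of_le hT, uIcc_of_le ht.1.le]; exact Icc_subset_Icc_right ht.2.le)
    · exact ContinuousOn.stronglyMeasurableAtFilter isOpen_Ioo (hR.mono Ioo_subset_Icc_self) t ht
  have hanti : AntitoneOn (fun t => w * ‖z t‖ ^ 2 - ∫ s in (0 : ℝ)..t, R s) (Icc 0 T) := by
    refine antitoneOn_of_deriv_nonpos (convex_Icc 0 T)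
      ((continuousOn_const.mul (hz.norm.pow 2)).sub hcI) ?_ ?_
    · rw [interior_Icc]
      exact fun t ht => (hderiv t ht).differentiableAt.differentiableWithinAt
    · rw [interior_Icc]
      intro t ht
      rw [(hderiv t ht).deriv]
      linarith [h t ht]
  have := hanti (left_mem_Icc.2 hT) ht ht.1
  simp only [intervalIntegral.integral_same, sub_zero] at this
  linarith

/-! ### Functions of class `C^{1,4}` -/

section MemC

variable {ℓ T : ℝ} {f : ℝ → ℝ → ℝ}

theorem MemC.continuousOn_dEta_uncurry (hf : MemC 1 4 (Icc 0 T) (cell ℓ) f) {j : ℕ} (hj : j ≤ 4) :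
    ContinuousOn (fun p : ℝ × ℝ => dEta ℓ j (f p.1) p.2) (Icc 0 T ×ˢ cell ℓ) :=
  hf.snd_cont j hj

theorem MemC.continuousOn_uncurry (hf : MemC 1 4 (Icc 0 T) (cell ℓ) f) :
    ContinuousOn (fun p : ℝ × ℝ => f p.1 p.2) (Icc 0 T ×ˢ cell ℓ) := by
  simpa only [iteratedDerivWithin_zero] using hf.snd_cont 0 (by norm_num)

theorem MemC.continuousOn_dTau (hf : MemC 1 4 (Icc 0 T) (cell ℓ) f) :
    ContinuousOn (fun p : ℝ × ℝ => dTau T f p.1 p.2) (Icc 0 T ×ˢ cell ℓ) := by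
  simpa only [iteratedDerivWithin_one, dTau] using hf.fst_cont 1 le_rfl

theorem MemC.exists_bound (hf : MemC 1 4 (Icc 0 T) (cell ℓ) f) :
    ∃ K : ℝ, 0 ≤ K ∧ ∀ j ≤ 4, ∀ τ ∈ Icc 0 T, ∀ η ∈ cell ℓ, |dEta ℓ j (f τ) η| ≤ K := by
  have h : ∀ j : Fin 5, ∃ C : ℝ, ∀ p ∈ Icc 0 T ×ˢ cell ℓ, ‖dEta ℓ j (f p.1) p.2‖ ≤ C := fun j =>
    (isCompact_Icc.prod (isCompact_cell ℓ)).exists_bound_of_continuousOn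
      (hf.continuousOn_dEta_uncurry (by omega))
  choose C hC using h
  refine ⟨∑ j, |C j|, by positivity, fun j hj τ hτ η hη => ?_⟩
  calc |dEta ℓ j (f τ) η| ≤ C ⟨j, by omega⟩ := hC ⟨j, by omega⟩ (τ, η) ⟨hτ, hη⟩
    _ ≤ |C ⟨j, by omega⟩| := le_abs_self _
    _ ≤ ∑ j, |C j| := Finset.single_le_sum (f := fun j => |C j|) (fun _ _ => abs_nonneg _)
      (Finset.mem_univ _)

theorem MemC.hasDerivAt_fc (hℓ : 0 < ℓ) (hf : MemC 1 4 (Icc 0 T) (cell ℓ) f) {τ : ℝ}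
    (hτ : τ ∈ Ioo 0 T) (k : ℤ) :
    HasDerivAt (fun s => fc ℓ (f s) k) (fc ℓ (dTau T f τ) k) τ := by
  obtain ⟨B, hB⟩ := (isCompact_Icc.prod (isCompact_cell ℓ)).exists_bound_of_continuousOn
    hf.continuousOn_dTau
  have hsub : ∀ s ∈ Ioo 0 T, s ∈ Icc 0 T := fun s hs => Ioo_subset_Icc_self hs
  refine KSFront.hasDerivAt_fc hℓ (Ioo_mem_nhds hτ.1 hτ.2)
    (fun s hs => ContinuousOn.uncurry_left' hf.continuousOn_uncurry (hsub s hs))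
    (ContinuousOn.uncurry_left' hf.continuousOn_dTau (hsub τ hτ)) (fun s hs η hη => ?_)
    (fun s hs η hη => hB (s, η) ⟨hsub s hs, hη⟩) k
  have hd := ((hf.fst_diff η hη).differentiableOn (by norm_num)) s (hsub s hs)
  exact hd.hasDerivWithinAt.hasDerivAt (Icc_mem_nhds hs.1 hs.2)

end MemC

/-! ### Smoothing for the modes of a fourth order equation -/

/-- A Duhamel bound. -/
theorem norm_le_duhamel {T a σ : ℝ} (haσ : a ≤ σ) {z m : ℝ → ℂ}
    (hz : ContinuousOn z (Icc 0 T)) (hm : ContinuousOn m (Icc 0 T))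
    (hd : ∀ t ∈ Ioo 0 T, HasDerivAt z (-σ * z t + m t) t) {t : ℝ} (ht : t ∈ Icc 0 T) :
    ‖z t‖ ≤ Real.exp (-(a * t)) * ‖z 0‖ + ∫ r in (0 : ℝ)..t, Real.exp (-(a * (t - r))) * ‖m r‖ := by
  have hsub : Icc 0 t ⊆ Icc 0 T := Icc_subset_Icc_right ht.2
  have hexp : Continuous fun r : ℝ => (Real.exp (-(σ * (t - r))) : ℂ) := by fun_prop
  have hg : ∀ r ∈ Ioo 0 t, HasDerivAt (fun r => (Real.exp (-(σ * (t - r))) : ℂ) * z r)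
      ((Real.exp (-(σ * (t - r))) : ℂ) * m r) r := by
    intro r hr
    have h1 : HasDerivAt (fun r : ℝ => Real.exp (-(σ * (t - r))))
        (Real.exp (-(σ * (t - r))) * σ) r := by
      refine HasDerivAt.exp ?_
      exact ((((hasDerivAt_id' r).const_sub t).const_mul σ).neg).congr_deriv (by ring)
    refine (h1.ofReal_comp.mul (hd r ⟨hr.1, hr.2.trans_le ht.2⟩)).congr_deriv ?_
    push_cast
    ring
  have hIntg : IntervalIntegrable (fun r => (Real.exp (-(σ * (t - r))) : ℂ) * m r) volume 0 t :=
    ContinuousOn.intervalIntegrable (by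
      rw [uIcc_of_le ht.1]; exact hexp.continuousOn.mul (hm.mono hsub))
  have h := intervalIntegral.integral_eq_sub_of_hasDerivAt_of_le ht.1
    (hexp.continuousOn.mul (hz.mono hsub)) hg hIntg
  have hz' : z t = (Real.exp (-(σ * t)) : ℂ) * z 0
      + ∫ r in (0 : ℝ)..t, (Real.exp (-(σ * (t - r))) : ℂ) * m r := by
    rw [h]; simp
  have hmono : ∀ s : ℝ, 0 ≤ s → Real.exp (-(σ * s)) ≤ Real.exp (-(a * s)) := fun s hs =>
    Real.exp_le_exp.2 (neg_le_neg (mul_le_mul_of_nonneg_right haσ hs))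
  rw [hz']
  refine (norm_add_le _ _).trans (add_le_add ?_ ?_)
  · rw [norm_mul, Complex.norm_real, Real.norm_of_nonneg (Real.exp_pos _).le]
    exact mul_le_mul_of_nonneg_right (hmono t ht.1) (norm_nonneg _)
  · refine intervalIntegral.norm_integral_le_of_norm_le ht.1 (.of_forall fun r hr => ?_) ?_
    · rw [norm_mul, Complex.norm_real, Real.norm_of_nonneg (Real.exp_pos _).le]
      exact mul_le_mul_of_nonneg_right (hmono _ (sub_nonneg.2 hr.2)) (norm_nonneg _)
    · refine ContinuousOn.intervalIntegrable ?_
      rw [uIcc_of_le ht.1]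
      exact (by fun_prop : Continuous fun r : ℝ => Real.exp (-(a * (t - r)))).continuousOn.mul
        (hm.mono hsub).norm

/-- The smoothing of the heat kernel of fourth order, with an integrable singularity in time. -/
theorem cube_mul_exp_mul_le {lm s n : ℝ} (hl : 0 ≤ lm) (hs : 0 < s) (hn : 0 ≤ n) :
    lm ^ 3 * (Real.exp (-(lm ^ 2 * s)) * n) ≤
      s ^ (-(15 / 16) : ℝ) * (lm ^ (-(3 / 4) : ℝ) + lm ^ 3 * n ^ 2) := by
  rcases hl.eq_or_lt with rfl | hl
  · simp
  -- With `y = λ^{1/8}` and `z = s^{1/16}` all exponents become integers. Split `λ³ = λ^{15/8}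
  -- λ^{9/8}`: the exponential absorbs the first factor at the price `s^{-15/16}`, integrable at
  -- `0`; the second, times `n`, is at most `λ^{-3/4} + λ³n²`.
  obtain ⟨y, hy⟩ : ∃ y, y = lm ^ (1 / 8 : ℝ) := ⟨_, rfl⟩
  obtain ⟨z, hz⟩ : ∃ z, z = s ^ (1 / 16 : ℝ) := ⟨_, rfl⟩
  have hy0 : 0 < y := hy ▸ Real.rpow_pos_of_pos hl _
  have hz0 : 0 < z := hz ▸ Real.rpow_pos_of_pos hs _
  have hyl : lm = y ^ 8 := by
    rw [hy, ← Real.rpow_natCast, ← Real.rpow_mul hl.le]; norm_num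
  have hzs : s = z ^ 16 := by
    rw [hz, ← Real.rpow_natCast, ← Real.rpow_mul hs.le]; norm_num
  have e1 : s ^ (-(15 / 16) : ℝ) = (z ^ 15)⁻¹ := by
    rw [hz, ← Real.rpow_natCast, ← Real.rpow_mul hs.le, ← Real.rpow_neg hs.le]; norm_num
  have e2 : lm ^ (-(3 / 4) : ℝ) = (y ^ 6)⁻¹ := by
    rw [hy, ← Real.rpow_natCast, ← Real.rpow_mul hl.le, ← Real.rpow_neg hl.le]; norm_num
  rw [e1, e2, hyl, hzs]
  have hu : (y * z) ^ 15 ≤ Real.exp ((y ^ 8) ^ 2 * z ^ 16) := by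
    have h1 : (y * z) ^ 15 ≤ (y * z) ^ 16 + 1 := by
      rcases le_total (y * z) 1 with h | h
      · have : (y * z) ^ 15 ≤ 1 := pow_le_one₀ (by positivity) h
        have : 0 ≤ (y * z) ^ 16 := by positivity
        linarith
      · have : (y * z) ^ 15 ≤ (y * z) ^ 16 := pow_le_pow_right₀ h (by norm_num)
        linarith
    refine h1.trans ?_
    have e : (y ^ 8) ^ 2 * z ^ 16 = (y * z) ^ 16 := by ring
    rw [e]
    exact Real.add_one_le_exp _
  have hexp : y ^ 15 * Real.exp (-((y ^ 8) ^ 2 * z ^ 16)) ≤ (z ^ 15)⁻¹ := by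
    rw [Real.exp_neg, ← div_eq_mul_inv, div_le_iff₀ (Real.exp_pos _), inv_mul_eq_div,
      le_div_iff₀ (by positivity), ← mul_pow]
    exact hu
  have hmain : y ^ 9 * n ≤ (y ^ 6)⁻¹ + (y ^ 8) ^ 3 * n ^ 2 := by
    have h := two_mul_le_add_sq ((y ^ 3)⁻¹) (y ^ 12 * n)
    have e3 : 2 * (y ^ 3)⁻¹ * (y ^ 12 * n) = 2 * (y ^ 9 * n) := by field_simp
    have e4 : ((y ^ 3)⁻¹) ^ 2 = (y ^ 6)⁻¹ := by rw [inv_pow, ← pow_mul]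
    have e5 : (y ^ 12 * n) ^ 2 = (y ^ 8) ^ 3 * n ^ 2 := by ring
    rw [e3, e4, e5] at h
    have : 0 ≤ y ^ 9 * n := by positivity
    linarith
  calc (y ^ 8) ^ 3 * (Real.exp (-((y ^ 8) ^ 2 * z ^ 16)) * n)
      = (y ^ 15 * Real.exp (-((y ^ 8) ^ 2 * z ^ 16))) * (y ^ 9 * n) := by ring
    _ ≤ (z ^ 15)⁻¹ * ((y ^ 6)⁻¹ + (y ^ 8) ^ 3 * n ^ 2) := by gcongr

/-- A multiple of `∑ |k|^{-3/2}`; the term `k = 0` is zero, as `0` to a nonzero real power is `0`.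
-/
theorem summable_lam_rpow (ℓ : ℝ) : Summable fun k => lam ℓ k ^ (-(3 / 4) : ℝ) := by
  have h := (Real.summable_abs_int_rpow (b := 3 / 2) (by norm_num)).mul_left
    (lam ℓ 1 ^ (-(3 / 4) : ℝ))
  refine h.congr fun k => ?_
  rw [lam_eq ℓ k, Real.mul_rpow (lam_nonneg _ _) (sq_nonneg _), ← sq_abs (k : ℝ), ← Real.rpow_natCast |(k : ℝ)|,
    ← Real.rpow_mul (abs_nonneg _)]
  norm_num

/-- A uniform bound for the third power of the Laplacian, in the Wiener norm, at positive times. -/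
theorem sum_lam_cube_le {ℓ T : ℝ} {z m : ℤ → ℝ → ℂ}
    (hz : ∀ k, ContinuousOn (z k) (Icc 0 T)) (hm : ∀ k, ContinuousOn (m k) (Icc 0 T))
    (hd : ∀ k, ∀ t ∈ Ioo 0 T,
      HasDerivAt (z k) (-((3 * lam ℓ k ^ 2 - lam ℓ k : ℝ) : ℂ) * z k t + m k t) t)
    {A C : ℝ} (hA : ∀ t ∈ Icc 0 T, ∀ s : Finset ℤ, ∑ k ∈ s, lam ℓ k * ‖z k t‖ ≤ A)
    (hC : ∀ t ∈ Icc 0 T, ∀ s : Finset ℤ, ∑ k ∈ s, lam ℓ k ^ 3 * ‖m k t‖ ^ 2 ≤ C)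
    {δ : ℝ} (hδ : 0 < δ) :
    ∃ B : ℝ, ∀ t ∈ Icc δ T, ∀ s : Finset ℤ, ∑ k ∈ s, lam ℓ k ^ 3 * ‖z k t‖ ≤ B := by
  obtain ⟨Z, hZ⟩ : ∃ Z, Z = ∑' k, lam ℓ k ^ (-(3 / 4) : ℝ) := ⟨_, rfl⟩
  -- Low modes, initial value, source; `16 t^{1/16}` is the integral of `s^{-15/16}` over `[0, t]`.
  refine ⟨A + δ⁻¹ * A + 16 * T ^ (1 / 16 : ℝ) * (Z + C), fun t ht s => ?_⟩
  have ht0 : 0 < t := hδ.trans_le ht.1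
  have htT : t ∈ Icc 0 T := ⟨ht0.le, ht.2⟩
  have hT : 0 < T := ht0.trans_le ht.2
  have hsub : Icc 0 t ⊆ Icc 0 T := Icc_subset_Icc_right ht.2
  have hcont : ∀ k, ContinuousOn
      (fun r => lam ℓ k ^ 3 * (Real.exp (-(lam ℓ k ^ 2 * (t - r))) * ‖m k r‖)) (Icc 0 t) := fun k =>
    continuousOn_const.mul ((by fun_prop : Continuous fun r : ℝ =>
      Real.exp (-(lam ℓ k ^ 2 * (t - r)))).continuousOn.mul ((hm k).mono hsub).norm)
  have hk : ∀ k, lam ℓ k ^ 3 * ‖z k t‖ ≤ lam ℓ k * ‖z k t‖ + δ⁻¹ * (lam ℓ k * ‖z k 0‖)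
      + ∫ r in (0 : ℝ)..t, lam ℓ k ^ 3 * (Real.exp (-(lam ℓ k ^ 2 * (t - r))) * ‖m k r‖) := by
    intro k
    have hl := lam_nonneg ℓ k
    have hI : 0 ≤ ∫ r in (0 : ℝ)..t,
        lam ℓ k ^ 3 * (Real.exp (-(lam ℓ k ^ 2 * (t - r))) * ‖m k r‖) :=
      intervalIntegral.integral_nonneg ht0.le fun r _ => by positivity
    -- For `λ ≤ 1` the cube is at most `λ`. For `λ ≥ 1` the rate `3λ² - λ` is at least `λ²`, so
    -- Duhamel's bound applies with rate `λ²`.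
    rcases le_total (lam ℓ k) 1 with h1 | h1
    · have : lam ℓ k ^ 3 ≤ lam ℓ k := by
        simpa using pow_le_pow_of_le_one hl h1 (show 1 ≤ 3 by norm_num)
      have := mul_le_mul_of_nonneg_right this (norm_nonneg (z k t))
      have : 0 ≤ δ⁻¹ * (lam ℓ k * ‖z k 0‖) := by positivity
      linarith
    · have h := norm_le_duhamel (a := lam ℓ k ^ 2) (σ := 3 * lam ℓ k ^ 2 - lam ℓ k)
        (by nlinarith) (hz k) (hm k) (hd k) htT
      have h2 := mul_le_mul_of_nonneg_left h (pow_nonneg hl 3)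
      rw [mul_add, ← intervalIntegral.integral_const_mul] at h2
      -- Staying away from `t = 0` gains two powers of `λ` on the initial value.
      have h3 : lam ℓ k ^ 2 * Real.exp (-(lam ℓ k ^ 2 * t)) ≤ δ⁻¹ := by
        rw [Real.exp_neg, ← div_eq_mul_inv, div_le_iff₀ (Real.exp_pos _), inv_mul_eq_div,
          le_div_iff₀ hδ]
        have := Real.add_one_le_exp (lam ℓ k ^ 2 * t)
        have : lam ℓ k ^ 2 * δ ≤ lam ℓ k ^ 2 * t := by gcongr; exact ht.1
        linarith
      have h4 : lam ℓ k ^ 3 * (Real.exp (-(lam ℓ k ^ 2 * t)) * ‖z k 0‖)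
          ≤ δ⁻¹ * (lam ℓ k * ‖z k 0‖) := by
        calc _ = (lam ℓ k ^ 2 * Real.exp (-(lam ℓ k ^ 2 * t))) * (lam ℓ k * ‖z k 0‖) := by ring
          _ ≤ _ := by gcongr
      have : 0 ≤ lam ℓ k * ‖z k t‖ := by positivity
      linarith
  have hsum : ∑ k ∈ s, ∫ r in (0 : ℝ)..t,
      lam ℓ k ^ 3 * (Real.exp (-(lam ℓ k ^ 2 * (t - r))) * ‖m k r‖)
      ≤ 16 * T ^ (1 / 16 : ℝ) * (Z + C) := by
    have hIntg : ∀ k, IntervalIntegrable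
        (fun r => lam ℓ k ^ 3 * (Real.exp (-(lam ℓ k ^ 2 * (t - r))) * ‖m k r‖)) volume 0 t :=
      fun k => ContinuousOn.intervalIntegrable (by rw [uIcc_of_le ht0.le]; exact hcont k)
    rw [← intervalIntegral.integral_finsetSum fun k _ => hIntg k]
    have hpow : IntervalIntegrable (fun r : ℝ => r ^ (-(15 / 16) : ℝ)) volume 0 t :=
      intervalIntegral.intervalIntegrable_rpow' (by norm_num)
    have hpow' : IntervalIntegrable (fun r : ℝ => (t - r) ^ (-(15 / 16) : ℝ)) volume 0 t := by
      have := (hpow.comp_sub_left t).symm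
      simpa using this
    have hZC : 0 ≤ Z + C := by
      have h1 : 0 ≤ Z := hZ ▸ tsum_nonneg fun k => Real.rpow_nonneg (lam_nonneg _ _) _
      have h2 := hC t htT ∅
      rw [Finset.sum_empty] at h2
      exact add_nonneg h1 h2
    calc _ ≤ ∫ r in (0 : ℝ)..t, (t - r) ^ (-(15 / 16) : ℝ) * (Z + C) := by
          refine intervalIntegral.integral_mono_on_of_le_Ioo ht0.le
            (ContinuousOn.intervalIntegrable (by
              rw [uIcc_of_le ht0.le]; exact continuousOn_finsetSum s fun k _ => hcont k))
            (hpow'.mul_const _) fun r hr => ?_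
          refine (Finset.sum_le_sum fun k _ => cube_mul_exp_mul_le (lam_nonneg ℓ k)
            (sub_pos.2 hr.2) (norm_nonneg (m k r))).trans ?_
          rw [← Finset.mul_sum, Finset.sum_add_distrib]
          refine mul_le_mul_of_nonneg_left (add_le_add ?_ (hC r (hsub ⟨hr.1.le, hr.2.le⟩) s))
            (Real.rpow_nonneg (sub_nonneg.2 hr.2.le) _)
          rw [hZ]
          exact (summable_lam_rpow ℓ).sum_le_tsum _
            fun k _ => Real.rpow_nonneg (lam_nonneg _ _) _
      _ = 16 * t ^ (1 / 16 : ℝ) * (Z + C) := by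
          rw [intervalIntegral.integral_mul_const, intervalIntegral.integral_comp_sub_left
            (fun r : ℝ => r ^ (-(15 / 16) : ℝ)), sub_self, sub_zero,
            integral_rpow (Or.inl (by norm_num))]
          norm_num
          ring_nf
          simp
      _ ≤ _ := by gcongr; exact ht.2
  calc ∑ k ∈ s, lam ℓ k ^ 3 * ‖z k t‖ ≤ ∑ k ∈ s, (lam ℓ k * ‖z k t‖ + δ⁻¹ * (lam ℓ k * ‖z k 0‖)
      + ∫ r in (0 : ℝ)..t, lam ℓ k ^ 3 * (Real.exp (-(lam ℓ k ^ 2 * (t - r))) * ‖m k r‖)) :=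
        Finset.sum_le_sum fun k _ => hk k
    _ ≤ _ := by
      rw [Finset.sum_add_distrib, Finset.sum_add_distrib, ← Finset.mul_sum]
      refine add_le_add (add_le_add (hA t htT s) ?_) hsum
      exact mul_le_mul_of_nonneg_left (hA 0 ⟨le_rfl, hT.le⟩ s) (by positivity)

/-! ### Symbols of the front operators -/

/-- The symbol of `ℬ_ε` at the eigenvalue `lm` of `-D_ηη`. -/
def symB (ε lm : ℝ) : ℝ := 1 + 13 * ε / 3 * lm + 3 * ε ^ 2 * lm ^ 2 * mW (root (ε * lm))

/-- The symbol of `𝒮_ε`. -/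
def symS (ε lm : ℝ) : ℝ :=
  -3 * (1 - ε) * lm ^ 2 + lm + 3 * ε * lm ^ 2 * mTU (root (ε * lm))

/-- The symbol of `𝒢_ε`. -/
def symG (ε lm : ℝ) : ℝ :=
  -(17 / 6) * lm + 3 * lm * (1 / 2 * mTU (root (ε * lm)) - ε * lm * mW (root (ε * lm)))

/-- The symbol of `ℋ_ε` acting on `Φ`. -/
def symH (ε lm : ℝ) : ℝ := 3 * lm ^ 2 + 3 * lm ^ 2 * mTU (root (ε * lm))

/-- The symbol of `ℋ_ε` acting on `Φ_τ`. -/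
def symHτ (ε lm : ℝ) : ℝ := -(13 / 3) * lm - 3 * ε * lm ^ 2 * mW (root (ε * lm))

section Symbols

variable {ε lm : ℝ}

/-- In terms of `a`, with `ελ = a² - a`, the symbol is the rational function `(6a³ - 3a)/(2a + 1)`;
both lower bounds below are read off from it. -/
theorem symB_mul (hε : 0 ≤ ε) (hl : 0 ≤ lm) :
    symB ε lm * (2 * root (ε * lm) + 1) = 6 * root (ε * lm) ^ 3 - 3 * root (ε * lm) := by
  have hμ : 0 ≤ ε * lm := mul_nonneg hε hl
  have h1 := one_le_root hμ
  have h2 := root_sq_sub hμ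
  have e : symB ε lm = 1 + 13 / 3 * (ε * lm) + 3 * (ε * lm) ^ 2 * mW (root (ε * lm)) := by
    unfold symB; ring
  rw [e]
  obtain ⟨a, ha⟩ : ∃ a, a = root (ε * lm) := ⟨_, rfl⟩
  rw [← ha] at h1 h2 ⊢
  rw [← h2, mW]
  field_simp
  ring

/-- After clearing denominators the difference is `(a - 1)(6a² + 6a + 1)`. -/
theorem one_le_symB (hε : 0 ≤ ε) (hl : 0 ≤ lm) : 1 ≤ symB ε lm := by
  have h1 := one_le_root (mul_nonneg hε hl)
  have h := symB_mul hε hl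
  obtain ⟨a, ha⟩ : ∃ a, a = root (ε * lm) := ⟨_, rfl⟩
  rw [← ha] at h1 h
  have : 1 * (2 * a + 1) ≤ symB ε lm * (2 * a + 1) := by
    rw [h]; nlinarith [mul_nonneg (sub_nonneg.2 h1) (sq_nonneg a)]
  exact le_of_mul_le_mul_right this (by linarith)

/-- This gain from `ℬ_ε` compensates the derivatives that `𝒢_ε` puts on products containing `ρ_η`.
-/
theorem mul_le_symB (hε : 0 ≤ ε) (hl : 0 ≤ lm) : ε * lm ≤ symB ε lm := by
  have hμ := mul_nonneg hε hl
  have h1 := one_le_root hμ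
  have h2 := root_sq_sub hμ
  have h := symB_mul hε hl
  obtain ⟨a, ha⟩ : ∃ a, a = root (ε * lm) := ⟨_, rfl⟩
  rw [← ha] at h1 h h2
  have : ε * lm * (2 * a + 1) ≤ symB ε lm * (2 * a + 1) := by
    rw [h, ← h2]; nlinarith [mul_nonneg (sub_nonneg.2 h1) (sq_nonneg a)]
  exact le_of_mul_le_mul_right this (by linarith)

theorem mTU_nonneg {a : ℝ} (ha : 1 ≤ a) : 0 ≤ mTU a := by unfold mTU; positivity

theorem mTU_le {a : ℝ} (ha : 1 ≤ a) : mTU a ≤ 1 / 9 := by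
  unfold mTU
  exact one_div_le_one_div_of_le (by norm_num) (by nlinarith)

theorem neg_mul_mW_nonneg (hμ : 0 ≤ ε * lm) : 0 ≤ -(ε * lm * mW (root (ε * lm))) := by
  have h1 := one_le_root hμ
  have : 0 ≤ (8 * root (ε * lm) + 3) / (9 * root (ε * lm) ^ 2 * (2 * root (ε * lm) + 1)) := by
    positivity
  have := mul_nonneg hμ this
  rw [mW, neg_div]
  linarith

/-- The left side is `(a-1)(8a+3)/(9a(2a+1))`, and `4/9` is its limit as `a → ∞`. -/
theorem neg_mul_mW_le (hμ : 0 ≤ ε * lm) : -(ε * lm * mW (root (ε * lm))) ≤ 4 / 9 := by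
  have h1 := one_le_root hμ
  have h2 := root_sq_sub hμ
  obtain ⟨a, ha⟩ : ∃ a, a = root (ε * lm) := ⟨_, rfl⟩
  rw [← ha] at h1 h2 ⊢
  have ha0 : 0 < a := by linarith
  have e : -(ε * lm * mW a) = (a - 1) * (8 * a + 3) / (9 * a * (2 * a + 1)) := by
    rw [← h2, mW]; field_simp
  rw [e, div_le_div_iff₀ (by positivity) (by norm_num)]
  nlinarith

/-- For `ε ≤ 1/5` the coefficient of `λ²` is at most `-3 + 3/5 + 1/15 = -7/3`, and the spare `-λ²/3`
controls the unstable term: `λ - λ²/3 ≤ 3/4`. -/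
theorem symS_le (hε : 0 ≤ ε) (hε' : ε ≤ 1 / 5) (hl : 0 ≤ lm) : symS ε lm ≤ -2 * lm ^ 2 + 1 := by
  have h1 := one_le_root (mul_nonneg hε hl)
  have h2 := mTU_le h1
  have h3 : ε * lm ^ 2 * mTU (root (ε * lm)) ≤ 1 / 5 * lm ^ 2 * (1 / 9) := by
    have := mTU_nonneg h1
    gcongr
  have h4 : ε * lm ^ 2 ≤ 1 / 5 * lm ^ 2 := by gcongr
  unfold symS
  nlinarith [sq_nonneg (lm - 3 / 2)]

theorem abs_symG_le (hε : 0 ≤ ε) (hl : 0 ≤ lm) : |symG ε lm| ≤ 3 * lm := by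
  have hμ := mul_nonneg hε hl
  have h1 := one_le_root hμ
  have h2 := mTU_le h1
  have h3 := mTU_nonneg h1
  have h4 := neg_mul_mW_le hμ
  have h5 := neg_mul_mW_nonneg hμ
  obtain ⟨q, hq⟩ : ∃ q, q = -(17 / 6) + 3 * (1 / 2 * mTU (root (ε * lm))
    - ε * lm * mW (root (ε * lm))) := ⟨_, rfl⟩
  have e : symG ε lm = q * lm := by rw [hq, symG]; ring
  rw [e, abs_mul, abs_of_nonneg hl]
  refine mul_le_mul_of_nonneg_right (abs_le.2 ⟨?_, ?_⟩) hl <;> rw [hq] <;> linarith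

theorem abs_symH_le (hε : 0 ≤ ε) (hl : 0 ≤ lm) : |symH ε lm| ≤ 4 * lm ^ 2 := by
  have h1 := one_le_root (mul_nonneg hε hl)
  have h2 := mTU_le h1
  have h3 := mTU_nonneg h1
  have e : symH ε lm = (3 + 3 * mTU (root (ε * lm))) * lm ^ 2 := by unfold symH; ring
  rw [e, abs_mul, abs_of_nonneg (sq_nonneg lm), abs_of_nonneg (by linarith)]
  exact mul_le_mul_of_nonneg_right (by linarith) (sq_nonneg lm)

theorem abs_symHτ_le (hε : 0 ≤ ε) (hl : 0 ≤ lm) : |symHτ ε lm| ≤ 5 * lm := by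
  have hμ := mul_nonneg hε hl
  have h4 := neg_mul_mW_le hμ
  have h5 := neg_mul_mW_nonneg hμ
  have e : symHτ ε lm = (-(13 / 3) + 3 * -(ε * lm * mW (root (ε * lm)))) * lm := by
    unfold symHτ; ring
  rw [e, abs_mul, abs_of_nonneg hl]
  exact mul_le_mul_of_nonneg_right (abs_le.2 ⟨by linarith, by linarith⟩) hl

theorem symB_zero (ε : ℝ) : symB ε 0 = 1 := by simp [symB]

theorem symS_zero (ε : ℝ) : symS ε 0 = 0 := by simp [symS]

end Symbols

/-! ### Fourier coefficients of the front operators -/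

/-- `f` is continuous on the cell, has Fourier coefficients `d`, and is bounded by `B`. -/
structure FourierData (ℓ : ℝ) (f : ℝ → ℝ) (d : ℤ → ℂ) (B : ℝ) : Prop where
  cont : ContinuousOn f (cell ℓ)
  coef : ∀ k, fc ℓ f k = d k
  bound : ∀ η ∈ cell ℓ, |f η| ≤ B

section FourierData

variable {ℓ ε : ℝ} {f g : ℝ → ℝ} {d e : ℤ → ℂ} {A B : ℝ}

theorem FourierData.add (hf : FourierData ℓ f d A) (hg : FourierData ℓ g e B) (hℓ : 0 < ℓ) :
    FourierData ℓ (fun x => f x + g x) (fun k => d k + e k) (A + B) where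
  cont := continuousOn_fun_add hf.cont hg.cont
  coef k := by rw [fc_add hℓ hf.cont hg.cont, hf.coef, hg.coef]
  bound η hη := (abs_add_le _ _).trans (add_le_add (hf.bound η hη) (hg.bound η hη))

theorem FourierData.const_mul (hf : FourierData ℓ f d A) (c : ℝ) :
    FourierData ℓ (fun x => c * f x) (fun k => c * d k) (|c| * A) where
  cont := continuousOn_const_mul c hf.cont
  coef k := by rw [fc_const_mul, hf.coef]
  bound η hη := by
    rw [abs_mul]; exact mul_le_mul_of_nonneg_left (hf.bound η hη) (abs_nonneg c)

theorem FourierData.congr (hf : FourierData ℓ f d A) (hℓ : 0 < ℓ) (hg : ∀ η ∈ cell ℓ, g η = f η)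
    (he : ∀ k, e k = d k) : FourierData ℓ g e A where
  cont := hf.cont.congr hg
  coef k := by rw [fc_congr hℓ hg, hf.coef, he]
  bound η hη := by rw [hg η hη]; exact hf.bound η hη

theorem fourierData_of_hasSum (hℓ : 0 < ℓ) (hd : Summable fun k => ‖d k‖) (hB : ∑' k, ‖d k‖ ≤ B)
    (hf : ∀ η ∈ cell ℓ, HasSum (fun k => d k * fexp ℓ k η) (f η : ℂ)) : FourierData ℓ f d B where
  cont := continuousOn_of_hasSum hd hf
  coef := fc_of_hasSum hℓ hd hf
  bound η hη := (abs_le_of_hasSum hd (hf η hη)).trans hB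

theorem fourierData_dEtaEtaRes {ψ χ : ℝ → ℝ} (hℓ : 0 < ℓ) (hε : 0 < ε)
    (hψ : ContinuousOn ψ (cell ℓ)) (hχ : ContinuousOn χ (cell ℓ))
    (sψ : Summable fun k => ‖fc ℓ ψ k‖) (sχ : Summable fun k => ‖fc ℓ χ k‖)
    {c : ℤ → ℂ} {r t : ℤ → ℝ} (cψ : ∀ k, fc ℓ ψ k = r k * c k) (cχ : ∀ k, fc ℓ χ k = t k * c k)
    (ht : t 0 = 0) (hA : ∑' k, ‖fc ℓ ψ k‖ ≤ A) (hB : ∑' k, ‖fc ℓ χ k‖ ≤ B) :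
    FourierData ℓ (dEtaEtaRes ℓ ε (tensor ψ (bT' - bU) + tensor χ bW)) (resCoef ℓ ε ψ χ)
      (ε⁻¹ * (A + B)) := by
  have hs := (sψ.add sχ).mul_left ε⁻¹
  have hs' : Summable fun k => ‖resCoef ℓ ε ψ χ k‖ :=
    Summable.of_nonneg_of_le (fun _ => norm_nonneg _) (norm_resCoef_le hε ψ χ) hs
  refine fourierData_of_hasSum hℓ hs' ?_ (hasSum_dEtaEtaRes hℓ hε hψ hχ sψ sχ cψ cχ ht)
  refine (hs'.tsum_le_tsum (norm_resCoef_le hε ψ χ) hs).trans ?_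
  rw [tsum_mul_left, sψ.tsum_add sχ]
  gcongr

theorem fc_zero (ℓ : ℝ) (k : ℤ) : fc ℓ (fun _ => 0) k = 0 := by
  simpa using fc_const_mul ℓ 0 (fun _ => 0) k

theorem tensor_zero (h : GenFun1) : tensor (fun _ => 0) h = 0 := by
  simp only [tensor, zero_mul]; rfl

theorem fourierData_resTU (hℓ : 0 < ℓ) (hε : 0 < ε) (hf : ContinuousOn f (cell ℓ))
    (sf : Summable fun k => ‖fc ℓ f k‖) (hA : ∑' k, ‖fc ℓ f k‖ ≤ A) :
    FourierData ℓ (dEtaEtaRes ℓ ε (tensor f (bT' - bU)))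
      (fun k => -lam ℓ k * (mTU (root (ε * lam ℓ k)) * fc ℓ f k)) (ε⁻¹ * A) := by
  have h := fourierData_dEtaEtaRes (ψ := f) (χ := fun _ => 0) (c := fc ℓ f) (r := fun _ => 1)
    (t := fun _ => 0) (A := A) (B := 0) hℓ hε hf continuousOn_const sf
    (by simpa only [fc_zero, norm_zero] using summable_zero) (by simp) (by simp [fc_zero]) rfl hA
    (by simp [fc_zero])
  rw [tensor_zero, add_zero, add_zero] at h
  exact h.congr hℓ (fun _ _ => rfl) fun k => by simp [resCoef, fc_zero]

/-- The zero mean `hf0` replaces the mode solution for `𝐖` that is not constructed at `k = 0`. -/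
theorem fourierData_resW (hℓ : 0 < ℓ) (hε : 0 < ε) (hf : ContinuousOn f (cell ℓ))
    (sf : Summable fun k => ‖fc ℓ f k‖) (hf0 : fc ℓ f 0 = 0) (hA : ∑' k, ‖fc ℓ f k‖ ≤ A) :
    FourierData ℓ (dEtaEtaRes ℓ ε (tensor f bW))
      (fun k => -lam ℓ k * (mW (root (ε * lam ℓ k)) * fc ℓ f k)) (ε⁻¹ * A) := by
  have h := fourierData_dEtaEtaRes (χ := f) (ψ := fun _ => 0) (c := fc ℓ f) (r := fun _ => 0)
    (t := fun k => if k = 0 then 0 else 1) (A := 0) (B := A) hℓ hε continuousOn_const hf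
    (by simpa only [fc_zero, norm_zero] using summable_zero) sf (by simp [fc_zero])
    (fun k => by by_cases hk : k = 0 <;> simp [hk, hf0]) (by simp) (by simp [fc_zero]) hA
  rw [tensor_zero, zero_add, zero_add] at h
  exact h.congr hℓ (fun _ _ => rfl) fun k => by simp [resCoef, fc_zero]

end FourierData

/-- A bound for the Wiener norm of a periodic `C¹` function bounded by `A` with its derivative. -/
def wienerBound (ℓ A : ℝ) : ℝ := A + (A ^ 2 + ∑' k, (lam ℓ k)⁻¹)

section Operators

variable {ℓ ε A : ℝ} {v v₁ v₂ v₃ : ℝ → ℝ}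

theorem C3Per.tsum_zero_le (h : C3Per ℓ v v₁ v₂ v₃) (hℓ : 0 < ℓ) (h0 : ∀ x ∈ cell ℓ, |v x| ≤ A)
    (h1 : ∀ x ∈ cell ℓ, |v₁ x| ≤ A) : ∑' k, ‖fc ℓ v k‖ ≤ wienerBound ℓ A :=
  tsum_fc_le_of_deriv hℓ h.deriv_zero h.cont_one h.end_zero h0 h1

theorem C3Per.tsum_two_le (h : C3Per ℓ v v₁ v₂ v₃) (hℓ : 0 < ℓ) (h2 : ∀ x ∈ cell ℓ, |v₂ x| ≤ A)
    (h3 : ∀ x ∈ cell ℓ, |v₃ x| ≤ A) : ∑' k, ‖fc ℓ v₂ k‖ ≤ wienerBound ℓ A :=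
  tsum_fc_le_of_deriv hℓ h.deriv_two h.cont_three h.end_two h2 h3

theorem C3Per.fc_dEta_two (h : C3Per ℓ v v₁ v₂ v₃) (hℓ : 0 < ℓ) (k : ℤ) :
    fc ℓ (dEta ℓ 2 v) k = fc ℓ v₂ k := fc_congr hℓ (fun _ hx => h.dEta_two hℓ hx) k

theorem C3Per.cont_dEta_two (h : C3Per ℓ v v₁ v₂ v₃) (hℓ : 0 < ℓ) :
    ContinuousOn (dEta ℓ 2 v) (cell ℓ) := h.cont_two.congr fun _ hx => h.dEta_two hℓ hx

theorem C3Per.fourierData_zero (h : C3Per ℓ v v₁ v₂ v₃) (h0 : ∀ x ∈ cell ℓ, |v x| ≤ A) :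
    FourierData ℓ v (fc ℓ v) A := ⟨h.cont_zero, fun _ => rfl, h0⟩

theorem C3Per.fourierData_dEta_two (h : C3Per ℓ v v₁ v₂ v₃) (hℓ : 0 < ℓ)
    (h2 : ∀ x ∈ cell ℓ, |v₂ x| ≤ A) :
    FourierData ℓ (dEta ℓ 2 v) (fun k => -lam ℓ k * fc ℓ v k) A :=
  ⟨h.cont_dEta_two hℓ, fun k => by rw [h.fc_dEta_two hℓ, h.fc_two hℓ],
    fun η hη => by rw [h.dEta_two hℓ hη]; exact h2 η hη⟩

/-- Bounds of this kind are for fixed `ε`: they justify differentiation under the integral and do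
not enter the uniform estimate. -/
theorem C3Per.fourierData_opB (h : C3Per ℓ v v₁ v₂ v₃) (hℓ : 0 < ℓ) (hε : 0 < ε)
    (h0 : ∀ x ∈ cell ℓ, |v x| ≤ A) (h2 : ∀ x ∈ cell ℓ, |v₂ x| ≤ A)
    (h3 : ∀ x ∈ cell ℓ, |v₃ x| ≤ A) :
    FourierData ℓ (opB ℓ ε v) (fun k => symB ε (lam ℓ k) * fc ℓ v k)
      (A + |-(13 * ε / 3)| * A + |3 * ε ^ 2| * (ε⁻¹ * wienerBound ℓ A)) := by
  have hW := fourierData_resW hℓ hε (h.cont_dEta_two hℓ) (A := wienerBound ℓ A)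
    (by simpa only [h.fc_dEta_two hℓ] using h.summable_two hℓ)
    (by rw [h.fc_dEta_two hℓ, h.fc_two hℓ, lam_zero]; simp)
    (by simpa only [h.fc_dEta_two hℓ] using h.tsum_two_le hℓ h2 h3)
  refine (((h.fourierData_zero h0).add ((h.fourierData_dEta_two hℓ h2).const_mul _) hℓ).add
    (hW.const_mul _) hℓ).congr hℓ (fun η _ => ?_) fun k => ?_
  · rw [opB]; ring
  · rw [h.fc_dEta_two hℓ, h.fc_two hℓ, symB]; push_cast; ring

theorem fourierData_opS {f : ℝ → ℝ} (hℓ : 0 < ℓ) (hε : 0 < ε) (hf : ContDiffOn ℝ 4 f (cell ℓ))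
    (hp : PeriodicUpTo ℓ 3 f) (hA : ∀ j ≤ 4, ∀ x ∈ cell ℓ, |dEta ℓ j f x| ≤ A) :
    FourierData ℓ (opS ℓ ε f) (fun k => symS ε (lam ℓ k) * fc ℓ f k)
      (|-3 * (1 - ε)| * A + |-1| * A + |3 * ε| * (ε⁻¹ * wienerBound ℓ A)) := by
  have h := c3Per_self hℓ hf hp
  have hT := fourierData_resTU hℓ hε h.cont_two (h.summable_two hℓ)
    (h.tsum_two_le hℓ (hA 2 (by norm_num)) (hA 3 (by norm_num)))
  have h4 : FourierData ℓ (dEta ℓ 4 f) (fun k => lam ℓ k ^ 2 * fc ℓ f k) A :=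
    ⟨continuousOn_dEta hℓ (n := 4) hf le_rfl, fc_dEta_four hℓ hf hp, hA 4 le_rfl⟩
  refine (((h4.const_mul _).add ((h.fourierData_dEta_two hℓ (hA 2 (by norm_num))).const_mul _)
    hℓ).add (hT.const_mul _) hℓ).congr hℓ (fun η _ => ?_) fun k => ?_
  · rw [opS]; ring
  · rw [h.fc_two hℓ, symS]; push_cast; ring

theorem C3Per.fourierData_opG (h : C3Per ℓ v v₁ v₂ v₃) (hℓ : 0 < ℓ) (hε : 0 < ε)
    (h0 : ∀ x ∈ cell ℓ, |v x| ≤ A) (h1 : ∀ x ∈ cell ℓ, |v₁ x| ≤ A)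
    (h2 : ∀ x ∈ cell ℓ, |v₂ x| ≤ A) (h3 : ∀ x ∈ cell ℓ, |v₃ x| ≤ A) :
    FourierData ℓ (opG ℓ ε v) (fun k => symG ε (lam ℓ k) * fc ℓ v k)
      (|17 / 6| * A + |-3| * (ε⁻¹ * (1 / 2 * wienerBound ℓ A + ε * wienerBound ℓ A))) := by
  have e : (1 / 2 : ℝ) • tensor v (bT' - bU) + ε • tensor (dEta ℓ 2 v) bW
      = tensor (fun x => 1 / 2 * v x) (bT' - bU) + tensor (fun x => ε * dEta ℓ 2 v x) bW := by
    ext x η <;> simp [tensor] <;> ring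
  have n1 : ∀ k, ‖fc ℓ (fun x => 1 / 2 * v x) k‖ = 1 / 2 * ‖fc ℓ v k‖ := fun k => by
    rw [fc_const_mul, norm_mul, Complex.norm_real, Real.norm_of_nonneg (by norm_num)]
  have n2 : ∀ k, ‖fc ℓ (fun x => ε * dEta ℓ 2 v x) k‖ = ε * ‖fc ℓ v₂ k‖ := fun k => by
    rw [fc_const_mul, norm_mul, Complex.norm_real, Real.norm_of_nonneg hε.le, h.fc_dEta_two hℓ]
  have hR := fourierData_dEtaEtaRes (ψ := fun x => 1 / 2 * v x) (χ := fun x => ε * dEta ℓ 2 v x)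
    (c := fc ℓ v) (r := fun _ => 1 / 2) (t := fun k => -ε * lam ℓ k)
    (A := 1 / 2 * wienerBound ℓ A) (B := ε * wienerBound ℓ A) hℓ hε
    (continuousOn_const_mul _ h.cont_zero) (continuousOn_const_mul _ (h.cont_dEta_two hℓ))
    (by simpa only [n1] using (h.summable_zero hℓ).mul_left _)
    (by simpa only [n2] using (h.summable_two hℓ).mul_left _)
    (fun k => by rw [fc_const_mul])
    (fun k => by rw [fc_const_mul, h.fc_dEta_two hℓ, h.fc_two hℓ]; push_cast; ring)
    (by simp [lam_zero])
    (by simp only [n1, tsum_mul_left]; gcongr; exact h.tsum_zero_le hℓ h0 h1)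
    (by simp only [n2, tsum_mul_left]; gcongr; exact h.tsum_two_le hℓ h2 h3)
  refine (((h.fourierData_dEta_two hℓ h2).const_mul _).add (hR.const_mul _) hℓ).congr hℓ
    (fun η _ => ?_) fun k => ?_
  · rw [opG, e]; ring
  · rw [resCoef, fc_const_mul, fc_const_mul, h.fc_dEta_two hℓ, h.fc_two hℓ, symG]
    push_cast
    ring

/-- The data on `Φ_τηη` are separate hypotheses because class `C^{1,4}` does not provide them; they
come from smoothing at positive times. -/
theorem fourierData_opH {T τ B : ℝ} {Φ : ℝ → ℝ → ℝ} (hℓ : 0 < ℓ) (hε : 0 < ε)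
    (hf : ContDiffOn ℝ 4 (Φ τ) (cell ℓ)) (hp : PeriodicUpTo ℓ 3 (Φ τ))
    (hA : ∀ j ≤ 4, ∀ x ∈ cell ℓ, |dEta ℓ j (Φ τ) x| ≤ A)
    (hg : FourierData ℓ (dEta ℓ 2 (dTau T Φ τ)) (fun k => -lam ℓ k * fc ℓ (dTau T Φ τ) k) B)
    (sg : Summable fun k => ‖fc ℓ (dEta ℓ 2 (dTau T Φ τ)) k‖)
    (hB : ∑' k, ‖fc ℓ (dEta ℓ 2 (dTau T Φ τ)) k‖ ≤ B) :
    FourierData ℓ (opH ℓ ε T Φ τ)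
      (fun k => symH ε (lam ℓ k) * fc ℓ (Φ τ) k + symHτ ε (lam ℓ k) * fc ℓ (dTau T Φ τ) k)
      (|3| * A + |3| * (ε⁻¹ * wienerBound ℓ A) + |13 / 3| * B + |-(3 * ε)| * (ε⁻¹ * B)) := by
  have h := c3Per_self hℓ hf hp
  have hT := fourierData_resTU hℓ hε h.cont_two (h.summable_two hℓ)
    (h.tsum_two_le hℓ (hA 2 (by norm_num)) (hA 3 (by norm_num)))
  have h4 : FourierData ℓ (dEta ℓ 4 (Φ τ)) (fun k => lam ℓ k ^ 2 * fc ℓ (Φ τ) k) A :=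
    ⟨continuousOn_dEta hℓ (n := 4) hf le_rfl, fc_dEta_four hℓ hf hp, hA 4 le_rfl⟩
  have hW := fourierData_resW hℓ hε hg.cont sg (by rw [hg.coef, lam_zero]; simp) hB
  refine ((((h4.const_mul _).add (hT.const_mul _) hℓ).add (hg.const_mul _) hℓ).add
    (hW.const_mul _) hℓ).congr hℓ (fun η _ => ?_) fun k => ?_
  · rw [opH]; ring
  · rw [h.fc_two hℓ, hg.coef, symH, symHτ]; push_cast; ring

end Operators

/-! ### Estimates for solutions of the Kuramoto–Sivashinsky equation -/

/-- The factor 8 is `1 + 3 + 3 + 1`, from Leibniz' rule of order three. -/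
theorem abs_mul_derivs_le {a₀ a₁ a₂ a₃ b₀ b₁ b₂ b₃ K L : ℝ} (ha₀ : |a₀| ≤ K) (ha₁ : |a₁| ≤ K)
    (ha₂ : |a₂| ≤ K) (ha₃ : |a₃| ≤ K) (hb₀ : |b₀| ≤ L) (hb₁ : |b₁| ≤ L) (hb₂ : |b₂| ≤ L)
    (hb₃ : |b₃| ≤ L) :
    |a₀ * b₀| ≤ 8 * (K * L) ∧ |a₁ * b₀ + a₀ * b₁| ≤ 8 * (K * L) ∧
      |a₂ * b₀ + 2 * (a₁ * b₁) + a₀ * b₂| ≤ 8 * (K * L) ∧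
      |a₃ * b₀ + 3 * (a₂ * b₁) + 3 * (a₁ * b₂) + a₀ * b₃| ≤ 8 * (K * L) := by
  have hK : 0 ≤ K := (abs_nonneg _).trans ha₀
  have hL : 0 ≤ L := (abs_nonneg _).trans hb₀
  have hKL := mul_nonneg hK hL
  have h : ∀ {a b : ℝ}, |a| ≤ K → |b| ≤ L → |a * b| ≤ K * L := fun ha hb => by
    rw [abs_mul]; exact mul_le_mul ha hb (abs_nonneg _) hK
  refine ⟨?_, ?_, ?_, ?_⟩
  · linarith [h ha₀ hb₀]
  · have := abs_le.1 (h ha₁ hb₀); have := abs_le.1 (h ha₀ hb₁)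
    exact abs_le.2 ⟨by linarith, by linarith⟩
  · have := abs_le.1 (h ha₂ hb₀); have := abs_le.1 (h ha₁ hb₁); have := abs_le.1 (h ha₀ hb₂)
    exact abs_le.2 ⟨by linarith, by linarith⟩
  · have := abs_le.1 (h ha₃ hb₀); have := abs_le.1 (h ha₂ hb₁); have := abs_le.1 (h ha₁ hb₂)
    have := abs_le.1 (h ha₀ hb₃)
    exact abs_le.2 ⟨by linarith, by linarith⟩

theorem C3Per.sum_lam_sq_le {ℓ A : ℝ} {v v₁ v₂ v₃ : ℝ → ℝ} (h : C3Per ℓ v v₁ v₂ v₃) (hℓ : 0 < ℓ)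
    (h2 : ∀ x ∈ cell ℓ, |v₂ x| ≤ A) (s : Finset ℤ) :
    ∑ k ∈ s, lam ℓ k ^ 2 * ‖fc ℓ v k‖ ^ 2 ≤ A ^ 2 := by
  simpa only [h.norm_fc_two hℓ, mul_pow] using sum_sq_fc_le hℓ h.cont_two h2 s

theorem C3Per.sum_lam_cube_le {ℓ A : ℝ} {v v₁ v₂ v₃ : ℝ → ℝ} (h : C3Per ℓ v v₁ v₂ v₃) (hℓ : 0 < ℓ)
    (h3 : ∀ x ∈ cell ℓ, |v₃ x| ≤ A) (s : Finset ℤ) :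
    ∑ k ∈ s, lam ℓ k ^ 3 * ‖fc ℓ v k‖ ^ 2 ≤ A ^ 2 := by
  simpa only [h.norm_fc_three hℓ] using sum_sq_fc_le hℓ h.cont_three h3 s

theorem C3Per.sum_lam_le {ℓ A : ℝ} {v v₁ v₂ v₃ : ℝ → ℝ} (h : C3Per ℓ v v₁ v₂ v₃) (hℓ : 0 < ℓ)
    (h2 : ∀ x ∈ cell ℓ, |v₂ x| ≤ A) (h3 : ∀ x ∈ cell ℓ, |v₃ x| ≤ A) (s : Finset ℤ) :
    ∑ k ∈ s, lam ℓ k * ‖fc ℓ v k‖ ≤ wienerBound ℓ A := by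
  have := ((h.summable_two hℓ).sum_le_tsum s fun _ _ => norm_nonneg _).trans
    (h.tsum_two_le hℓ h2 h3)
  simpa only [h.norm_fc_two hℓ] using this

/-- Of the dissipation `-6λ⁶|z|²`, one unit pays for the unstable term via `2λ⁵ ≤ λ⁶ + λ⁴` and one
for the product of `z` and `n`. -/
theorem energy_ineq {lm : ℝ} (hl : 0 ≤ lm) (z n : ℂ) :
    lm ^ 4 * (2 * inner ℝ z (-((3 * lm ^ 2 - lm : ℝ) : ℂ) * z + ((-(1 / 2) : ℝ) : ℂ) * n)) ≤
      -4 * (lm ^ 6 * ‖z‖ ^ 2) + (lm ^ 4 * ‖z‖ ^ 2 + lm ^ 2 * ‖n‖ ^ 2) := by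
  have e : inner ℝ z (-((3 * lm ^ 2 - lm : ℝ) : ℂ) * z + ((-(1 / 2) : ℝ) : ℂ) * n)
      = -(3 * lm ^ 2 - lm) * ‖z‖ ^ 2 + -(1 / 2) * inner ℝ z n := by
    rw [inner_add_right, ← Complex.ofReal_neg, ← Complex.real_smul, ← Complex.real_smul,
      real_inner_smul_right, real_inner_smul_right, real_inner_self_eq_norm_sq]
  have h1 : -inner ℝ z n ≤ ‖z‖ * ‖n‖ := (neg_le_abs _).trans (abs_real_inner_le_norm z n)
  have h2 : lm ^ 4 * (-inner ℝ z n) ≤ lm ^ 4 * (‖z‖ * ‖n‖) :=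
    mul_le_mul_of_nonneg_left h1 (by positivity)
  have h3 : 2 * lm ^ 5 ≤ lm ^ 6 + lm ^ 4 := by nlinarith [mul_nonneg (pow_nonneg hl 4) (sq_nonneg (lm - 1))]
  have h4 := mul_le_mul_of_nonneg_right h3 (sq_nonneg ‖z‖)
  have h5 := sq_nonneg (lm ^ 3 * ‖z‖ - lm * ‖n‖ / 2)
  have h6 : 0 ≤ lm ^ 2 * ‖n‖ ^ 2 := by positivity
  rw [e]
  nlinarith

namespace IsKSSolution

variable {ℓ T : ℝ} {Φ₀ : ℝ → ℝ} {Φ : ℝ → ℝ → ℝ}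

theorem c3Per (hΦ : IsKSSolution ℓ T Φ₀ Φ) (hℓ : 0 < ℓ) {τ : ℝ} (hτ : τ ∈ Icc 0 T) :
    C3Per ℓ (Φ τ) (dEta ℓ 1 (Φ τ)) (dEta ℓ 2 (Φ τ)) (dEta ℓ 3 (Φ τ)) :=
  c3Per_self hℓ (hΦ.mem.snd_diff τ hτ) (hΦ.periodic τ hτ)

theorem c3Per_one (hΦ : IsKSSolution ℓ T Φ₀ Φ) (hℓ : 0 < ℓ) {τ : ℝ} (hτ : τ ∈ Icc 0 T) :
    C3Per ℓ (dEta ℓ 1 (Φ τ)) (dEta ℓ 2 (Φ τ)) (dEta ℓ 3 (Φ τ)) (dEta ℓ 4 (Φ τ)) :=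
  c3Per_dEta hℓ (hΦ.mem.snd_diff τ hτ) (hΦ.periodic τ hτ)

theorem fc_dTau (hΦ : IsKSSolution ℓ T Φ₀ Φ) (hℓ : 0 < ℓ) {τ : ℝ} (hτ : τ ∈ Icc 0 T) (k : ℤ) :
    fc ℓ (dTau T Φ τ) k = -((3 * lam ℓ k ^ 2 - lam ℓ k : ℝ) : ℂ) * fc ℓ (Φ τ) k
      + ((-(1 / 2) : ℝ) : ℂ) * fc ℓ (fun x => dEta ℓ 1 (Φ τ) x * dEta ℓ 1 (Φ τ) x) k := by
  have h := hΦ.c3Per hℓ hτ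
  have h1 := hΦ.c3Per_one hℓ hτ
  rw [fc_congr hℓ (g := fun x => (-3 * dEta ℓ 4 (Φ τ) x + -1 * dEta ℓ 2 (Φ τ) x)
    + -(1 / 2) * (dEta ℓ 1 (Φ τ) x * dEta ℓ 1 (Φ τ) x))
    (fun x hx => by rw [hΦ.eqn τ hτ x hx]; ring),
    fc_add hℓ (continuousOn_fun_add (continuousOn_const_mul _ h1.cont_three)
      (continuousOn_const_mul _ h.cont_two)) (continuousOn_const_mul _ (h1.mul h1).cont_zero),
    fc_add hℓ (continuousOn_const_mul _ h1.cont_three) (continuousOn_const_mul _ h.cont_two),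
    fc_const_mul, fc_const_mul, fc_const_mul, h.fc_two hℓ,
    fc_dEta_four hℓ (hΦ.mem.snd_diff τ hτ) (hΦ.periodic τ hτ)]
  push_cast
  ring

theorem continuousOn_fc_sq (hΦ : IsKSSolution ℓ T Φ₀ Φ) (hℓ : 0 < ℓ) (k : ℤ) :
    ContinuousOn (fun τ => fc ℓ (fun x => dEta ℓ 1 (Φ τ) x * dEta ℓ 1 (Φ τ) x) k) (Icc 0 T) := by
  have h := hΦ.mem.continuousOn_dEta_uncurry (j := 1) (by norm_num)
  exact continuousOn_fc hℓ (f := fun τ x => dEta ℓ 1 (Φ τ) x * dEta ℓ 1 (Φ τ) x) (h.mul h) k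

theorem continuousOn_fc_self (hΦ : IsKSSolution ℓ T Φ₀ Φ) (hℓ : 0 < ℓ) (k : ℤ) :
    ContinuousOn (fun τ => fc ℓ (Φ τ) k) (Icc 0 T) :=
  continuousOn_fc hℓ hΦ.mem.continuousOn_uncurry k

theorem continuousOn_fc_dTau (hΦ : IsKSSolution ℓ T Φ₀ Φ) (hℓ : 0 < ℓ) (k : ℤ) :
    ContinuousOn (fun τ => fc ℓ (dTau T Φ τ) k) (Icc 0 T) :=
  continuousOn_fc hℓ hΦ.mem.continuousOn_dTau k

theorem hasDerivAt_fc (hΦ : IsKSSolution ℓ T Φ₀ Φ) (hℓ : 0 < ℓ) {τ : ℝ} (hτ : τ ∈ Ioo 0 T)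
    (k : ℤ) : HasDerivAt (fun s => fc ℓ (Φ s) k)
      (-((3 * lam ℓ k ^ 2 - lam ℓ k : ℝ) : ℂ) * fc ℓ (Φ τ) k
        + ((-(1 / 2) : ℝ) : ℂ) * fc ℓ (fun x => dEta ℓ 1 (Φ τ) x * dEta ℓ 1 (Φ τ) x) k) τ := by
  rw [← hΦ.fc_dTau hℓ (Ioo_subset_Icc_self hτ)]
  exact hΦ.mem.hasDerivAt_fc hℓ hτ k

theorem sum_lam_four_le (hΦ : IsKSSolution ℓ T Φ₀ Φ) (hℓ : 0 < ℓ) {K : ℝ}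
    (hK : ∀ j ≤ 4, ∀ τ ∈ Icc 0 T, ∀ η ∈ cell ℓ, |dEta ℓ j (Φ τ) η| ≤ K) {τ : ℝ}
    (hτ : τ ∈ Icc 0 T) (s : Finset ℤ) : ∑ k ∈ s, lam ℓ k ^ 4 * ‖fc ℓ (Φ τ) k‖ ^ 2 ≤ K ^ 2 := by
  refine le_of_eq_of_le (Finset.sum_congr rfl fun k _ => ?_)
    (sum_sq_fc_le hℓ (hΦ.c3Per_one hℓ hτ).cont_three (hK 4 le_rfl τ hτ) s)
  rw [fc_dEta_four hℓ (hΦ.mem.snd_diff τ hτ) (hΦ.periodic τ hτ), norm_mul, mul_pow, norm_pow,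
    Complex.norm_real, Real.norm_eq_abs, ← pow_mul, ← abs_pow, abs_of_nonneg]
  have := lam_nonneg ℓ k
  positivity

theorem abs_sq_derivs_le {K : ℝ}
    (hK : ∀ j ≤ 4, ∀ τ ∈ Icc 0 T, ∀ η ∈ cell ℓ, |dEta ℓ j (Φ τ) η| ≤ K) {τ : ℝ}
    (hτ : τ ∈ Icc 0 T) {η : ℝ} (hη : η ∈ cell ℓ) :
    let v := fun j => dEta ℓ j (Φ τ) η
    |v 1 * v 1| ≤ 8 * (K * K) ∧ |v 2 * v 1 + v 1 * v 2| ≤ 8 * (K * K) ∧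
      |v 3 * v 1 + 2 * (v 2 * v 2) + v 1 * v 3| ≤ 8 * (K * K) ∧
      |v 4 * v 1 + 3 * (v 3 * v 2) + 3 * (v 2 * v 3) + v 1 * v 4| ≤ 8 * (K * K) :=
  abs_mul_derivs_le (hK 1 (by norm_num) τ hτ η hη) (hK 2 (by norm_num) τ hτ η hη)
    (hK 3 (by norm_num) τ hτ η hη) (hK 4 le_rfl τ hτ η hη) (hK 1 (by norm_num) τ hτ η hη)
    (hK 2 (by norm_num) τ hτ η hη) (hK 3 (by norm_num) τ hτ η hη) (hK 4 le_rfl τ hτ η hη)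

/-- Parabolic gain: testing with weight `λ⁴` turns four bounded derivatives into six that are square
integrable in time, and the equation transfers this to two derivatives of `Φ_τ`. The bound is
uniform in `s`, which is all that the estimate for `ρ` needs. -/
theorem exists_integral_bound (hΦ : IsKSSolution ℓ T Φ₀ Φ) (hℓ : 0 < ℓ) :
    ∃ A : ℝ, ∀ t ∈ Icc 0 T, ∀ s : Finset ℤ,
      ∫ r in (0 : ℝ)..t, ∑ k ∈ s, (lam ℓ k ^ 4 * ‖fc ℓ (Φ r) k‖ ^ 2
        + lam ℓ k ^ 2 * ‖fc ℓ (dTau T Φ r) k‖ ^ 2) ≤ A := by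
  obtain ⟨K, hK0, hK⟩ := hΦ.mem.exists_bound
  -- By Parseval, `K²` bounds the mean square of `Φ_ηηηη` and `(8K²)²` that of the second derivative
  -- of `(Φ_η)²`.
  obtain ⟨D, hD⟩ : ∃ D, D = K ^ 2 + (8 * (K * K)) ^ 2 := ⟨_, rfl⟩
  refine ⟨27 * (K ^ 2 + T * D) + 4 * (T * D), fun t ht s => ?_⟩
  have hT0 : 0 ≤ T := ht.1.trans ht.2
  have hsub : Icc 0 t ⊆ Icc 0 T := Icc_subset_Icc_right ht.2
  obtain ⟨n, hn⟩ : ∃ n : ℤ → ℝ → ℂ, n = fun k r =>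
    fc ℓ (fun x => dEta ℓ 1 (Φ r) x * dEta ℓ 1 (Φ r) x) k := ⟨_, rfl⟩
  have hnc : ∀ k, ContinuousOn (n k) (Icc 0 T) := fun k => hn ▸ hΦ.continuousOn_fc_sq hℓ k
  have hzc := hΦ.continuousOn_fc_self hℓ
  have cu : ContinuousOn (fun r => ∑ k ∈ s, lam ℓ k ^ 6 * ‖fc ℓ (Φ r) k‖ ^ 2) (Icc 0 T) :=
    continuousOn_finsetSum s fun k _ => continuousOn_const_mul _ ((hzc k).norm.pow 2)
  have cq : ∀ k, ContinuousOn (fun r => lam ℓ k ^ 4 * ‖fc ℓ (Φ r) k‖ ^ 2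
      + lam ℓ k ^ 2 * ‖n k r‖ ^ 2) (Icc 0 T) := fun k =>
    (continuousOn_const_mul _ ((hzc k).norm.pow 2)).add
      (continuousOn_const_mul _ ((hnc k).norm.pow 2))
  have cqs : ContinuousOn (fun r => ∑ k ∈ s, (lam ℓ k ^ 4 * ‖fc ℓ (Φ r) k‖ ^ 2
      + lam ℓ k ^ 2 * ‖n k r‖ ^ 2)) (Icc 0 T) := continuousOn_finsetSum s fun k _ => cq k
  have cR : ∀ k, ContinuousOn (fun r => -4 * (lam ℓ k ^ 6 * ‖fc ℓ (Φ r) k‖ ^ 2)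
      + (lam ℓ k ^ 4 * ‖fc ℓ (Φ r) k‖ ^ 2 + lam ℓ k ^ 2 * ‖n k r‖ ^ 2)) (Icc 0 T) := fun k =>
    (continuousOn_const_mul _ (continuousOn_const_mul _ ((hzc k).norm.pow 2))).add (cq k)
  have hii : ∀ {R : ℝ → ℝ}, ContinuousOn R (Icc 0 T) → IntervalIntegrable R volume 0 t :=
    fun hR => ContinuousOn.intervalIntegrable (by rw [uIcc_of_le ht.1]; exact hR.mono hsub)
  have hq : ∀ r ∈ Icc 0 T, ∑ k ∈ s, (lam ℓ k ^ 4 * ‖fc ℓ (Φ r) k‖ ^ 2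
      + lam ℓ k ^ 2 * ‖n k r‖ ^ 2) ≤ D := by
    intro r hr
    rw [Finset.sum_add_distrib, hD]
    refine add_le_add (hΦ.sum_lam_four_le hℓ hK hr s) ?_
    have h1 := hΦ.c3Per_one hℓ hr
    rw [hn]
    exact (h1.mul h1).sum_lam_sq_le hℓ (fun x hx => (abs_sq_derivs_le hK hr hx).2.2.1) s
  have hD0 : 0 ≤ D := by rw [hD]; positivity
  have hqi : ∫ r in (0 : ℝ)..t, ∑ k ∈ s, (lam ℓ k ^ 4 * ‖fc ℓ (Φ r) k‖ ^ 2
      + lam ℓ k ^ 2 * ‖n k r‖ ^ 2) ≤ T * D := by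
    refine (intervalIntegral.integral_mono_on ht.1 (hii cqs) intervalIntegrable_const
      fun r hr => hq r (hsub hr)).trans ?_
    rw [intervalIntegral.integral_const, sub_zero, smul_eq_mul]
    exact mul_le_mul_of_nonneg_right ht.2 hD0
  have hu : 4 * ∫ r in (0 : ℝ)..t, ∑ k ∈ s, lam ℓ k ^ 6 * ‖fc ℓ (Φ r) k‖ ^ 2 ≤ K ^ 2 + T * D := by
    have hk : ∀ k ∈ s, 0 ≤ lam ℓ k ^ 4 * ‖fc ℓ (Φ 0) k‖ ^ 2
        + ∫ r in (0 : ℝ)..t, (-4 * (lam ℓ k ^ 6 * ‖fc ℓ (Φ r) k‖ ^ 2)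
          + (lam ℓ k ^ 4 * ‖fc ℓ (Φ r) k‖ ^ 2 + lam ℓ k ^ 2 * ‖n k r‖ ^ 2)) := by
      intro k _
      refine le_trans ?_ (norm_sq_le_add_integral (w := lam ℓ k ^ 4) (hzc k)
        (fun t ht => hΦ.hasDerivAt_fc hℓ ht k)
        (cR k) (fun t ht => ?_) ht)
      · have := lam_nonneg ℓ k
        positivity
      · rw [hn]; exact energy_ineq (lam_nonneg ℓ k) _ _
    have hsum := Finset.sum_nonneg hk
    rw [Finset.sum_add_distrib, ← intervalIntegral.integral_finsetSum (fun k _ => hii (cR k))]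
      at hsum
    simp only [Finset.sum_add_distrib (f := fun k => -4 * (lam ℓ k ^ 6 * ‖fc ℓ (Φ _) k‖ ^ 2)),
      ← Finset.mul_sum (a := (-4 : ℝ))] at hsum
    rw [intervalIntegral.integral_add (hii (continuousOn_const_mul _ cu)) (hii cqs),
      intervalIntegral.integral_const_mul] at hsum
    linarith [hΦ.sum_lam_four_le hℓ hK ⟨le_rfl, hT0⟩ s]
  -- Here `27 = 3 · 3²` from the square of a three-term sum with leading coefficient 3, and `4 = 3 +
  -- 1` adds the term already present.
  have hfin : ∀ r ∈ Icc 0 t, ∑ k ∈ s, (lam ℓ k ^ 4 * ‖fc ℓ (Φ r) k‖ ^ 2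
        + lam ℓ k ^ 2 * ‖fc ℓ (dTau T Φ r) k‖ ^ 2) ≤
      27 * ∑ k ∈ s, lam ℓ k ^ 6 * ‖fc ℓ (Φ r) k‖ ^ 2 +
      4 * ∑ k ∈ s, (lam ℓ k ^ 4 * ‖fc ℓ (Φ r) k‖ ^ 2 + lam ℓ k ^ 2 * ‖n k r‖ ^ 2) := by
    intro r hr
    rw [Finset.mul_sum, Finset.mul_sum, ← Finset.sum_add_distrib]
    refine Finset.sum_le_sum fun k _ => ?_
    have hl := lam_nonneg ℓ k
    have e : fc ℓ (dTau T Φ r) k = -(3 * lam ℓ k ^ 2 : ℝ) * fc ℓ (Φ r) k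
        + (lam ℓ k : ℝ) * fc ℓ (Φ r) k + ((-(1 / 2) : ℝ) : ℂ) * n k r := by
      rw [hΦ.fc_dTau hℓ (hsub hr), hn]; push_cast; ring
    have hnorm : ‖fc ℓ (dTau T Φ r) k‖ ≤ 3 * lam ℓ k ^ 2 * ‖fc ℓ (Φ r) k‖
        + lam ℓ k * ‖fc ℓ (Φ r) k‖ + 1 / 2 * ‖n k r‖ := by
      rw [e]
      refine (norm_add₃_le).trans_eq ?_
      rw [norm_mul, norm_mul, norm_mul, norm_neg, Complex.norm_real, Complex.norm_real,
        Complex.norm_real, Real.norm_of_nonneg (by positivity), Real.norm_of_nonneg hl]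
      norm_num
    have h2 := pow_le_pow_left₀ (norm_nonneg _) hnorm 2
    obtain ⟨x, hx⟩ : ∃ x, x = ‖fc ℓ (Φ r) k‖ := ⟨_, rfl⟩
    obtain ⟨y, hy⟩ : ∃ y, y = ‖n k r‖ := ⟨_, rfl⟩
    rw [← hx, ← hy] at h2 ⊢
    have h3 : (3 * lam ℓ k ^ 2 * x + lam ℓ k * x + 1 / 2 * y) ^ 2
        ≤ 3 * ((3 * lam ℓ k ^ 2 * x) ^ 2 + (lam ℓ k * x) ^ 2 + (1 / 2 * y) ^ 2) := by
      nlinarith [sq_nonneg (3 * lam ℓ k ^ 2 * x - lam ℓ k * x),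
        sq_nonneg (3 * lam ℓ k ^ 2 * x - 1 / 2 * y), sq_nonneg (lam ℓ k * x - 1 / 2 * y)]
    have h4 := mul_le_mul_of_nonneg_left (h2.trans h3) (pow_nonneg hl 2)
    have h5 : 0 ≤ lam ℓ k ^ 2 * y ^ 2 := by positivity
    nlinarith
  refine (intervalIntegral.integral_mono_on ht.1 (hii ?_) (hii
    (continuousOn_fun_add (continuousOn_const_mul 27 cu) (continuousOn_const_mul 4 cqs))) hfin).trans ?_
  · exact continuousOn_finsetSum s fun k _ =>
      (continuousOn_const_mul _ ((hzc k).norm.pow 2)).add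
        (continuousOn_const_mul _ ((hΦ.continuousOn_fc_dTau hℓ k).norm.pow 2))
  · rw [intervalIntegral.integral_add (hii (continuousOn_const_mul _ cu))
      (hii (continuousOn_const_mul _ cqs)), intervalIntegral.integral_const_mul,
      intervalIntegral.integral_const_mul]
    have : 0 ≤ K ^ 2 + T * D := by positivity
    linarith

/-- For `τ ≥ δ` the smoothing bound makes `∑ λ³|Φ_k|` finite. Through the equation `∑ λ|(Φ_τ)_k|` is
finite too, so `Φ_τηη` is the sum of an absolutely convergent Fourier series. -/
theorem exists_fourierData_dTau (hΦ : IsKSSolution ℓ T Φ₀ Φ) (hℓ : 0 < ℓ) {δ : ℝ} (hδ : 0 < δ) :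
    ∃ B : ℝ, ∀ τ ∈ Icc δ T,
      FourierData ℓ (dEta ℓ 2 (dTau T Φ τ)) (fun k => -lam ℓ k * fc ℓ (dTau T Φ τ) k) B ∧
      (Summable fun k => ‖fc ℓ (dEta ℓ 2 (dTau T Φ τ)) k‖) ∧
      ∑' k, ‖fc ℓ (dEta ℓ 2 (dTau T Φ τ)) k‖ ≤ B := by
  obtain ⟨K, hK0, hK⟩ := hΦ.mem.exists_bound
  obtain ⟨n, hn⟩ : ∃ n : ℤ → ℝ → ℂ, n = fun k r =>
    fc ℓ (fun x => dEta ℓ 1 (Φ r) x * dEta ℓ 1 (Φ r) x) k := ⟨_, rfl⟩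
  have hnorm : ∀ k r, ‖((-(1 / 2) : ℝ) : ℂ) * n k r‖ = 1 / 2 * ‖n k r‖ := fun k r => by
    rw [norm_mul, Complex.norm_real]; norm_num
  have hlz : ∀ t ∈ Icc 0 T, ∀ s : Finset ℤ, ∑ k ∈ s, lam ℓ k * ‖fc ℓ (Φ t) k‖ ≤ wienerBound ℓ K :=
    fun t ht s => (hΦ.c3Per hℓ ht).sum_lam_le hℓ (hK 2 (by norm_num) t ht)
      (hK 3 (by norm_num) t ht) s
  have hln : ∀ t ∈ Icc 0 T, ∀ s : Finset ℤ,
      ∑ k ∈ s, lam ℓ k * ‖n k t‖ ≤ wienerBound ℓ (8 * (K * K)) := fun t ht s => by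
    have h1 := hΦ.c3Per_one hℓ ht
    rw [hn]
    exact (h1.mul h1).sum_lam_le hℓ (fun x hx => (abs_sq_derivs_le hK ht hx).2.2.1)
      (fun x hx => (abs_sq_derivs_le hK ht hx).2.2.2) s
  obtain ⟨B, hB⟩ := KSFront.sum_lam_cube_le (ℓ := ℓ) (T := T) (z := fun k t => fc ℓ (Φ t) k)
    (m := fun k t => ((-(1 / 2) : ℝ) : ℂ) * n k t) (A := wienerBound ℓ K)
    (C := (8 * (K * K)) ^ 2)
    (hΦ.continuousOn_fc_self hℓ)
    (fun k => continuousOn_const.mul (hn ▸ hΦ.continuousOn_fc_sq hℓ k))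
    (fun k t ht => by rw [hn]; exact hΦ.hasDerivAt_fc hℓ ht k) hlz
    (fun t ht s => by
      have h1 := hΦ.c3Per_one hℓ ht
      refine le_trans (Finset.sum_le_sum fun k _ => ?_) ((h1.mul h1).sum_lam_cube_le hℓ
        (fun x hx => (abs_sq_derivs_le hK ht hx).2.2.2) s)
      refine mul_le_mul_of_nonneg_left (pow_le_pow_left₀ (norm_nonneg _) ?_ 2)
        (pow_nonneg (lam_nonneg ℓ k) 3)
      rw [hnorm, hn]
      linarith [norm_nonneg (fc ℓ (fun x => dEta ℓ 1 (Φ t) x * dEta ℓ 1 (Φ t) x) k)]) hδ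
  refine ⟨4 * B + wienerBound ℓ K + wienerBound ℓ (8 * (K * K)), fun τ hτ => ?_⟩
  have hτ' : τ ∈ Icc 0 T := ⟨hδ.le.trans hτ.1, hτ.2⟩
  have hnm : ∀ k, ‖fc ℓ (dTau T Φ τ) k‖ ≤ 3 * lam ℓ k ^ 2 * ‖fc ℓ (Φ τ) k‖
      + lam ℓ k * ‖fc ℓ (Φ τ) k‖ + ‖n k τ‖ := fun k => by
    have hl := lam_nonneg ℓ k
    have e : fc ℓ (dTau T Φ τ) k = -(3 * lam ℓ k ^ 2 : ℝ) * fc ℓ (Φ τ) k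
        + (lam ℓ k : ℝ) * fc ℓ (Φ τ) k + ((-(1 / 2) : ℝ) : ℂ) * n k τ := by
      rw [hΦ.fc_dTau hℓ hτ', hn]; push_cast; ring
    rw [e]
    refine norm_add₃_le.trans ?_
    rw [hnorm, norm_mul, norm_mul, norm_neg, Complex.norm_real, Complex.norm_real,
      Real.norm_of_nonneg (by positivity), Real.norm_of_nonneg hl]
    linarith [norm_nonneg (n k τ)]
  have hsq : ∀ k, lam ℓ k ^ 2 ≤ lam ℓ k + lam ℓ k ^ 3 := fun k => by
    have hl := lam_nonneg ℓ k
    nlinarith [mul_nonneg hl (sq_nonneg (lam ℓ k - 1))]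
  have s1 : Summable fun k => lam ℓ k * ‖fc ℓ (Φ τ) k‖ :=
    summable_of_sum_le (fun k => mul_nonneg (lam_nonneg ℓ k) (norm_nonneg _)) (hlz τ hτ')
  have s3 : Summable fun k => lam ℓ k ^ 3 * ‖fc ℓ (Φ τ) k‖ :=
    summable_of_sum_le (fun k => mul_nonneg (pow_nonneg (lam_nonneg ℓ k) 3) (norm_nonneg _))
      (hB τ hτ)
  have sn : Summable fun k => ‖n k τ‖ := by
    have h1 := hΦ.c3Per_one hℓ hτ'
    rw [hn]
    exact (h1.mul h1).summable_zero hℓ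
  have hd : Summable fun k => ‖fc ℓ (dTau T Φ τ) k‖ := by
    refine Summable.of_nonneg_of_le (fun _ => norm_nonneg _) (fun k => ?_)
      (((s1.mul_left 4).add (s3.mul_left 3)).add sn)
    have := mul_le_mul_of_nonneg_right (hsq k) (norm_nonneg (fc ℓ (Φ τ) k))
    linarith [hnm k]
  have hsum : ∀ s : Finset ℤ, ∑ k ∈ s, lam ℓ k * ‖fc ℓ (dTau T Φ τ) k‖
      ≤ 4 * B + wienerBound ℓ K + wienerBound ℓ (8 * (K * K)) := by
    intro s
    calc _ ≤ ∑ k ∈ s, (4 * (lam ℓ k ^ 3 * ‖fc ℓ (Φ τ) k‖) + lam ℓ k * ‖fc ℓ (Φ τ) k‖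
          + lam ℓ k * ‖n k τ‖) := Finset.sum_le_sum fun k _ => by
          have h := mul_le_mul_of_nonneg_left (hnm k) (lam_nonneg ℓ k)
          have := mul_le_mul_of_nonneg_right (hsq k) (norm_nonneg (fc ℓ (Φ τ) k))
          linarith
      _ ≤ _ := by
          rw [Finset.sum_add_distrib, Finset.sum_add_distrib, ← Finset.mul_sum]
          exact add_le_add (add_le_add (mul_le_mul_of_nonneg_left (hB τ hτ s) (by norm_num))
            (hlz τ hτ' s)) (hln τ hτ' s)
  have hnn : ∀ k, ‖-(lam ℓ k : ℂ) * fc ℓ (dTau T Φ τ) k‖ = lam ℓ k * ‖fc ℓ (dTau T Φ τ) k‖ :=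
    fun k => by
      rw [norm_mul, norm_neg, Complex.norm_real, Real.norm_of_nonneg (lam_nonneg ℓ k)]
  have hn0 : ∀ k, 0 ≤ lam ℓ k * ‖fc ℓ (dTau T Φ τ) k‖ := fun k =>
    mul_nonneg (lam_nonneg ℓ k) (norm_nonneg _)
  have hd2 : Summable fun k => lam ℓ k * ‖fc ℓ (dTau T Φ τ) k‖ := summable_of_sum_le hn0 hsum
  have hd2' : Summable fun k => ‖-(lam ℓ k : ℂ) * fc ℓ (dTau T Φ τ) k‖ := by
    simpa only [hnn] using hd2
  have ht : ∑' k, ‖-(lam ℓ k : ℂ) * fc ℓ (dTau T Φ τ) k‖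
      ≤ 4 * B + wienerBound ℓ K + wienerBound ℓ (8 * (K * K)) := by
    simp only [hnn]
    exact hd2.tsum_le_of_sum_le hsum
  have hfd := fourierData_of_hasSum hℓ hd2' ht (hasSum_dEta_two hℓ hd hd2 fun η hη =>
    hasSum_fc hℓ (ContinuousOn.uncurry_left' hΦ.mem.continuousOn_dTau hτ') hd hη)
  refine ⟨hfd, ?_, ?_⟩
  · simpa only [hfd.coef] using hd2'
  · simpa only [hfd.coef] using ht

end IsKSSolution

/-! ### The equation for the remainder, mode by mode -/

/-- The Fourier coefficients of `v_η w_η`. -/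
def fcGrad (ℓ : ℝ) (v w : ℝ → ℝ) (k : ℤ) : ℂ := fc ℓ (fun x => dEta ℓ 1 v x * dEta ℓ 1 w x) k

/-- The part of the right-hand side of the equation for the remainder that does not come from
`𝒮_ε(ρ)`, in Fourier coefficients. -/
def forcing (ℓ ε T : ℝ) (Φ ρ : ℝ → ℝ → ℝ) (τ : ℝ) (k : ℤ) : ℂ :=
  -fcGrad ℓ (Φ τ) (ρ τ) k - (ε / 2 : ℝ) * fcGrad ℓ (ρ τ) (ρ τ) k
    + symG ε (lam ℓ k) * (fcGrad ℓ (Φ τ) (Φ τ) k + (2 * ε : ℝ) * fcGrad ℓ (Φ τ) (ρ τ) k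
      + (ε ^ 2 : ℝ) * fcGrad ℓ (ρ τ) (ρ τ) k)
    + (symH ε (lam ℓ k) * fc ℓ (Φ τ) k + symHτ ε (lam ℓ k) * fc ℓ (dTau T Φ τ) k)

theorem C3Per.fc_mul_self_add {ℓ : ℝ} {v v₁ v₂ v₃ w w₁ w₂ w₃ : ℝ → ℝ} (h : C3Per ℓ v v₁ v₂ v₃)
    (g : C3Per ℓ w w₁ w₂ w₃) (hℓ : 0 < ℓ) (c : ℝ) (k : ℤ) :
    fc ℓ (fun x => (v x + c * w x) * (v x + c * w x)) k = fc ℓ (fun x => v x * v x) k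
      + (2 * c : ℝ) * fc ℓ (fun x => v x * w x) k + (c ^ 2 : ℝ) * fc ℓ (fun x => w x * w x) k := by
  have e : (fun x => (v x + c * w x) * (v x + c * w x)) = fun x => (v x * v x
      + (2 * c) * (v x * w x)) + c ^ 2 * (w x * w x) := funext fun x => by ring
  rw [e, fc_add hℓ (continuousOn_fun_add (h.mul h).cont_zero
    (continuousOn_const_mul _ (h.mul g).cont_zero)) (continuousOn_const_mul _ (g.mul g).cont_zero),
    fc_add hℓ (h.mul h).cont_zero (continuousOn_const_mul _ (h.mul g).cont_zero), fc_const_mul,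
    fc_const_mul]

section Remainder

variable {ℓ ε T : ℝ} {Φ₀ : ℝ → ℝ} {Φ ρ : ℝ → ℝ → ℝ}

theorem exists_fourierData_rhs (hℓ : 0 < ℓ) (hε : 0 < ε) (hΦ : IsKSSolution ℓ T Φ₀ Φ)
    (hρ : MemC 1 4 (Icc 0 T) (cell ℓ) ρ) (hρp : ∀ τ ∈ Icc 0 T, PeriodicUpTo ℓ 3 (ρ τ))
    {δ : ℝ} (hδ : 0 < δ) :
    ∃ B : ℝ, ∀ τ ∈ Icc δ T, FourierData ℓ (fun η => opS ℓ ε (ρ τ) η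
        - dEta ℓ 1 (Φ τ) η * dEta ℓ 1 (ρ τ) η - ε / 2 * (dEta ℓ 1 (ρ τ) η) ^ 2
        + opG ℓ ε (fun y => (dEta ℓ 1 (Φ τ) y + ε * dEta ℓ 1 (ρ τ) y) ^ 2) η
        + opH ℓ ε T Φ τ η)
      (fun k => symS ε (lam ℓ k) * fc ℓ (ρ τ) k + forcing ℓ ε T Φ ρ τ k) B := by
  obtain ⟨K, hK0, hK⟩ := hΦ.mem.exists_bound
  obtain ⟨L, hL0, hL⟩ := hρ.exists_bound
  obtain ⟨D, hD⟩ := hΦ.exists_fourierData_dTau hℓ hδ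
  -- The bound is left as a metavariable, fixed by unification with the sum of the bounds below;
  -- being introduced before `τ`, it cannot depend on it.
  apply Exists.intro
  intro τ hτ
  have hτ' : τ ∈ Icc 0 T := ⟨hδ.le.trans hτ.1, hτ.2⟩
  have hS := fourierData_opS hℓ hε (hρ.snd_diff τ hτ') (hρp τ hτ') (fun j hj => hL j hj τ hτ')
  have h1 := hΦ.c3Per_one hℓ hτ'
  have g1 := c3Per_dEta hℓ (hρ.snd_diff τ hτ') (hρp τ hτ')
  have c1 := h1.add_const_mul g1 ε
  have hM : ∀ j ≤ 4, ∀ x ∈ cell ℓ, |dEta ℓ j (Φ τ) x + ε * dEta ℓ j (ρ τ) x| ≤ K + ε * L :=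
    fun j hj x hx => (abs_add_le _ _).trans (add_le_add (hK j hj τ hτ' x hx) (by
      rw [abs_mul, abs_of_pos hε]; exact mul_le_mul_of_nonneg_left (hL j hj τ hτ' x hx) hε.le))
  have hb : ∀ x (hx : x ∈ cell ℓ), _ := fun x hx => abs_mul_derivs_le
    (hM 1 (by norm_num) x hx) (hM 2 (by norm_num) x hx) (hM 3 (by norm_num) x hx)
    (hM 4 le_rfl x hx) (hM 1 (by norm_num) x hx) (hM 2 (by norm_num) x hx)
    (hM 3 (by norm_num) x hx) (hM 4 le_rfl x hx)
  have hG := (c1.mul c1).fourierData_opG hℓ hε (fun x hx => (hb x hx).1)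
    (fun x hx => (hb x hx).2.1) (fun x hx => (hb x hx).2.2.1) (fun x hx => (hb x hx).2.2.2)
  have hH := fourierData_opH hℓ hε (hΦ.mem.snd_diff τ hτ') (hΦ.periodic τ hτ')
    (fun j hj => hK j hj τ hτ') (hD τ hτ).1 (hD τ hτ).2.1 (hD τ hτ).2.2
  have hP := (h1.mul g1).fourierData_zero (A := K * L) fun x hx => by
    rw [abs_mul]
    exact mul_le_mul (hK 1 (by norm_num) τ hτ' x hx) (hL 1 (by norm_num) τ hτ' x hx)
      (abs_nonneg _) hK0
  have hR := (g1.mul g1).fourierData_zero (A := L * L) fun x hx => by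
    rw [abs_mul]
    exact mul_le_mul (hL 1 (by norm_num) τ hτ' x hx) (hL 1 (by norm_num) τ hτ' x hx)
      (abs_nonneg _) hL0
  refine ((((hS.add (hP.const_mul (-1)) hℓ).add (hR.const_mul (-(ε / 2))) hℓ).add hG hℓ).add hH
    hℓ).congr hℓ (fun η _ => ?_) fun k => ?_
  · have e : (fun y => (dEta ℓ 1 (Φ τ) y + ε * dEta ℓ 1 (ρ τ) y) ^ 2) = fun y =>
        (dEta ℓ 1 (Φ τ) y + ε * dEta ℓ 1 (ρ τ) y) * (dEta ℓ 1 (Φ τ) y + ε * dEta ℓ 1 (ρ τ) y) :=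
      funext fun y => pow_two _
    rw [e]
    ring
  · rw [h1.fc_mul_self_add g1 hℓ, forcing, fcGrad, fcGrad, fcGrad]
    push_cast
    ring

/-- The pointwise equation is integrated against an exponential, with domination on `(τ/2, T)` since
the right-hand side is controlled away from `τ = 0`. Division by `symB ≥ 1` leaves an explicit ODE
for each coefficient of `ρ`. -/
theorem hasDerivAt_fc_remainder (hℓ : 0 < ℓ) (hε : 0 < ε) (hΦ : IsKSSolution ℓ T Φ₀ Φ)
    (hρ : MemC 1 4 (Icc 0 T) (cell ℓ) ρ) (hρp : ∀ τ ∈ Icc 0 T, PeriodicUpTo ℓ 3 (ρ τ))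
    (heq : SolvesRemainderEq ℓ ε T Φ ρ) {τ : ℝ} (hτ : τ ∈ Ioo 0 T) (k : ℤ) :
    HasDerivAt (fun s => fc ℓ (ρ s) k) (((symB ε (lam ℓ k))⁻¹ : ℝ) *
      (symS ε (lam ℓ k) * fc ℓ (ρ τ) k + forcing ℓ ε T Φ ρ τ k)) τ := by
  obtain ⟨B, hB⟩ := exists_fourierData_rhs hℓ hε hΦ hρ hρp (half_pos hτ.1)
  obtain ⟨L, hL0, hL⟩ := hρ.exists_bound
  have hS : Ioo (τ / 2) T ∈ nhds τ := Ioo_mem_nhds (by linarith [hτ.1]) hτ.2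
  have hsub : ∀ s ∈ Ioo (τ / 2) T, s ∈ Ioo 0 T := fun s hs => ⟨by linarith [hs.1, hτ.1], hs.2⟩
  have hBd : ∀ s ∈ Icc 0 T, ∃ C, FourierData ℓ (opB ℓ ε (ρ s))
      (fun k => symB ε (lam ℓ k) * fc ℓ (ρ s) k) C := fun s hs => by
    have h := c3Per_self hℓ (hρ.snd_diff s hs) (hρp s hs)
    refine ⟨_, h.fourierData_opB hℓ hε (fun x hx => ?_) (hL 2 (by norm_num) s hs)
      (hL 3 (by norm_num) s hs)⟩
    simpa only [dEta_zero] using hL 0 (by norm_num) s hs x hx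
  have hτ2 : τ ∈ Icc (τ / 2) T := ⟨by linarith [hτ.1], hτ.2.le⟩
  have h := hasDerivAt_fc hℓ hS (f := fun s => opB ℓ ε (ρ s))
    (fun s hs => (hBd s (Ioo_subset_Icc_self (hsub s hs))).choose_spec.cont) (hB τ hτ2).cont
    (fun s hs η hη => (heq s (Ioo_subset_Icc_self (hsub s hs)) η hη).hasDerivAt
      (Icc_mem_nhds (hsub s hs).1 hs.2))
    (fun s hs η hη => (hB s (Ioo_subset_Icc_self hs)).bound η hη) k
  rw [(hB τ hτ2).coef] at h
  have hb : (symB ε (lam ℓ k) : ℂ) ≠ 0 := by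
    have := one_le_symB hε.le (lam_nonneg ℓ k)
    exact_mod_cast (by linarith : symB ε (lam ℓ k) ≠ 0)
  have h2 := h.const_mul (((symB ε (lam ℓ k))⁻¹ : ℝ) : ℂ)
  refine h2.congr_of_eventuallyEq ?_
  filter_upwards [hS] with s hs
  rw [(hBd s (Ioo_subset_Icc_self (hsub s hs))).choose_spec.coef, Complex.ofReal_inv, inv_mul_cancel_left₀ hb]

end Remainder

/-! ### A nonlinear Gronwall inequality -/

/-- Under the hypothesis `(C + c ∫₀^r E) e^{-cr}` is nonincreasing. -/
theorem le_exp_of_le_add_integral {c C t : ℝ} (hc : 0 ≤ c) (ht : 0 ≤ t) {E : ℝ → ℝ}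
    (hE : Continuous E) (h : ∀ r ∈ Icc 0 t, E r ≤ C + c * ∫ s in (0 : ℝ)..r, E s) :
    E t ≤ C * Real.exp (c * t) := by
  have hd : ∀ r, HasDerivAt (fun r => (C + c * ∫ s in (0 : ℝ)..r, E s) * Real.exp (-(c * r)))
      (c * E r * Real.exp (-(c * r))
        + (C + c * ∫ s in (0 : ℝ)..r, E s) * (Real.exp (-(c * r)) * -(c * 1))) r := fun r =>
    (((hE.integral_hasStrictDerivAt 0 r).hasDerivAt.const_mul c).const_add C).mul
      (((hasDerivAt_id' r).const_mul c).neg.exp)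
  have hanti : AntitoneOn (fun r => (C + c * ∫ s in (0 : ℝ)..r, E s) * Real.exp (-(c * r)))
      (Icc 0 t) := by
    refine antitoneOn_of_deriv_nonpos (convex_Icc 0 t)
      (fun r _ => (hd r).continuousAt.continuousWithinAt)
      (fun r _ => (hd r).differentiableAt.differentiableWithinAt) fun r hr => ?_
    rw [interior_Icc] at hr
    rw [(hd r).deriv]
    have h1 := mul_le_mul_of_nonneg_left (h r (Ioo_subset_Icc_self hr))
      (mul_nonneg hc (Real.exp_pos (-(c * r))).le)
    linarith
  have h0 := hanti (left_mem_Icc.2 ht) (right_mem_Icc.2 ht) ht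
  simp only [intervalIntegral.integral_same, mul_zero, add_zero, neg_zero, Real.exp_zero,
    mul_one] at h0
  rw [Real.exp_neg, ← div_eq_mul_inv, div_le_iff₀ (Real.exp_pos _)] at h0
  exact (h t (right_mem_Icc.2 ht)).trans h0

/-- Continuation: before the first time at which `E` reaches `M`, `κE² ≤ κME ≤ E`, so the linear
Gronwall inequality with rate `c + 1` holds and keeps `E` strictly below `M` at that time. -/
theorem le_of_le_add_integral_sq {T C c κ M : ℝ} (hC : 0 ≤ C) (hc : 0 ≤ c) (hκ : 0 ≤ κ)
    {E : ℝ → ℝ} (hE : ContinuousOn E (Icc 0 T)) (hE0 : ∀ t ∈ Icc 0 T, 0 ≤ E t)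
    (h : ∀ t ∈ Icc 0 T, E t ≤ C + ∫ r in (0 : ℝ)..t, (c * E r + κ * E r ^ 2))
    (hM : C * Real.exp ((c + 1) * T) < M) (hκM : κ * M ≤ 1) : ∀ t ∈ Icc 0 T, E t ≤ M := by
  intro t₀ ht₀
  by_contra hlt
  rw [not_le] at hlt
  have hT : 0 ≤ T := ht₀.1.trans ht₀.2
  obtain ⟨S, hS⟩ : ∃ S, S = Icc 0 T ∩ E ⁻¹' Ici M := ⟨_, rfl⟩
  have hSc : IsCompact S := by
    rw [hS]
    exact isCompact_Icc.of_isClosed_subset (hE.preimage_isClosed_of_isClosed isClosed_Icc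
      isClosed_Ici) inter_subset_left
  obtain ⟨t, htS, hmin⟩ := hSc.exists_isLeast ⟨t₀, by rw [hS]; exact ⟨ht₀, hlt.le⟩⟩
  have htT : t ∈ Icc 0 T := by rw [hS] at htS; exact htS.1
  have htM : M ≤ E t := by rw [hS] at htS; exact htS.2
  have hbelow : ∀ r ∈ Ico 0 t, E r < M := fun r hr => by
    by_contra hge
    exact absurd (hmin (by rw [hS]; exact ⟨⟨hr.1, hr.2.le.trans htT.2⟩, not_lt.1 hge⟩)) (not_le.2 hr.2)
  -- A continuous extension to the whole line, as the linear Gronwall lemma assumes.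
  obtain ⟨F, hF⟩ : ∃ F, F = IccExtend hT ((Icc 0 T).domRestrict E) := ⟨_, rfl⟩
  have hFc : Continuous F := by rw [hF]; exact (continuousOn_iff_continuous_domRestrict.1 hE).Icc_extend'
  have hFE : ∀ r ∈ Icc 0 T, F r = E r := fun r hr => by
    rw [hF, IccExtend_of_mem hT _ hr]; rfl
  have hkey : ∀ r ∈ Icc 0 t, F r ≤ C + (c + 1) * ∫ s in (0 : ℝ)..r, F s := by
    intro r hr
    have hrT : r ∈ Icc 0 T := ⟨hr.1, hr.2.trans htT.2⟩
    have hsub : Icc 0 r ⊆ Icc 0 T := Icc_subset_Icc_right hrT.2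
    rw [hFE r hrT, ← intervalIntegral.integral_const_mul]
    refine (h r hrT).trans (add_le_add le_rfl ?_)
    refine intervalIntegral.integral_mono_on_of_le_Ioo hr.1 ?_
      ((continuous_const.mul hFc).intervalIntegrable _ _) fun s hs => ?_
    · refine ContinuousOn.intervalIntegrable ?_
      rw [uIcc_of_le hr.1]
      exact (continuousOn_const.mul (hE.mono hsub)).add (continuousOn_const.mul ((hE.mono hsub).pow 2))
    · have hsT : s ∈ Icc 0 T := hsub (Ioo_subset_Icc_self hs)
      rw [hFE s hsT]
      have h1 := hbelow s ⟨hs.1.le, hs.2.trans_le hr.2⟩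
      have h2 := hE0 s hsT
      have h3 : κ * E s ≤ 1 := (mul_le_mul_of_nonneg_left h1.le hκ).trans hκM
      nlinarith
  have hfin := le_exp_of_le_add_integral (by linarith) htT.1 hFc hkey
  rw [hFE t htT] at hfin
  have : C * Real.exp ((c + 1) * t) ≤ C * Real.exp ((c + 1) * T) := by
    gcongr
    exact htT.2
  linarith

/-! ### Pointwise bounds by mean squares -/

/-- Averaging `2m|f| ≤ f² + m²` with `m` the mean of `|f|`. -/
theorem avg_abs_sq_le {ℓ : ℝ} (hℓ : 0 < ℓ) {f : ℝ → ℝ} (hf : ContinuousOn f (cell ℓ)) :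
    (avg ℓ fun x => |f x|) ^ 2 ≤ avg ℓ fun x => f x ^ 2 := by
  obtain ⟨m, hm⟩ : ∃ m, m = avg ℓ fun x => |f x| := ⟨_, rfl⟩
  have h := avg_mono hℓ (f := fun x => 2 * m * |f x|) (g := fun x => f x ^ 2 + m ^ 2)
    (continuousOn_const_mul _ hf.abs) (continuousOn_fun_add (hf.pow 2) continuousOn_const)
    (fun x _ => by nlinarith [sq_nonneg (|f x| - m), sq_abs (f x)])
  rw [avg_const_mul, avg_add hℓ (f := fun x => f x ^ 2) (hf.pow 2) continuousOn_const,
    avg_const hℓ, ← hm] at h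
  rw [← hm]
  linarith

theorem abs_sub_le_mul_avg {ℓ : ℝ} (hℓ : 0 < ℓ) {f f' : ℝ → ℝ}
    (hf : ∀ x ∈ cell ℓ, HasDerivWithinAt f (f' x) (cell ℓ) x) (hf' : ContinuousOn f' (cell ℓ))
    {x y : ℝ} (hx : x ∈ cell ℓ) (hy : y ∈ cell ℓ) :
    |f y - f x| ≤ ℓ * avg ℓ fun x => |f' x| := by
  wlog hxy : x ≤ y generalizing x y
  · rw [abs_sub_comm]; exact this hy hx (le_of_not_ge hxy)
  have hsub : Icc x y ⊆ cell ℓ := Icc_subset_Icc hx.1 hy.2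
  have hIntg : IntervalIntegrable f' volume x y :=
    ContinuousOn.intervalIntegrable (by rw [uIcc_of_le hxy]; exact hf'.mono hsub)
  have h := intervalIntegral.integral_eq_sub_of_hasDerivAt_of_le hxy
    (fun z hz => ((hf z (hsub hz)).continuousWithinAt).mono hsub)
    (fun z hz => (hf z (hsub (Ioo_subset_Icc_self hz))).hasDerivAt
      (Icc_mem_nhds (hx.1.trans_lt hz.1) (hz.2.trans_le hy.2))) hIntg
  have e : ℓ * avg ℓ (fun x => |f' x|) = ∫ x in (-(ℓ / 2))..(ℓ / 2), |f' x| := by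
    rw [avg, mul_inv_cancel_left₀ hℓ.ne']
  rw [e, ← h]
  refine (intervalIntegral.abs_integral_le_integral_abs hxy).trans ?_
  exact intervalIntegral.integral_mono_interval hx.1 hxy hy.2
    (.of_forall fun z => abs_nonneg _) (intervalIntegrable_cell hℓ hf'.abs)

/-- Periodicity and Rolle's theorem give a zero of `v'`; integrating `v''` from it bounds `v'` by
the mean of `|v''|`. -/
theorem C3Per.sq_one_le {ℓ : ℝ} {v v₁ v₂ v₃ : ℝ → ℝ} (h : C3Per ℓ v v₁ v₂ v₃) (hℓ : 0 < ℓ) {x : ℝ}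
    (hx : x ∈ cell ℓ) : v₁ x ^ 2 ≤ ℓ ^ 2 * avg ℓ fun x => v₂ x ^ 2 := by
  obtain ⟨c, hc, hc0⟩ := exists_hasDerivAt_eq_zero (f := v) (f' := v₁)
    (show -(ℓ / 2) < ℓ / 2 by linarith) h.cont_zero h.end_zero
    (fun z hz => (h.deriv_zero z (Ioo_subset_Icc_self hz)).hasDerivAt (Icc_mem_nhds hz.1 hz.2))
  have h1 := abs_sub_le_mul_avg hℓ h.deriv_one h.cont_two (Ioo_subset_Icc_self hc) hx
  rw [hc0, sub_zero] at h1
  have h2 := pow_le_pow_left₀ (abs_nonneg _) h1 2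
  rw [sq_abs, mul_pow] at h2
  exact h2.trans (mul_le_mul_of_nonneg_left (avg_abs_sq_le hℓ h.cont_two) (sq_nonneg ℓ))

theorem fc_const {ℓ : ℝ} (hℓ : 0 < ℓ) (c : ℝ) : fc ℓ (fun _ => c) 0 = c := by
  simp only [fc, coef, neg_zero, fexp_zero, one_mul, intervalIntegral.integral_const]
  rw [Complex.real_smul, ← mul_assoc, ← Complex.ofReal_inv, ← Complex.ofReal_mul,
    show ℓ⁻¹ * (ℓ / 2 - -(ℓ / 2)) = 1 by field_simp; ring, Complex.ofReal_one, one_mul]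

/-- The deviation from the mean is the mean of `f(x) - f(y)` over `y`, each at most `ℓm`. -/
theorem abs_le_norm_fc_add {ℓ m : ℝ} (hℓ : 0 < ℓ) {f f' : ℝ → ℝ}
    (hf : ∀ x ∈ cell ℓ, HasDerivWithinAt f (f' x) (cell ℓ) x) (hf' : ∀ x ∈ cell ℓ, |f' x| ≤ m)
    {x : ℝ} (hx : x ∈ cell ℓ) : |f x| ≤ ‖fc ℓ f 0‖ + ℓ * m := by
  have hm : 0 ≤ m := (abs_nonneg _).trans (hf' x hx)
  have hfc : ContinuousOn f (cell ℓ) := fun z hz => (hf z hz).continuousWithinAt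
  have h := norm_fc_le hℓ (f := fun y => f x - f y) (C := ℓ * m) (fun y hy => ?_) 0
  · rw [fc_sub hℓ continuousOn_const hfc, fc_const hℓ] at h
    have h2 := norm_sub_norm_le (f x : ℂ) (fc ℓ f 0)
    rw [Complex.norm_real, Real.norm_eq_abs] at h2
    linarith
  · have h1 := (convex_Icc (-(ℓ / 2)) (ℓ / 2)).norm_image_sub_le_of_norm_hasDerivWithin_le
      (f := f) (f' := f') hf hf' hy hx
    rw [Real.norm_eq_abs, Real.norm_eq_abs] at h1
    refine h1.trans ?_
    rw [mul_comm]
    refine mul_le_mul_of_nonneg_right (abs_le.2 ⟨?_, ?_⟩) hm <;> linarith [hx.1, hx.2, hy.1, hy.2]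

/-! ### The energy estimate for the remainder -/

/-- The dissipation `-4λ⁴|z|²` completes the square with `2λ²|z||F|` and leaves `|F|²/4`. Dividing
by `b` afterwards keeps the gain `1/b` on the forcing, with no loss in the linear term. -/
theorem mode_energy_ineq {lm b σ : ℝ} (hb : 1 ≤ b) (hσ : σ ≤ -2 * lm ^ 2 + 1) (z F : ℂ) :
    lm ^ 2 * (2 * inner ℝ z (((b⁻¹ : ℝ) : ℂ) * ((σ : ℂ) * z + F))) ≤
      2 * (lm ^ 2 * ‖z‖ ^ 2) + ‖F‖ ^ 2 / (4 * b) := by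
  have hb0 : 0 < b := by linarith
  have e : inner ℝ z (((b⁻¹ : ℝ) : ℂ) * ((σ : ℂ) * z + F)) = b⁻¹ * (σ * ‖z‖ ^ 2 + inner ℝ z F) := by
    rw [← Complex.real_smul, ← Complex.real_smul, real_inner_smul_right, inner_add_right,
      real_inner_smul_right, real_inner_self_eq_norm_sq]
  have h1 : inner ℝ z F ≤ ‖z‖ * ‖F‖ := real_inner_le_norm z F
  have h2 : 2 * lm ^ 2 * (σ * ‖z‖ ^ 2 + inner ℝ z F) ≤ 2 * (lm ^ 2 * ‖z‖ ^ 2) + ‖F‖ ^ 2 / 4 := by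
    have h3 := mul_le_mul_of_nonneg_right hσ (sq_nonneg ‖z‖)
    have h4 := mul_le_mul_of_nonneg_left (add_le_add h3 h1) (by positivity : 0 ≤ 2 * lm ^ 2)
    nlinarith [sq_nonneg (2 * lm ^ 2 * ‖z‖ - ‖F‖ / 2)]
  have h3 : b⁻¹ ≤ 1 := inv_le_one_of_one_le₀ hb
  have h4 := mul_le_mul_of_nonneg_left h2 (inv_pos.2 hb0).le
  have h5 : b⁻¹ * (2 * (lm ^ 2 * ‖z‖ ^ 2)) ≤ 2 * (lm ^ 2 * ‖z‖ ^ 2) :=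
    mul_le_of_le_one_left (by positivity) h3
  have e2 : ‖F‖ ^ 2 / (4 * b) = b⁻¹ * (‖F‖ ^ 2 / 4) := by field_simp
  rw [e, e2]
  linarith

/-- Here `p`, `r`, `n` are the moduli of the coefficients of `Φ_ηρ_η`, `ρ_η²`, `Φ_η²`, and `x`, `y`
those of `Φ`, `Φ_τ`. The dangerous terms are `6ελp` and `3ε²λr`: since `ελ ≤ b` and `ελ ≤ λ`, one
has `(ελ)² ≤ bλ`, so after division by `b` each costs a single derivative of a product of first
derivatives, which `ρ_ηη` controls. -/
theorem sq_forcing_div_le {ε lm b p r n x y f : ℝ} (hε : 0 ≤ ε) (hε1 : ε ≤ 1) (hl : 0 ≤ lm)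
    (hb : 1 ≤ b) (hlb : ε * lm ≤ b) (hf0 : 0 ≤ f)
    (hf : f ≤ p + ε / 2 * r + 3 * lm * (n + 2 * ε * p + ε ^ 2 * r)
      + (4 * lm ^ 2 * x + 5 * lm * y)) :
    f ^ 2 / (4 * b) ≤ 63 * (p ^ 2 + lm * p ^ 2) + 16 * ε ^ 2 * (r ^ 2 + lm * r ^ 2)
      + 16 * (lm ^ 2 * n ^ 2) + 44 * (lm ^ 4 * x ^ 2 + lm ^ 2 * y ^ 2) := by
  have hb0 : 0 < b := by linarith
  have h7 : ∀ a₁ a₂ a₃ a₄ a₅ a₆ a₇ : ℝ, (a₁ + a₂ + a₃ + a₄ + a₅ + a₆ + a₇) ^ 2 ≤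
      7 * (a₁ ^ 2 + a₂ ^ 2 + a₃ ^ 2 + a₄ ^ 2 + a₅ ^ 2 + a₆ ^ 2 + a₇ ^ 2) := by
    intro a₁ a₂ a₃ a₄ a₅ a₆ a₇
    have := sq_sum_le_card_mul_sum_sq (s := Finset.univ) (f := ![a₁, a₂, a₃, a₄, a₅, a₆, a₇])
    simpa [Fin.sum_univ_succ, add_assoc] using this
  have h1 := (pow_le_pow_left₀ hf0 hf 2).trans_eq (by ring :
    _ = (p + ε / 2 * r + 3 * lm * n + 6 * (ε * lm) * p + 3 * (ε * (ε * lm)) * r + 4 * lm ^ 2 * x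
      + 5 * lm * y) ^ 2)
  have h2 := h1.trans (h7 _ _ _ _ _ _ _)
  have hεl : 0 ≤ ε * lm := mul_nonneg hε hl
  have hle : (ε * lm) ^ 2 ≤ b * lm := by
    rw [pow_two]
    exact mul_le_mul hlb (mul_le_of_le_one_left hl hε1) hεl hb0.le
  have k1 := mul_le_mul_of_nonneg_right hle (sq_nonneg p)
  have k2 := mul_le_mul_of_nonneg_right hle (sq_nonneg (ε * r))
  have k3 : ∀ a : ℝ, 0 ≤ a → a ≤ b * a := fun a ha => le_mul_of_one_le_left ha hb
  have k4 := k3 (p ^ 2) (sq_nonneg p)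
  have k5 := k3 ((ε * r) ^ 2) (sq_nonneg _)
  have k6 := k3 ((lm * n) ^ 2) (sq_nonneg _)
  have k7 := k3 ((lm ^ 2 * x) ^ 2) (sq_nonneg _)
  have k8 := k3 ((lm * y) ^ 2) (sq_nonneg _)
  rw [div_le_iff₀ (by linarith)]
  refine h2.trans ?_
  have n1 : 0 ≤ b * lm * p ^ 2 := by positivity
  have n2 : 0 ≤ b * lm * (ε * r) ^ 2 := by positivity
  have n3 := sq_nonneg p
  have n4 := sq_nonneg (ε * r)
  have n5 := sq_nonneg (lm * n)
  have n6 := sq_nonneg (lm ^ 2 * x)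
  have n7 := sq_nonneg (lm * y)
  calc _ = 7 * p ^ 2 + 7 / 4 * (ε * r) ^ 2 + 63 * (lm * n) ^ 2 + 252 * ((ε * lm) ^ 2 * p ^ 2)
        + 63 * ((ε * lm) ^ 2 * (ε * r) ^ 2) + 112 * (lm ^ 2 * x) ^ 2 + 175 * (lm * y) ^ 2 := by ring
    _ ≤ 252 * (b * p ^ 2) + 64 * (b * (ε * r) ^ 2) + 64 * (b * (lm * n) ^ 2)
        + 252 * (b * lm * p ^ 2) + 64 * (b * lm * (ε * r) ^ 2) + 176 * (b * (lm ^ 2 * x) ^ 2)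
        + 176 * (b * (lm * y) ^ 2) := by linarith
    _ = _ := by ring

/-- Parseval for the product and its derivative. It is used with `v = Φ_η`, `w = ρ_η`, where the
result is linear in the energy because `m²` is at most a multiple of it. -/
theorem C3Per.sum_mul_le {ℓ a m : ℝ} {v v₁ v₂ v₃ w w₁ w₂ w₃ : ℝ → ℝ} (h : C3Per ℓ v v₁ v₂ v₃)
    (g : C3Per ℓ w w₁ w₂ w₃) (hℓ : 0 < ℓ) (hv : ∀ x ∈ cell ℓ, |v x| ≤ a)
    (hv₁ : ∀ x ∈ cell ℓ, |v₁ x| ≤ a) (hw : ∀ x ∈ cell ℓ, |w x| ≤ m) (s : Finset ℤ) :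
    ∑ k ∈ s, (‖fc ℓ (fun x => v x * w x) k‖ ^ 2 + lam ℓ k * ‖fc ℓ (fun x => v x * w x) k‖ ^ 2) ≤
      3 * a ^ 2 * m ^ 2 + 2 * a ^ 2 * avg ℓ fun x => w₁ x ^ 2 := by
  have hg := h.mul g
  have e1 : ∑ k ∈ s, ‖fc ℓ (fun x => v x * w x) k‖ ^ 2 ≤ (a * m) ^ 2 :=
    sum_sq_fc_le hℓ hg.cont_zero (fun x hx => by
      rw [abs_mul]
      exact mul_le_mul (hv x hx) (hw x hx) (abs_nonneg _) ((abs_nonneg _).trans (hv x hx))) s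
  have e2 : ∑ k ∈ s, lam ℓ k * ‖fc ℓ (fun x => v x * w x) k‖ ^ 2 ≤
      2 * a ^ 2 * m ^ 2 + 2 * a ^ 2 * avg ℓ fun x => w₁ x ^ 2 := by
    simp only [← hg.norm_fc_one hℓ]
    refine (sum_le_hasSum s (fun _ _ => sq_nonneg _) (hasSum_sq_fc hℓ hg.cont_one)).trans ?_
    refine (avg_mono hℓ (g := fun x => 2 * a ^ 2 * m ^ 2 + 2 * a ^ 2 * w₁ x ^ 2)
      (hg.cont_one.pow 2) (continuousOn_fun_add continuousOn_const
        (continuousOn_const_mul _ (g.cont_one.pow 2))) fun x hx => ?_).trans_eq ?_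
    · have k1 : (v₁ x * w x) ^ 2 ≤ a ^ 2 * m ^ 2 := by
        rw [mul_pow]
        exact mul_le_mul (sq_le_sq' (neg_le_of_abs_le (hv₁ x hx)) (le_of_abs_le (hv₁ x hx)))
          (sq_le_sq' (neg_le_of_abs_le (hw x hx)) (le_of_abs_le (hw x hx))) (sq_nonneg _)
          (sq_nonneg _)
      have k2 : (v x * w₁ x) ^ 2 ≤ a ^ 2 * w₁ x ^ 2 := by
        rw [mul_pow]
        exact mul_le_mul_of_nonneg_right
          (sq_le_sq' (neg_le_of_abs_le (hv x hx)) (le_of_abs_le (hv x hx))) (sq_nonneg _)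
      change (v₁ x * w x + v x * w₁ x) ^ 2 ≤ _
      nlinarith [sq_nonneg (v₁ x * w x - v x * w₁ x)]
    · rw [avg_add hℓ continuousOn_const (g := fun x => 2 * a ^ 2 * w₁ x ^ 2)
        (continuousOn_const_mul _ (g.cont_one.pow 2)), avg_const hℓ, avg_const_mul]
  rw [Finset.sum_add_distrib]
  nlinarith

/-- The analogue for `w = ρ_η` squared, quadratic in the energy. -/
theorem C3Per.sum_mul_self_le {ℓ m : ℝ} {w w₁ w₂ w₃ : ℝ → ℝ}
    (g : C3Per ℓ w w₁ w₂ w₃) (hℓ : 0 < ℓ) (hw : ∀ x ∈ cell ℓ, |w x| ≤ m) (s : Finset ℤ) :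
    ∑ k ∈ s, (‖fc ℓ (fun x => w x * w x) k‖ ^ 2 + lam ℓ k * ‖fc ℓ (fun x => w x * w x) k‖ ^ 2) ≤
      m ^ 4 + 4 * m ^ 2 * avg ℓ fun x => w₁ x ^ 2 := by
  have hg := g.mul g
  have e1 : ∑ k ∈ s, ‖fc ℓ (fun x => w x * w x) k‖ ^ 2 ≤ (m * m) ^ 2 :=
    sum_sq_fc_le hℓ hg.cont_zero (fun x hx => by
      rw [abs_mul]
      exact mul_le_mul (hw x hx) (hw x hx) (abs_nonneg _) ((abs_nonneg _).trans (hw x hx))) s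
  have e2 : ∑ k ∈ s, lam ℓ k * ‖fc ℓ (fun x => w x * w x) k‖ ^ 2 ≤
      4 * m ^ 2 * avg ℓ fun x => w₁ x ^ 2 := by
    simp only [← hg.norm_fc_one hℓ]
    refine (sum_le_hasSum s (fun _ _ => sq_nonneg _) (hasSum_sq_fc hℓ hg.cont_one)).trans ?_
    refine (avg_mono hℓ (g := fun x => 4 * m ^ 2 * w₁ x ^ 2) (hg.cont_one.pow 2)
      (continuousOn_const_mul _ (g.cont_one.pow 2)) fun x hx => ?_).trans_eq
      (avg_const_mul _ _ _)
    have := mul_le_mul_of_nonneg_right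
      (sq_le_sq' (neg_le_of_abs_le (hw x hx)) (le_of_abs_le (hw x hx))) (sq_nonneg (w₁ x))
    change (w₁ x * w x + w x * w₁ x) ^ 2 ≤ _
    nlinarith
  rw [Finset.sum_add_distrib]
  nlinarith

theorem continuousOn_fcGrad {ℓ T : ℝ} (hℓ : 0 < ℓ) {f g : ℝ → ℝ → ℝ}
    (hf : MemC 1 4 (Icc 0 T) (cell ℓ) f) (hg : MemC 1 4 (Icc 0 T) (cell ℓ) g) (k : ℤ) :
    ContinuousOn (fun τ => fcGrad ℓ (f τ) (g τ) k) (Icc 0 T) :=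
  continuousOn_fc hℓ (f := fun τ x => dEta ℓ 1 (f τ) x * dEta ℓ 1 (g τ) x)
    ((hf.continuousOn_dEta_uncurry (by norm_num)).mul
      (hg.continuousOn_dEta_uncurry (by norm_num))) k

/-- The mean square of `v_ηη`. -/
def energy (ℓ : ℝ) (v : ℝ → ℝ) : ℝ := avg ℓ fun x => dEta ℓ 2 v x ^ 2

theorem energy_nonneg {ℓ : ℝ} (hℓ : 0 < ℓ) (v : ℝ → ℝ) : 0 ≤ energy ℓ v :=
  mul_nonneg (by positivity)
    (intervalIntegral.integral_nonneg (by linarith) fun _ _ => sq_nonneg _)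

section Remainder

variable {ℓ ε T : ℝ} {Φ₀ : ℝ → ℝ} {Φ ρ : ℝ → ℝ → ℝ}

theorem norm_forcing_le (hε : 0 ≤ ε) (τ : ℝ) (k : ℤ) :
    ‖forcing ℓ ε T Φ ρ τ k‖ ≤ ‖fcGrad ℓ (Φ τ) (ρ τ) k‖ + ε / 2 * ‖fcGrad ℓ (ρ τ) (ρ τ) k‖
      + 3 * lam ℓ k * (‖fcGrad ℓ (Φ τ) (Φ τ) k‖ + 2 * ε * ‖fcGrad ℓ (Φ τ) (ρ τ) k‖
        + ε ^ 2 * ‖fcGrad ℓ (ρ τ) (ρ τ) k‖)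
      + (4 * lam ℓ k ^ 2 * ‖fc ℓ (Φ τ) k‖ + 5 * lam ℓ k * ‖fc ℓ (dTau T Φ τ) k‖) := by
  have hl := lam_nonneg ℓ k
  have hn : ∀ (c : ℝ) (z : ℂ), 0 ≤ c → ‖(c : ℂ) * z‖ = c * ‖z‖ := fun c z hc => by
    rw [norm_mul, Complex.norm_real, Real.norm_of_nonneg hc]
  have hn' : ∀ (c d : ℝ) (z : ℂ), |c| ≤ d → ‖(c : ℂ) * z‖ ≤ d * ‖z‖ := fun c d z hc => by
    rw [norm_mul, Complex.norm_real, Real.norm_eq_abs]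
    exact mul_le_mul_of_nonneg_right hc (norm_nonneg z)
  unfold forcing
  refine (norm_add_le _ _).trans (add_le_add ((norm_add_le _ _).trans (add_le_add ?_ ?_)) ?_)
  · refine (norm_sub_le _ _).trans_eq ?_
    rw [norm_neg, hn _ _ (by positivity)]
  · refine (hn' _ _ _ (abs_symG_le hε hl)).trans (mul_le_mul_of_nonneg_left ?_ (by positivity))
    refine norm_add₃_le.trans_eq ?_
    rw [hn _ _ (by positivity), hn _ _ (by positivity)]
  · exact (norm_add_le _ _).trans (add_le_add (hn' _ _ _ (abs_symH_le hε hl))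
      (hn' _ _ _ (abs_symHτ_le hε hl)))

/-- The mode inequalities are summed over a finite set and bounded uniformly in it; only then does
Parseval give the full energy, so no series is exchanged with the time integral. -/
theorem energy_le_add_integral (hℓ : 0 < ℓ) (hε : 0 < ε) (hε' : ε ≤ 1 / 5)
    (hΦ : IsKSSolution ℓ T Φ₀ Φ)
    (hρ : MemC 1 4 (Icc 0 T) (cell ℓ) ρ) (hρp : ∀ τ ∈ Icc 0 T, PeriodicUpTo ℓ 3 (ρ τ))
    (heq : SolvesRemainderEq ℓ ε T Φ ρ) (hρ0 : ∀ η ∈ cell ℓ, ρ 0 η = 0) {K A : ℝ}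
    (hK : ∀ j ≤ 4, ∀ τ ∈ Icc 0 T, ∀ η ∈ cell ℓ, |dEta ℓ j (Φ τ) η| ≤ K)
    (hA : ∀ t ∈ Icc 0 T, ∀ s : Finset ℤ,
      ∫ r in (0 : ℝ)..t, ∑ k ∈ s, (lam ℓ k ^ 4 * ‖fc ℓ (Φ r) k‖ ^ 2
        + lam ℓ k ^ 2 * ‖fc ℓ (dTau T Φ r) k‖ ^ 2) ≤ A) {t : ℝ} (ht : t ∈ Icc 0 T) :
    energy ℓ (ρ t) ≤ (T * (16 * (8 * (K * K)) ^ 2) + 44 * A)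
      + ∫ r in (0 : ℝ)..t, ((2 + 63 * ((3 * ℓ ^ 2 + 2) * K ^ 2)) * energy ℓ (ρ r)
        + 16 * ε ^ 2 * (ℓ ^ 4 + 4 * ℓ ^ 2) * energy ℓ (ρ r) ^ 2) := by
  have hsub : Icc 0 t ⊆ Icc 0 T := Icc_subset_Icc_right ht.2
  have hii : ∀ {R : ℝ → ℝ}, ContinuousOn R (Icc 0 T) → IntervalIntegrable R volume 0 t :=
    fun hR => ContinuousOn.intervalIntegrable (by rw [uIcc_of_le ht.1]; exact hR.mono hsub)
  have hg := fun {r : ℝ} (hr : r ∈ Icc 0 T) => c3Per_self hℓ (hρ.snd_diff r hr) (hρp r hr)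
  have hg1 := fun {r : ℝ} (hr : r ∈ Icc 0 T) => c3Per_dEta hℓ (hρ.snd_diff r hr) (hρp r hr)
  have cE : ContinuousOn (fun r => energy ℓ (ρ r)) (Icc 0 T) :=
    continuousOn_avg hℓ (f := fun r x => dEta ℓ 2 (ρ r) x ^ 2)
      ((hρ.continuousOn_dEta_uncurry (by norm_num)).pow 2)
  obtain ⟨R, hR⟩ : ∃ R : ℤ → ℝ → ℝ, R = fun k r => 2 * (lam ℓ k ^ 2 * ‖fc ℓ (ρ r) k‖ ^ 2)
    + (63 * (‖fcGrad ℓ (Φ r) (ρ r) k‖ ^ 2 + lam ℓ k * ‖fcGrad ℓ (Φ r) (ρ r) k‖ ^ 2)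
      + 16 * ε ^ 2 * (‖fcGrad ℓ (ρ r) (ρ r) k‖ ^ 2 + lam ℓ k * ‖fcGrad ℓ (ρ r) (ρ r) k‖ ^ 2)
      + 16 * (lam ℓ k ^ 2 * ‖fcGrad ℓ (Φ r) (Φ r) k‖ ^ 2)
      + 44 * (lam ℓ k ^ 4 * ‖fc ℓ (Φ r) k‖ ^ 2 + lam ℓ k ^ 2 * ‖fc ℓ (dTau T Φ r) k‖ ^ 2)) :=
    ⟨_, rfl⟩
  have cρ := fun k => ((continuousOn_fc hℓ hρ.continuousOn_uncurry k).norm.pow 2)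
  have cΦ := fun k => ((hΦ.continuousOn_fc_self hℓ k).norm.pow 2)
  have cτ := fun k => ((hΦ.continuousOn_fc_dTau hℓ k).norm.pow 2)
  have cP := fun k => ((continuousOn_fcGrad hℓ hΦ.mem hρ k).norm.pow 2)
  have cQ := fun k => ((continuousOn_fcGrad hℓ hρ hρ k).norm.pow 2)
  have cN := fun k => ((continuousOn_fcGrad hℓ hΦ.mem hΦ.mem k).norm.pow 2)
  have ch : ∀ k, ContinuousOn (fun r => lam ℓ k ^ 4 * ‖fc ℓ (Φ r) k‖ ^ 2
      + lam ℓ k ^ 2 * ‖fc ℓ (dTau T Φ r) k‖ ^ 2) (Icc 0 T) := fun k =>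
    (continuousOn_const_mul _ (cΦ k)).add (continuousOn_const_mul _ (cτ k))
  have cR : ∀ k, ContinuousOn (R k) (Icc 0 T) := fun k => by
    rw [hR]
    exact (continuousOn_const_mul _ (continuousOn_const_mul _ (cρ k))).add
      ((((continuousOn_const_mul _ ((cP k).add (continuousOn_const_mul _ (cP k)))).add
        (continuousOn_const_mul _ ((cQ k).add (continuousOn_const_mul _ (cQ k))))).add
        (continuousOn_const_mul _ (continuousOn_const_mul _ (cN k)))).add
        (continuousOn_const_mul _ (ch k)))
  have hmode : ∀ k, lam ℓ k ^ 2 * ‖fc ℓ (ρ t) k‖ ^ 2 ≤ ∫ r in (0 : ℝ)..t, R k r := fun k => by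
    have h0 : fc ℓ (ρ 0) k = 0 := by rw [fc_congr hℓ hρ0, fc_zero]
    have hl := lam_nonneg ℓ k
    have h := norm_sq_le_add_integral (w := lam ℓ k ^ 2)
      (continuousOn_fc hℓ hρ.continuousOn_uncurry k)
      (fun r hr => hasDerivAt_fc_remainder hℓ hε hΦ hρ hρp heq hr k) (cR k) (fun r _ => ?_) ht
    · rwa [h0, norm_zero, zero_pow two_ne_zero, mul_zero, zero_add] at h
    · refine (mode_energy_ineq (one_le_symB hε.le hl) (symS_le hε.le hε' hl) _ _).trans ?_
      rw [hR]
      exact add_le_add le_rfl (sq_forcing_div_le hε.le (by linarith) hl (one_le_symB hε.le hl)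
        (mul_le_symB hε.le hl) (norm_nonneg _) (norm_forcing_le hε.le r k))
  have hsumR : ∀ s : Finset ℤ, ∀ r ∈ Icc 0 T, ∑ k ∈ s, R k r ≤
      (((2 + 63 * ((3 * ℓ ^ 2 + 2) * K ^ 2)) * energy ℓ (ρ r)
        + 16 * ε ^ 2 * (ℓ ^ 4 + 4 * ℓ ^ 2) * energy ℓ (ρ r) ^ 2) + 16 * (8 * (K * K)) ^ 2)
        + 44 * ∑ k ∈ s, (lam ℓ k ^ 4 * ‖fc ℓ (Φ r) k‖ ^ 2
          + lam ℓ k ^ 2 * ‖fc ℓ (dTau T Φ r) k‖ ^ 2) := by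
    intro s r hr
    have hE := energy_nonneg hℓ (ρ r)
    -- The Rolle bound on `ρ_η`, which expresses every estimate of the products through the energy.
    obtain ⟨m, hm⟩ : ∃ m, m = √(ℓ ^ 2 * energy ℓ (ρ r)) := ⟨_, rfl⟩
    have hm2 : m ^ 2 = ℓ ^ 2 * energy ℓ (ρ r) := by rw [hm, Real.sq_sqrt (by positivity)]
    have hρm : ∀ x ∈ cell ℓ, |dEta ℓ 1 (ρ r) x| ≤ m := fun x hx => by
      rw [hm]; exact Real.abs_le_sqrt ((hg hr).sq_one_le hℓ hx)
    have h1 := hΦ.c3Per_one hℓ hr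
    have s1 : ∑ k ∈ s, lam ℓ k ^ 2 * ‖fc ℓ (ρ r) k‖ ^ 2 ≤ energy ℓ (ρ r) := by
      simp only [← mul_pow, ← (hg hr).norm_fc_two hℓ]
      exact sum_le_hasSum s (fun _ _ => sq_nonneg _) (hasSum_sq_fc hℓ (hg hr).cont_two)
    have s2 := h1.sum_mul_le (hg1 hr) hℓ (hK 1 (by norm_num) r hr) (hK 2 (by norm_num) r hr) hρm s
    have s3 := (hg1 hr).sum_mul_self_le hℓ hρm s
    have s4 := (h1.mul h1).sum_lam_sq_le hℓ
      (fun x hx => (IsKSSolution.abs_sq_derivs_le hK hr hx).2.2.1) s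
    have e4 : m ^ 4 = (m ^ 2) ^ 2 := by ring
    rw [e4, hm2] at s3
    rw [hm2] at s2
    simp only [hR, fcGrad, Finset.sum_add_distrib, ← Finset.mul_sum] at s2 s3 ⊢
    change _ ≤ _ + 2 * K ^ 2 * energy ℓ (ρ r) at s2
    change _ ≤ _ + 4 * (ℓ ^ 2 * energy ℓ (ρ r)) * energy ℓ (ρ r) at s3
    have s3' := mul_le_mul_of_nonneg_left s3 (by positivity : 0 ≤ 16 * ε ^ 2)
    linarith
  have hfin : ∀ s : Finset ℤ, ∑ k ∈ s, lam ℓ k ^ 2 * ‖fc ℓ (ρ t) k‖ ^ 2 ≤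
      (T * (16 * (8 * (K * K)) ^ 2) + 44 * A)
      + ∫ r in (0 : ℝ)..t, ((2 + 63 * ((3 * ℓ ^ 2 + 2) * K ^ 2)) * energy ℓ (ρ r)
        + 16 * ε ^ 2 * (ℓ ^ 4 + 4 * ℓ ^ 2) * energy ℓ (ρ r) ^ 2) := by
    intro s
    have cE2 : ContinuousOn (fun r => (2 + 63 * ((3 * ℓ ^ 2 + 2) * K ^ 2)) * energy ℓ (ρ r)
        + 16 * ε ^ 2 * (ℓ ^ 4 + 4 * ℓ ^ 2) * energy ℓ (ρ r) ^ 2) (Icc 0 T) :=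
      (continuousOn_const_mul _ cE).add (continuousOn_const_mul _ (cE.pow 2))
    have chs : ContinuousOn (fun r => ∑ k ∈ s, (lam ℓ k ^ 4 * ‖fc ℓ (Φ r) k‖ ^ 2
        + lam ℓ k ^ 2 * ‖fc ℓ (dTau T Φ r) k‖ ^ 2)) (Icc 0 T) :=
      continuousOn_finsetSum s fun k _ => ch k
    have hle := Finset.sum_le_sum fun k (_ : k ∈ s) => hmode k
    rw [← intervalIntegral.integral_finsetSum fun k _ => hii (cR k)] at hle
    refine (hle.trans (intervalIntegral.integral_mono_on ht.1
      (hii (continuousOn_finsetSum s fun k _ => cR k))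
      (hii (continuousOn_fun_add (continuousOn_fun_add cE2 continuousOn_const)
        (continuousOn_const_mul 44 chs))) fun r hr => hsumR s r (hsub hr))).trans ?_
    rw [intervalIntegral.integral_add (hii (continuousOn_fun_add cE2 continuousOn_const))
      (hii (continuousOn_const_mul 44 chs)),
      intervalIntegral.integral_add (hii cE2) intervalIntegrable_const,
      intervalIntegral.integral_const, intervalIntegral.integral_const_mul, sub_zero, smul_eq_mul]
    have h1 := hA t ht s
    have h2 : t * (16 * (8 * (K * K)) ^ 2) ≤ T * (16 * (8 * (K * K)) ^ 2) :=
      mul_le_mul_of_nonneg_right ht.2 (by positivity)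
    linarith
  have hs := hasSum_sq_fc hℓ (hg ht).cont_two
  refine hasSum_le_of_sum_le hs fun s => ?_
  simpa only [(hg ht).norm_fc_two hℓ, mul_pow] using hfin s

end Remainder

/-! ### Bounds for the remainder -/

section Remainder

variable {ℓ ε T : ℝ} {Φ₀ : ℝ → ℝ} {Φ ρ : ℝ → ℝ → ℝ}

theorem forcing_zero (ℓ ε T : ℝ) (Φ ρ : ℝ → ℝ → ℝ) (τ : ℝ) : forcing ℓ ε T Φ ρ τ 0 =
    -fcGrad ℓ (Φ τ) (ρ τ) 0 - (ε / 2 : ℝ) * fcGrad ℓ (ρ τ) (ρ τ) 0 := by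
  simp [forcing, lam_zero, symG, symH, symHτ]

/-- At `k = 0` all symbols vanish except `symB = 1`, so the mean of `ρ` is driven only by `-Φ_ηρ_η -
(ε/2)ρ_η²`, already bounded through `m`. -/
theorem norm_fc_zero_le (hℓ : 0 < ℓ) (hε : 0 < ε) (hε' : ε ≤ 1 / 5) (hΦ : IsKSSolution ℓ T Φ₀ Φ)
    (hρ : MemC 1 4 (Icc 0 T) (cell ℓ) ρ) (hρp : ∀ τ ∈ Icc 0 T, PeriodicUpTo ℓ 3 (ρ τ))
    (heq : SolvesRemainderEq ℓ ε T Φ ρ) (hρ0 : ∀ η ∈ cell ℓ, ρ 0 η = 0) {K m : ℝ}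
    (hK0 : 0 ≤ K) (hK : ∀ j ≤ 4, ∀ τ ∈ Icc 0 T, ∀ η ∈ cell ℓ, |dEta ℓ j (Φ τ) η| ≤ K)
    (hm0 : 0 ≤ m) (hm : ∀ τ ∈ Icc 0 T, ∀ η ∈ cell ℓ, |dEta ℓ 1 (ρ τ) η| ≤ m) {t : ℝ}
    (ht : t ∈ Icc 0 T) : ‖fc ℓ (ρ t) 0‖ ≤ T * (K * m + m * m) := by
  have hfc : ContinuousOn (fun τ => forcing ℓ ε T Φ ρ τ 0) (Icc 0 T) := by
    simp only [forcing_zero]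
    exact (continuousOn_fcGrad hℓ hΦ.mem hρ 0).neg.sub
      (continuousOn_const.mul (continuousOn_fcGrad hℓ hρ hρ 0))
  have h := norm_le_duhamel (a := 0) (σ := 0) (le_refl (0 : ℝ))
    (continuousOn_fc hℓ hρ.continuousOn_uncurry 0) hfc
    (fun r hr => (hasDerivAt_fc_remainder hℓ hε hΦ hρ hρp heq hr 0).congr_deriv (by
      rw [lam_zero, symB_zero, symS_zero]; simp)) ht
  have h0 : fc ℓ (ρ 0) 0 = 0 := by rw [fc_congr hℓ hρ0, fc_zero]
  simp only [h0, norm_zero, mul_zero, zero_mul, neg_zero, Real.exp_zero, one_mul, zero_add] at h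
  refine h.trans ?_
  have hb : ∀ r ∈ Icc 0 t, ‖forcing ℓ ε T Φ ρ r 0‖ ≤ K * m + m * m := fun r hr => by
    have hr' : r ∈ Icc 0 T := ⟨hr.1, hr.2.trans ht.2⟩
    have h1 : ‖fcGrad ℓ (Φ r) (ρ r) 0‖ ≤ K * m := norm_fc_le hℓ (fun x hx => by
      rw [abs_mul]
      exact mul_le_mul (hK 1 (by norm_num) r hr' x hx) (hm r hr' x hx) (abs_nonneg _) hK0) 0
    have h2 : ‖fcGrad ℓ (ρ r) (ρ r) 0‖ ≤ m * m := norm_fc_le hℓ (fun x hx => by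
      rw [abs_mul]
      exact mul_le_mul (hm r hr' x hx) (hm r hr' x hx) (abs_nonneg _) hm0) 0
    rw [forcing_zero]
    refine (norm_sub_le _ _).trans ?_
    rw [norm_neg, norm_mul, Complex.norm_real, Real.norm_of_nonneg (by positivity)]
    have h3 : ε / 2 * ‖fcGrad ℓ (ρ r) (ρ r) 0‖ ≤ 1 * (m * m) :=
      mul_le_mul (by linarith) h2 (norm_nonneg _) zero_le_one
    linarith
  refine (intervalIntegral.integral_mono_on ht.1 (ContinuousOn.intervalIntegrable (by
    rw [uIcc_of_le ht.1]; exact hfc.norm.mono (Icc_subset_Icc_right ht.2)))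
    intervalIntegrable_const hb).trans ?_
  rw [intervalIntegral.integral_const, sub_zero, smul_eq_mul]
  exact mul_le_mul_of_nonneg_right ht.2 (by positivity)

/-- The remainder and its first derivative are bounded uniformly in `ε`. -/
theorem exists_remainder_bound (hℓ : 0 < ℓ) (hT : 0 < T) (hΦ : IsKSSolution ℓ T Φ₀ Φ) :
    ∃ ε₀ ∈ Ioo (0 : ℝ) (1 / 2), ∃ m₀ m₁ : ℝ, 0 ≤ m₀ ∧ 0 ≤ m₁ ∧
      ∀ ε ∈ Ioc 0 ε₀, ∀ ρ : ℝ → ℝ → ℝ, MemC 1 4 (Icc 0 T) (cell ℓ) ρ →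
        (∀ τ ∈ Icc 0 T, PeriodicUpTo ℓ 3 (ρ τ)) → SolvesRemainderEq ℓ ε T Φ ρ →
        (∀ η ∈ cell ℓ, ρ 0 η = 0) →
        ∀ τ ∈ Icc 0 T, ∀ η ∈ cell ℓ, |ρ τ η| ≤ m₀ ∧ |dEta ℓ 1 (ρ τ) η| ≤ m₁ := by
  obtain ⟨K, hK0, hK⟩ := hΦ.mem.exists_bound
  obtain ⟨A, hA⟩ := hΦ.exists_integral_bound hℓ
  have hA0 : 0 ≤ A := by simpa using hA 0 ⟨le_rfl, hT.le⟩ ∅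
  obtain ⟨C, hC⟩ : ∃ C, C = T * (16 * (8 * (K * K)) ^ 2) + 44 * A := ⟨_, rfl⟩
  obtain ⟨c, hc⟩ : ∃ c, c = 2 + 63 * ((3 * ℓ ^ 2 + 2) * K ^ 2) := ⟨_, rfl⟩
  obtain ⟨q, hq⟩ : ∃ q, q = 16 * (ℓ ^ 4 + 4 * ℓ ^ 2) := ⟨_, rfl⟩
  -- The added 1 provides the strict inequality of the continuation argument.
  obtain ⟨M, hM⟩ : ∃ M, M = C * Real.exp ((c + 1) * T) + 1 := ⟨_, rfl⟩
  have hC0 : 0 ≤ C := by rw [hC]; positivity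
  have hc0 : 0 ≤ c := by rw [hc]; positivity
  have hq0 : 0 ≤ q := by rw [hq]; positivity
  have hM0 : 0 ≤ M := by rw [hM]; positivity
  have hqM : 0 < q * M + 1 := by positivity
  obtain ⟨m, hm⟩ : ∃ m, m = √(ℓ ^ 2 * M) := ⟨_, rfl⟩
  have hm0 : 0 ≤ m := by rw [hm]; positivity
  -- The value `1/5` is the threshold of `symS_le`; the other one gives `ε²qM ≤ 1`, so that the
  -- quadratic term stays below the linear one.
  refine ⟨min (1 / 5) (1 / (q * M + 1)), ⟨lt_min (by norm_num) (by positivity),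
    (min_le_left _ _).trans_lt (by norm_num)⟩, T * (K * m + m * m) + ℓ * m, m, by positivity, hm0,
    fun ε hε ρ hρ hρp heq hρ0 => ?_⟩
  have hε5 : ε ≤ 1 / 5 := hε.2.trans (min_le_left _ _)
  have hεq : ε * (q * M + 1) ≤ 1 := by
    have := hε.2.trans (min_le_right _ _)
    rwa [le_div_iff₀ hqM] at this
  have hκM : 16 * ε ^ 2 * (ℓ ^ 4 + 4 * ℓ ^ 2) * M ≤ 1 := by
    have h1 : ε * ε ≤ ε * 1 := mul_le_mul_of_nonneg_left (by linarith) hε.1.le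
    have h2 := mul_le_mul_of_nonneg_right h1 (mul_nonneg hq0 hM0)
    have e : 16 * ε ^ 2 * (ℓ ^ 4 + 4 * ℓ ^ 2) * M = ε * ε * (q * M) := by rw [hq]; ring
    rw [e]
    linarith [hε.1]
  have hE : ∀ τ ∈ Icc 0 T, energy ℓ (ρ τ) ≤ M := by
    refine le_of_le_add_integral_sq (C := C) (c := c) (κ := 16 * ε ^ 2 * (ℓ ^ 4 + 4 * ℓ ^ 2))
      hC0 hc0 (by positivity) ?_ (fun τ _ => energy_nonneg hℓ (ρ τ)) ?_ (by linarith) hκM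
    · exact continuousOn_avg hℓ (f := fun r x => dEta ℓ 2 (ρ r) x ^ 2)
        ((hρ.continuousOn_dEta_uncurry (by norm_num)).pow 2)
    · intro t ht
      rw [hC, hc]
      exact energy_le_add_integral hℓ hε.1 hε5 hΦ hρ hρp heq hρ0 hK hA ht
  have h1 : ∀ τ ∈ Icc 0 T, ∀ η ∈ cell ℓ, |dEta ℓ 1 (ρ τ) η| ≤ m := fun τ hτ η hη => by
    rw [hm]
    exact Real.abs_le_sqrt (((c3Per_self hℓ (hρ.snd_diff τ hτ) (hρp τ hτ)).sq_one_le hℓ hη).trans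
      (mul_le_mul_of_nonneg_left (hE τ hτ) (sq_nonneg ℓ)))
  refine fun τ hτ η hη => ⟨?_, h1 τ hτ η hη⟩
  refine (abs_le_norm_fc_add hℓ (c3Per_self hℓ (hρ.snd_diff τ hτ) (hρp τ hτ)).deriv_zero
    (h1 τ hτ) hη).trans (add_le_add ?_ le_rfl)
  exact norm_fc_zero_le hℓ hε.1 hε5 hΦ hρ hρp heq hρ0 hK0 hK hm0 h1 hτ

end Remainder

/-- The bound `m₀` enters twice because the norm contains the supremum of `|f|` in both of its
summands. -/
theorem normC01_le {ℓ T m₀ m₁ : ℝ} (h₀ : 0 ≤ m₀) (h₁ : 0 ≤ m₁) {f : ℝ → ℝ → ℝ}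
    (h : ∀ τ ∈ Icc 0 T, ∀ η ∈ cell ℓ, |f τ η| ≤ m₀ ∧ |dEta ℓ 1 (f τ) η| ≤ m₁) :
    normC01 ℓ T f ≤ ENNReal.ofReal (m₀ + m₁ + m₀) := by
  have he : ∀ {a b : ℝ}, |a| ≤ b → ‖a‖ₑ ≤ ENNReal.ofReal b := fun hab => by
    rw [Real.enorm_eq_ofReal_abs]; exact ENNReal.ofReal_le_ofReal hab
  rw [ENNReal.ofReal_add (by positivity) h₀, ENNReal.ofReal_add h₀ h₁]
  refine add_le_add (iSup₂_le fun τ hτ => add_le_add ?_ ?_) ?_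
  · exact iSup₂_le fun η hη => he (h τ hτ η hη).1
  · exact iSup₂_le fun η hη => he (h τ hτ η hη).2
  · exact iSup₂_le fun η hη => iSup₂_le fun τ hτ => he (h τ hτ η hη).1

theorem abs_front_sub_le {ℓ T ε m₀ : ℝ} (hε : 0 < ε) {Φ ρ : ℝ → ℝ → ℝ}
    (h : ∀ τ ∈ Icc 0 T, ∀ η ∈ cell ℓ, |ρ τ η| ≤ m₀) {t : ℝ} (ht : t ∈ Icc 0 (T / ε ^ 2)) {y : ℝ}
    (hy : |y| ≤ ℓ / (2 * √ε)) :
    |front ε Φ ρ t y - ε * Φ (ε ^ 2 * t) (√ε * y)| ≤ m₀ * ε ^ 2 := by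
  have hτ : ε ^ 2 * t ∈ Icc 0 T := by
    refine ⟨mul_nonneg (sq_nonneg ε) ht.1, ?_⟩
    have := ht.2
    rwa [le_div_iff₀ (by positivity), mul_comm] at this
  have hη : √ε * y ∈ cell ℓ := by
    have hs := Real.sqrt_pos.2 hε
    rw [le_div_iff₀ (by positivity)] at hy
    have h2 : |√ε * y| ≤ ℓ / 2 := by rw [abs_mul, abs_of_pos hs]; linarith
    exact abs_le.1 h2
  have e : front ε Φ ρ t y - ε * Φ (ε ^ 2 * t) (√ε * y) = ρ (ε ^ 2 * t) (√ε * y) * ε ^ 2 := by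
    unfold front; ring
  rw [e, abs_mul, abs_of_nonneg (sq_nonneg ε)]
  exact mul_le_mul_of_nonneg_right (h _ hτ _ hη) (sq_nonneg ε)

end

end KSFront

theorem mainTheorem7 (ℓ₀ α T : ℝ) (hℓ₀ : 0 < ℓ₀) (hα : α ∈ Set.Ioo (0 : ℝ) (1 / 2)) (hT : 0 < T)
    (Φ₀ : ℝ → ℝ) (hΦ₀ : KSFront.MemCSharp ℓ₀ 6 α Φ₀)
    (Φ : ℝ → ℝ → ℝ) (hΦ : KSFront.IsKSSolution ℓ₀ T Φ₀ Φ) :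
    ∃ ε₀ ∈ Set.Ioo (0 : ℝ) (1 / 2), ∃ M : ℝ, 0 < M ∧
      ∀ ε ∈ Set.Ioc (0 : ℝ) ε₀, ∀ ρ : ℝ → ℝ → ℝ,
        KSFront.MemY ℓ₀ α T ρ →
        KSFront.SolvesRemainderEq ℓ₀ ε T Φ ρ →
        (∀ η ∈ KSFront.cell ℓ₀, ρ 0 η = 0) →
        KSFront.normC01 ℓ₀ T ρ ≤ ENNReal.ofReal M ∧
        ∀ t ∈ Set.Icc (0 : ℝ) (T / ε ^ 2), ∀ y : ℝ, |y| ≤ ℓ₀ / (2 * √ε) →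
          |KSFront.front ε Φ ρ t y - ε * Φ (ε ^ 2 * t) (√ε * y)| ≤ M * ε ^ 2 := by
  obtain ⟨ε₀, hε₀, m₀, m₁, h₀, h₁, h⟩ := KSFront.exists_remainder_bound hℓ₀ hT hΦ
  -- The added 1 makes the constant strictly positive.
  refine ⟨ε₀, hε₀, m₀ + m₁ + m₀ + 1, by positivity, fun ε hε ρ hρ heq hρ0 => ?_⟩
  have hb := h ε hε ρ hρ.mem hρ.periodic heq hρ0
  refine ⟨(KSFront.normC01_le h₀ h₁ hb).trans (ENNReal.ofReal_le_ofReal (by linarith)),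
    fun t ht y hy => ?_⟩
  refine (KSFront.abs_front_sub_le hε.1 (fun τ hτ η hη => (hb τ hτ η hη).1) ht hy).trans ?_
  exact mul_le_mul_of_nonneg_right (by linarith) (sq_nonneg ε)
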